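/- **Setting.** Let $N,K\ge 1$ be integers, not both equal to $1$. There are $N$ items; item $i\in[N]$ has a known reward $r_i\in(0,1]$ and an unknown preference $v_i\in(0,1]$. When a set (assortment) $S\subseteq[N]$ with $|S|\le K$ is offered to a user (a *pull*), the user chooses $i\in S$ with probability $v_i/(1+\sum_{j\in S}v_j)$ and makes no purchase with probability $1/(1+\sum_{j\in S}v_j)$, independently over the pulls. For $\mathbf w\in[0,\infty)^N$ let $R(S,\mathbf w)=\sum_{i\in S}r_iw_i/(1+\sum_{j\in S}w_j)$. The best assortment $S_{\mathbf v}$ is the maximiser of $R(S,\mathbf v)$ over $|S|\le K$ (of smallest cardinality, if there are several), and $\theta_{\mathbf v}=R(S_{\mathbf v},\mathbf v)$. Let $\eta_i=(r_i-\theta_{\mathbf v})v_i$, and let $\eta^{(j)}$ be the $j$-th largest of these values. For $i\notin S_{\mathbf v}$ put $\Delta_i=\eta^{(K)}-\eta_i$ if $|S_{\mathbf v}|=K$ and $\Delta_i=-\eta_i$ if $|S_{\mathbf v}|<K$; for $i\in S_{\mathbf v}$ put $\Delta_i=\min\{\eta^{(K)}-\eta^{(K+1)},\ \min_{j\in S_{\mathbf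 v}}(r_j-\theta_{\mathbf v})\}$, where the first term is omitted if $K\ge N$. Assume $\Delta_i\ne0$ for all $i$, and let $$H_1=\sum_{i}\frac1{\Delta_i^2},\qquad H_2=\sum_{i}\frac{v_i+1/K}{\Delta_i^2}+\max_i\frac1{\Delta_i^2}.$$ **Algorithm** (input $N$, $K$, $\mathbf r$, $\delta>0$). Put $\epsilon_\tau=2^{-\tau-3}$, $T_{-1}=0$, $T_\tau=\lceil 8\epsilon_\tau^{-2}\ln(16N(\tau+1)^2/\delta)\rceil$, $I_0=[N]$. In round $\tau=0,1,\dots$: split $I_\tau$ arbitrarily (possibly depending on the past) into $\lceil|I_\tau|/K\rceil$ blocks of size at most $K$. On each block $S$ call $T_\tau-T_{\tau-1}$ times the procedure ExploreSet$(S)$, which offers $S$ repeatedly until a no-purchase occurs and returns, for each $i\in S$, the number $f_i$ of times that $i$ was chosen. For $i\in I_\tau$ let $v_i^{(\tau)}$ be the average of the $f_i$ over all calls so far that involved $i$, $a_i=\max\{0,v_i^{(\tau)}-\epsilon_\tau\}$ and $b_i=\min\{v_i^{(\tau)}+\epsilon_\tau,1\}$. Let $\theta_{\mathbf a}$, $\theta_{\mathbf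 b}$ be the maxima of $R(S,\mathbf a)$, $R(S,\mathbf b)$ over $S\subseteq I_\tau$, $|S|\le K$. Let $C$ be the set of all $i\in I_\tau$ for which there is a $\theta\in[\theta_{\mathbf a},\theta_{\mathbf b}]$ such that $\theta<r_i$ and fewer than $K$ items $j\in I_\tau\setminus\{i\}$ satisfy $(r_j-\theta)a_j>(r_i-\theta)b_i$. If $|C|\le K$ and $r_i>R(C,\mathbf b)$ for all $i\in C$, return $C$; otherwise continue with $I_{\tau+1}=C$. **Theorem.** We have $H_2\le3H_1$. There is an implementation of the algorithm (with an exact implementation of the computation of $C$) and an absolute constant $c>0$ such that the following holds for all such $N,K,\mathbf r,\mathbf v$, all $\delta>0$ and every choice of the partitions. With probability at least $1-\delta$ the algorithm stops, returns $S_{\mathbf v}$, uses at most $c\,\Gamma$ pulls, where $$\Gamma=K^2H_2\ln\Big(\frac N\delta\ln(KH_2)\Big),$$ and runs in at most $$c\,\Big(N\Gamma+N^2\ln N\,\ln\frac{K}{\min_i\Delta_i}\Big)$$ steps. Here the running time is counted on a real RAM with unit cost for memory accesses, for arithmetic operations (including logarithm and rounding) and for comparisons; submitting an assortment or writing down a chosen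 partition costs a number of steps linear in its size, and the time for obtaining the users' choices is not counted. -/

import Mathlib

open MeasureTheory ProbabilityTheory

namespace MNL

/-! ### The choice model, the best assortment and the instance complexities -/

/-- Expected reward `R(S, w)` of the assortment `S` under preferences `w`. -/
noncomputable def reward {N : ℕ} (r w : Fin N → ℝ) (S : Finset (Fin N)) : ℝ :=
  (∑ i ∈ S, r i * w i) / (1 + ∑ j ∈ S, w j)

/-- Choice probabilities: `none` is the no-purchase option, whose preference is `1`. -/
noncomputable def choiceProb {N : ℕ} (v : Fin N → ℝ) (S : Finset (Fin N)) : Option (Fin N) → ℝ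
  | none => 1 / (1 + ∑ j ∈ S, v j)
  | some i => if i ∈ S then v i / (1 + ∑ j ∈ S, v j) else 0

/-- The assortments contained in `I` that respect the capacity `K`. -/
def feasible {N : ℕ} (K : ℕ) (I : Finset (Fin N)) : Finset (Finset (Fin N)) :=
  I.powerset.filter fun S => S.card ≤ K

theorem feasible_nonempty {N : ℕ} (K : ℕ) (I : Finset (Fin N)) : (feasible K I).Nonempty :=
  ⟨∅, by simp [feasible]⟩

/-- Optimal expected reward over the feasible assortments contained in `I`. -/
noncomputable def optReward {N : ℕ} (r : Fin N → ℝ) (K : ℕ) (I : Finset (Fin N))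
    (w : Fin N → ℝ) : ℝ :=
  (feasible K I).sup' (feasible_nonempty K I) (reward r w)

/-- `S` maximises the expected reward and has the smallest cardinality among all maximisers. -/
def IsBest {N : ℕ} (r : Fin N → ℝ) (K : ℕ) (v : Fin N → ℝ) (S : Finset (Fin N)) : Prop :=
  S.card ≤ K ∧ reward r v S = optReward r K Finset.univ v ∧
    ∀ S' : Finset (Fin N), S'.card ≤ K → reward r v S' = optReward r K Finset.univ v →
      S.card ≤ S'.card

theorem exists_isBest {N : ℕ} (r : Fin N → ℝ) (K : ℕ) (v : Fin N → ℝ) :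
    ∃ S, IsBest r K v S := by
  obtain ⟨S₀, hS₀, h₀⟩ := Finset.exists_mem_eq_sup' (feasible_nonempty K (Finset.univ)) (reward r v)
  obtain ⟨S, hS, hmin⟩ := Finset.exists_min_image
    ((feasible K Finset.univ).filter fun S => reward r v S = optReward r K Finset.univ v)
    Finset.card ⟨S₀, Finset.mem_filter.2 ⟨hS₀, h₀.symm⟩⟩
  simp only [Finset.mem_filter, feasible, Finset.mem_powerset, Finset.subset_univ, true_and]
    at hS hmin
  exact ⟨S, hS.1, hS.2, fun S' h1 h2 => hmin S' ⟨h1, h2⟩⟩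

/-- The best assortment `S_v`. -/
noncomputable def best {N : ℕ} (r : Fin N → ℝ) (K : ℕ) (v : Fin N → ℝ) : Finset (Fin N) :=
  (exists_isBest r K v).choose

/-- The advantage `η_i = (r_i - θ_v) v_i`. -/
noncomputable def advantage {N : ℕ} (r : Fin N → ℝ) (K : ℕ) (v : Fin N → ℝ) (i : Fin N) : ℝ :=
  (r i - optReward r K Finset.univ v) * v i

/-- The `j`-th largest advantage `η^(j)`, `1 ≤ j ≤ N`. -/
noncomputable def advantageRank {N : ℕ} (r : Fin N → ℝ) (K : ℕ) (v : Fin N → ℝ) (j : ℕ) : ℝ :=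
  (((Finset.univ : Finset (Fin N)).val.map (advantage r K v)).sort (· ≥ ·)).getD (j - 1) 0

/-- The common gap of the items of the best assortment. If `N ≤ K` there is no `(K+1)`-st
advantage, and the minimum is taken over the remaining terms. -/
noncomputable def innerGap {N : ℕ} (r : Fin N → ℝ) (K : ℕ) (v : Fin N → ℝ) : ℝ :=
  if K < N then
    min (advantageRank r K v K - advantageRank r K v (K + 1))
      (⨅ j : {j // j ∈ best r K v}, (r j - optReward r K Finset.univ v))
  else ⨅ j : {j // j ∈ best r K v}, (r j - optReward r K Finset.univ v)

/-- The reward gap `Δ_i`. -/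
noncomputable def gap {N : ℕ} (r : Fin N → ℝ) (K : ℕ) (v : Fin N → ℝ) (i : Fin N) : ℝ :=
  if i ∈ best r K v then innerGap r K v
  else if (best r K v).card = K then advantageRank r K v K - advantage r K v i
  else - advantage r K v i

noncomputable def H₁ {N : ℕ} (r : Fin N → ℝ) (K : ℕ) (v : Fin N → ℝ) : ℝ :=
  ∑ i, 1 / gap r K v i ^ 2

noncomputable def H₂ {N : ℕ} (r : Fin N → ℝ) (K : ℕ) (v : Fin N → ℝ) : ℝ :=
  (∑ i, (v i + 1 / K) / gap r K v i ^ 2) + ⨆ i, 1 / gap r K v i ^ 2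

/-- `Γ = K² H₂ ln ((N/δ) ln (K H₂))`. -/
noncomputable def pullBound {N : ℕ} (r : Fin N → ℝ) (K : ℕ) (v : Fin N → ℝ) (δ : ℝ) : ℝ :=
  (K : ℝ) ^ 2 * H₂ r K v * Real.log ((N / δ) * Real.log (K * H₂ r K v))

/-- `N Γ + N² ln N ln (K / min_i Δ_i)`. -/
noncomputable def timeBound {N : ℕ} (r : Fin N → ℝ) (K : ℕ) (v : Fin N → ℝ) (δ : ℝ) : ℝ :=
  N * pullBound r K v δ + (N : ℝ) ^ 2 * Real.log N * Real.log (K / ⨅ i, gap r K v i)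

/-- MNL feedback on a probability space: `X t S` is the choice that the user of the `t`-th pull
makes when offered `S`. Different pulls are independent, and each choice from an assortment that
respects the capacity follows the MNL model. (Nothing is assumed on the joint law of the choices
of one user from different assortments, since only one of them is observed.) -/
structure IsFeedback {N : ℕ} {Ω : Type*} [MeasurableSpace Ω] (μ : Measure Ω) (K : ℕ)
    (v : Fin N → ℝ) (X : ℕ → Finset (Fin N) → Ω → Option (Fin N)) : Prop where
  measurable : ∀ t S x, MeasurableSet {ω | X t S ω = x}
  indep : iIndepFun (m := fun _ : ℕ => (⊤ : MeasurableSpace (Finset (Fin N) → Option (Fin N))))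
    (fun t ω S => X t S ω) μ
  law : ∀ t S x, S.card ≤ K → μ {ω | X t S ω = x} = ENNReal.ofReal (choiceProb v S x)

/-! ### The pruning rule -/

/-- Items of `I` that are among the `K` items with the largest values `(r_i - θ) w_i` and satisfy
`r_i > θ`. An item qualifies when fewer than `K` items have a strictly larger value. -/
noncomputable def top {N : ℕ} (r : Fin N → ℝ) (K : ℕ) (I : Finset (Fin N)) (w : Fin N → ℝ)
    (θ : ℝ) : Finset (Fin N) :=
  I.filter fun i => θ < r i ∧
    (I.filter fun j => (r i - θ) * w i < (r j - θ) * w j).card < K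

open Classical in
/-- The pruning rule: keep `i` if it is a top item for some `θ` in `[θ_a, θ_b]`, when item `i` has
preference `b i` and every other item `j` has preference `a j`. -/
noncomputable def prune {N : ℕ} (r : Fin N → ℝ) (K : ℕ) (I : Finset (Fin N)) (a b : Fin N → ℝ) :
    Finset (Fin N) :=
  I.filter fun i => ∃ θ : ℝ, optReward r K I a ≤ θ ∧ θ ≤ optReward r K I b ∧
    i ∈ top r K I (Function.update a i (b i)) θ

/-! ### Computations with a step count

The model is the unit-cost real RAM: reading or writing a memory cell (an array entry, or a cell of
a linked list), an arithmetic operation on real or integer numbers (including logarithm and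
rounding), and a comparison each cost one step. Arrays indexed by the items are functions on
`Fin N`. -/

/-- A value together with the number of steps spent on computing it. -/
structure Timed (α : Type) where
  val : α
  cost : ℕ

instance : Monad Timed where
  pure x := ⟨x, 0⟩
  bind x f := ⟨(f x.val).val, x.cost + (f x.val).cost⟩

/-- Evaluation of an expression made of (at most) `k` elementary operations. -/
def step {α : Type} (k : ℕ) (x : α) : Timed α := ⟨x, k⟩

/-- Traversal of a list, from its end. -/
def foldT {α β : Type} (f : α → β → Timed β) (init : β) : List α → Timed β
  | [] => step 1 init
  | x :: l => do
      let y ← foldT f init l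
      let y ← f x y
      step 2 y

def filterT {α : Type} (p : α → Timed Bool) (l : List α) : Timed (List α) :=
  foldT (fun x acc => do if ← p x then step 2 (x :: acc) else step 1 acc) [] l

def takeT {α : Type} : ℕ → List α → Timed (List α)
  | 0, _ => step 1 []
  | _ + 1, [] => step 2 []
  | k + 1, x :: l => do
      let l' ← takeT k l
      step 4 (x :: l')

/-- Distributes a list alternately over two lists. -/
def splitT {α : Type} : List α → Timed (List α × List α)
  | [] => step 1 ([], [])
  | [x] => step 2 ([x], [])
  | x :: y :: l => do
      let s ← splitT l
      step 6 (x :: s.1, y :: s.2)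

theorem splitT_length {α : Type} : ∀ l : List α,
    (splitT l).val.1.length + (splitT l).val.2.length = l.length
  | [] => rfl
  | [_] => rfl
  | _ :: _ :: l => by
      have h := splitT_length l
      simp only [splitT, bind, step, List.length_cons]
      omega

def mergeT {α : Type} (le : α → α → Timed Bool) : List α → List α → Timed (List α)
  | [], ys => step 2 ys
  | x :: xs, [] => step 2 (x :: xs)
  | x :: xs, y :: ys => do
      if ← le x y then
        let l ← mergeT le xs (y :: ys)
        step 5 (x :: l)
      else
        let l ← mergeT le (x :: xs) ys
        step 5 (y :: l)
termination_by xs ys => xs.length + ys.length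

/-- Merge sort. -/
def sortT {α : Type} (le : α → α → Timed Bool) : List α → Timed (List α)
  | [] => step 1 []
  | [x] => step 2 [x]
  | x :: y :: l => do
      let s := splitT l
      step (s.cost + 6) ()
      let xs ← sortT le (x :: s.val.1)
      let ys ← sortT le (y :: s.val.2)
      mergeT le xs ys
termination_by l => l.length
decreasing_by
  all_goals
    have h := splitT_length l
    simp only [List.length_cons]
    omega

/-- Bisection in a sorted list: shrinks `(lo, hi)` to an interval without list elements inside,
where `ok` holds at the left end and fails at the right end. -/
def searchT (ok : ℝ → Timed Bool) (lo hi : ℝ) (l : List ℝ) : Timed (ℝ × ℝ) :=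
  match h : l.drop (l.length / 2) with
  | [] => step 3 (lo, hi)
  | x :: l₂ => do
      step (4 * l.length + 4) ()
      if ← ok x then searchT ok x hi l₂ else searchT ok lo x (l.take (l.length / 2))
termination_by l.length
decreasing_by
  all_goals
    have h' := congrArg List.length h
    simp only [List.length_drop, List.length_cons, List.length_take] at h' ⊢
    omega

/-- Computes the expected reward of the items of a list. -/
noncomputable def rewardT {N : ℕ} (r w : Fin N → ℝ) (S : List (Fin N)) : Timed ℝ := do
  let s ← foldT (fun i (s : ℝ × ℝ) => step 8 (s.1 + r i * w i, s.2 + w i)) (0, 1) S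
  step 3 (s.1 / s.2)

/-- Expected reward of (up to) `K` items with the largest positive values `(r_i - θ) w_i`. -/
noncomputable def topRewardT {N : ℕ} (r : Fin N → ℝ) (K : ℕ) (I : List (Fin N)) (w : Fin N → ℝ)
    (θ : ℝ) : Timed ℝ := do
  let J ← filterT (fun i => step 2 (decide (θ < r i))) I
  let J ← sortT (fun i j => step 9 (decide ((r j - θ) * w j ≤ (r i - θ) * w i))) J
  let J ← takeT K J
  rewardT r w J

/-- Optimal expected reward: the values `(r_i - θ) w_i` change their order or sign only at the
listed break points, between which the optimum is located by bisection. -/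
noncomputable def optRewardT {N : ℕ} (r : Fin N → ℝ) (K : ℕ) (I : List (Fin N))
    (w : Fin N → ℝ) : Timed ℝ := do
  let P ← foldT (fun i acc =>
      foldT (fun j acc => step 14
        (if w i = w j then acc else (r i * w i - r j * w j) / (w i - w j) :: acc))
        (r i :: acc) I) [] I
  let P ← sortT (fun x y => step 1 (decide (x ≤ y))) P
  let q ← searchT (fun θ => do
    let x ← topRewardT r K I w θ
    step 1 (decide (θ ≤ x))) 0 2 P
  let θ ← step 4 ((q.1 + q.2) / 2)
  topRewardT r K I w θ

/-- Sweep over events `(x, d)` sorted by position: a negative `d` lowers the count from position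
`x` on (inclusively), a positive `d` raises it after position `x`. Reports whether the count drops
below `K` at an event position in `[lo, hi]` that is smaller than `ρ`. -/
noncomputable def sweepT (K : ℕ) (lo hi ρ : ℝ) : ℤ → List (ℝ × ℤ) → Timed Bool
  | _, [] => step 1 false
  | c, e :: es => do
      let c ← step 4 (c + min e.2 0)
      if ← step 8 (decide (lo ≤ e.1 ∧ e.1 ≤ hi ∧ e.1 < ρ ∧ c < K)) then step 1 true
      else
        let c ← step 4 (c + max e.2 0)
        sweepT K lo hi ρ c es

/-- Decides whether item `i` survives: the values `θ` for which item `j` is strictly preferred to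
`i` are given by the linear inequality `θ (a j - b i) < r j * a j - r i * b i`, and a sweep finds
out whether fewer than `K` of them hold for some admissible `θ`. -/
noncomputable def surviveT {N : ℕ} (r : Fin N → ℝ) (K : ℕ) (I : List (Fin N)) (a b : Fin N → ℝ)
    (lo hi : ℝ) (i : Fin N) : Timed Bool := do
  let s ← foldT (fun j (s : ℤ × List (ℝ × ℤ)) => step 30
      (let p := a j - b i
       let q := r j * a j - r i * b i
       if j = i then s
       else if p = 0 then (if 0 < q then (s.1 + 1, s.2) else s)
       else if 0 < p then (s.1 + 1, (q / p, -1) :: s.2)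
       else (s.1, (q / p, 1) :: s.2)))
    (0, [(lo, 0)]) I
  let es ← sortT (fun e e' : ℝ × ℤ =>
    step 7 (decide (e.1 < e'.1 ∨ (e.1 = e'.1 ∧ e.2 ≤ e'.2)))) s.2
  sweepT K lo hi (r i) s.1 es

/-- The implementation of the pruning rule. -/
noncomputable def pruneT {N : ℕ} (r : Fin N → ℝ) (K : ℕ) (I : List (Fin N)) (a b : Fin N → ℝ) :
    Timed (List (Fin N)) := do
  let lo ← optRewardT r K I a
  let hi ← optRewardT r K I b
  filterT (fun i => surviveT r K I a b lo hi i) I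

/-! ### The algorithm -/

/-- What an execution has done so far: the observed choices, latest first, and the number of
elementary steps. -/
structure Ledger (N : ℕ) where
  hist : List (Option (Fin N))
  time : ℕ

/-- Number of pulls. -/
def Ledger.pulls {N : ℕ} (s : Ledger N) : ℕ := s.hist.length

/-- Executions: they keep a ledger. Each unbounded loop is given a maximal number `fuel` of
iterations, and `none` means that some loop has not stopped within it; a result `some _` does not
depend on `fuel`. -/
abbrev Exec (N : ℕ) := StateT (Ledger N) Option

/-- Performs a timed computation and charges its steps. -/
def perform {N : ℕ} {α : Type} (x : Timed α) : Exec N α :=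
  fun s => some (x.val, { s with time := s.time + x.cost })

/-- Offers the assortment `S` to the next user and observes the choice. Here `env t S` is the choice
of the user of pull `t` from `S`; writing down `S` costs `S.length + 1` steps. -/
def pull {N : ℕ} (env : ℕ → Finset (Fin N) → Option (Fin N)) (S : List (Fin N)) :
    Exec N (Option (Fin N)) :=
  fun s => some (env s.pulls S.toFinset,
    { hist := env s.pulls S.toFinset :: s.hist, time := s.time + (S.length + 1) })

/-- Pulls `S` until a no-purchase occurs, counting how often each item of `S` is chosen. -/
def exploreLoop {N : ℕ} (env : ℕ → Finset (Fin N) → Option (Fin N)) (S : List (Fin N)) :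
    ℕ → (Fin N → ℕ) → Exec N (Fin N → ℕ)
  | 0, _ => fun _ => none
  | fuel + 1, f => do
      match ← pull env S with
      | none => perform (step 1 f)
      | some x =>
          let f ← perform (step (2 * S.length + 4)
            (if x ∈ S then Function.update f x (f x + 1) else f))
          exploreLoop env S fuel f

/-- One exploration of the set `S`: the empirical preferences start at `0`. -/
def exploreSet {N : ℕ} (fuel : ℕ) (env : ℕ → Finset (Fin N) → Option (Fin N))
    (S : List (Fin N)) : Exec N (Fin N → ℕ) := do
  let f ← perform (step (S.length + 1) (fun _ => 0))
  exploreLoop env S fuel f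

/-- For each item, the sum of the empirical preferences returned by the explorations that involved
it, and the number of these explorations. -/
structure Stats (N : ℕ) where
  sum : Fin N → ℕ
  calls : Fin N → ℕ

/-- Explores `S` the given number of times. -/
def exploreTimes {N : ℕ} (fuel : ℕ) (env : ℕ → Finset (Fin N) → Option (Fin N))
    (S : List (Fin N)) : ℕ → Stats N → Exec N (Stats N)
  | 0, st => perform (step 1 st)
  | n + 1, st => do
      let f ← exploreSet fuel env S
      let st ← perform (foldT (fun i (st : Stats N) => step 8
        { sum := Function.update st.sum i (st.sum i + f i)
          calls := Function.update st.calls i (st.calls i + 1) }) st S)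
      let st ← perform (step 2 st)
      exploreTimes fuel env S n st

/-- Explores each block of a partition `n` times. -/
def exploreBlocks {N : ℕ} (fuel : ℕ) (env : ℕ → Finset (Fin N) → Option (Fin N)) (n : ℕ) :
    List (List (Fin N)) → Stats N → Exec N (Stats N)
  | [], st => perform (step 1 st)
  | S :: Ss, st => do
      let st ← exploreTimes fuel env S n st
      let st ← perform (step 2 st)
      exploreBlocks fuel env n Ss st

/-- The accuracy `ε_τ = 2^(-τ-3)`. -/
noncomputable def accuracy (τ : ℕ) : ℝ := (1 / 2) ^ (τ + 3)

/-- `T_τ = ⌈(8 / ε_τ²) ln (16 N (τ+1)² / δ)⌉`. -/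
noncomputable def schedule (N : ℕ) (δ : ℝ) (τ : ℕ) : ℕ :=
  ⌈8 / accuracy τ ^ 2 * Real.log (16 * N * ((τ : ℝ) + 1) ^ 2 / δ)⌉₊

/-- `T_τ - T_{τ-1}`, with `T_{-1} = 0`. -/
noncomputable def newCalls (N : ℕ) (δ : ℝ) : ℕ → ℕ
  | 0 => schedule N δ 0
  | τ + 1 => schedule N δ (τ + 1) - schedule N δ τ

/-- A way to choose the partitions: given the choices observed so far and the surviving items `I`,
it splits `I` into `⌈|I| / K⌉` blocks of size at most `K`. -/
def IsPartitionRule {N : ℕ} (K : ℕ)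
    (part : List (Option (Fin N)) → List (Fin N) → List (List (Fin N))) : Prop :=
  ∀ h I, I.Nodup → (part h I).length = ⌈(I.length : ℝ) / K⌉₊ ∧
    (∀ B ∈ part h I, B.length ≤ K) ∧ (part h I).flatten.Perm I

/-- The rounds `τ, τ + 1, …` of the algorithm, with surviving items `I`. Writing down the chosen
partition costs a constant number of steps per item and per block. -/
noncomputable def rounds {N : ℕ} (fuel : ℕ) (env : ℕ → Finset (Fin N) → Option (Fin N))
    (part : List (Option (Fin N)) → List (Fin N) → List (List (Fin N)))
    (r : Fin N → ℝ) (K : ℕ) (δ : ℝ) :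
    ℕ → ℕ → List (Fin N) → Stats N → Exec N (List (Fin N))
  | 0, _, _, _ => fun _ => none
  | k + 1, τ, I, st => do
      let ε ← perform (step 2 (accuracy τ))
      let n ← perform (step 20 (newCalls N δ τ))
      let s ← get
      let Ss ← perform
        (step (2 * I.length + 2 * (part s.hist I).length + 2) (part s.hist I))
      let st ← exploreBlocks fuel env n Ss st
      let ab ← perform (foldT (fun i (ab : (Fin N → ℝ) × (Fin N → ℝ)) => step 12
          (Function.update ab.1 i (max 0 ((st.sum i : ℝ) / st.calls i - ε)),
           Function.update ab.2 i (min ((st.sum i : ℝ) / st.calls i + ε) 1)))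
        ((fun _ => 0), (fun _ => 0)) I)
      let C ← perform (pruneT r K I ab.1 ab.2)
      let R ← perform (rewardT r ab.2 C)
      let above ← perform (foldT (fun i t => step 3 (decide (R < r i) && t)) true C)
      let done ← perform (step (C.length + 2) (decide (C.length ≤ K) && above))
      if done then return C
      else rounds fuel env part r K δ k (τ + 1) C st

/-- The whole algorithm, on the items `0, …, N - 1`. -/
noncomputable def algorithm {N : ℕ} (fuel : ℕ) (env : ℕ → Finset (Fin N) → Option (Fin N))
    (part : List (Option (Fin N)) → List (Fin N) → List (List (Fin N)))
    (r : Fin N → ℝ) (K : ℕ) (δ : ℝ) : Exec N (List (Fin N)) := do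
  let I ← perform (step (2 * N + 1) (List.finRange N))
  let st ← perform (step (2 * N + 1) { sum := fun _ => 0, calls := fun _ => 0 })
  rounds fuel env part r K δ fuel 0 I st

/-- On the feedback `env`, the algorithm stops and returns the items of `C`, and `s` is the ledger
of the whole execution. -/
def Returns {N : ℕ} (env : ℕ → Finset (Fin N) → Option (Fin N))
    (part : List (Option (Fin N)) → List (Fin N) → List (List (Fin N)))
    (r : Fin N → ℝ) (K : ℕ) (δ : ℝ) (C : List (Fin N)) (s : Ledger N) : Prop :=
  ∃ fuel, (algorithm fuel env part r K δ).run { hist := [], time := 0 } = some (C, s)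

end MNL

namespace MNL

/-! ### Values and costs of the elementary list procedures -/

/-! The proof separates a probabilistic statement about counts, a deterministic analysis of one
pruning step, and the verification of the implementation.

Probability. For an item `i` and a base `y`, the weight `y ^ chosen i * (1 + v i * (1 - y)) ^ quits
i` is a martingale over single pulls, whatever assortment is offered next
(`sum_choiceProb_mul_expWeight`). So neither geometric variables nor stopping times are needed.
`potential` adds these weights over the items, finitely many rounds and both signs of the deviation,
each divided by `level`. It starts below `δ` (`potential_zero_le`) and is at least `1` as soon as
some estimate is off by more than its accuracy (`one_le_potential`). The maximal inequality is
proved along the program: `Wins` views an execution as a well-founded decision tree over the answers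
of fresh users, and `Wins.measure_fail_le` is an induction over this tree, conditioning on cylinder
events. Hence it is enough to show that the program succeeds against every sequence of answers that
keeps the counts accurate.

Pruning. Accurate counts give bounds `a ≤ v ≤ b` on the surviving items, with error of order `ε`. A
threshold satisfies `θ ≤ R(S, w)` iff `θ ≤ ∑ i ∈ S, (r i - θ) * w i` (`le_reward_iff`), so the
optima under `a` and `b` enclose `θ_v` within `2Kε`. Therefore the best assortment survives
(`best_subset_prune`), a returned set is the best one (`prune_eq_best`), and an item outside it
survives only if its gap is at most `8Kε` (`gap_le_of_mem_prune`).

Counting. Each pull is a choice of an item or ends the exploration of a block, and a block costs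
about `1/K` per item. An item outside the best assortment pays about `T_τ (v i + ε_τ + 1/K)` up to
its last round, when its gap is still at most `16Kε_τ`; this yields its summand of `H₂`. The best
assortment is explored until the end, and its total preference has to be paid by `H₂` as a whole.
This is `one_add_sum_best_le`; in the case of an unfilled assortment it relies on the factor `1 + ∑
a` kept in `sub_optReward_left_mul_le`.

Implementation. The optimum of the reward is a fixed point in `θ`, and the order and signs of `(r i
- θ) * w i` change only at `O(N²)` break points, so sorting and bisection find it exactly
(`optRewardT_val`). Survival of an item is the question whether a sum of indicators of half-lines
drops below `K`, which a sweep over sorted end points decides (`sweepT_spec`). One pruning step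
costs `O(N² ln N)`, apart from an additive constant that matters only for `N = 1`; the number of
rounds is `O(ln (K / min Δ))`. -/

@[simp] theorem bind_val {α β : Type} (x : Timed α) (f : α → Timed β) :
    (x >>= f).val = (f x.val).val := rfl

@[simp] theorem bind_cost {α β : Type} (x : Timed α) (f : α → Timed β) :
    (x >>= f).cost = x.cost + (f x.val).cost := rfl

@[simp] theorem step_val {α : Type} (k : ℕ) (x : α) : (step k x).val = x := rfl

@[simp] theorem step_cost {α : Type} (k : ℕ) (x : α) : (step k x).cost = k := rfl

theorem foldT_val {α β : Type} (f : α → β → Timed β) (init : β) (l : List α) :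
    (foldT f init l).val = l.foldr (fun x y => (f x y).val) init := by
  induction l with
  | nil => rfl
  | cons x l ih => simp [foldT, ih]

theorem foldT_cost_le {α β : Type} (f : α → β → Timed β) (init : β) (l : List α) (c : ℕ)
    (h : ∀ x ∈ l, ∀ y, (f x y).cost ≤ c) :
    (foldT f init l).cost ≤ (c + 2) * l.length + 1 := by
  induction l with
  | nil => simp [foldT]
  | cons x l ih =>
      have h1 := ih fun x hx => h x (List.mem_cons_of_mem _ hx)
      have h2 := h x List.mem_cons_self (foldT f init l).val
      simp only [foldT, bind_cost, step_cost, List.length_cons]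
      nlinarith

theorem filterT_val {α : Type} (p : α → Timed Bool) (l : List α) :
    (filterT p l).val = l.filter fun x => (p x).val := by
  rw [filterT, foldT_val]
  induction l with
  | nil => rfl
  | cons x l ih =>
      rw [List.foldr_cons, ih, List.filter_cons]
      by_cases h : (p x).val = true <;> simp [h]

theorem filterT_cost_le {α : Type} (p : α → Timed Bool) (l : List α) (c : ℕ)
    (h : ∀ x ∈ l, (p x).cost ≤ c) : (filterT p l).cost ≤ (c + 4) * l.length + 1 := by
  refine foldT_cost_le _ _ _ (c + 2) fun x hx y => ?_
  have := h x hx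
  by_cases h' : (p x).val = true <;> simp [h'] <;> omega

theorem takeT_val {α : Type} : ∀ (k : ℕ) (l : List α), (takeT k l).val = l.take k
  | 0, _ => by simp [takeT]
  | _ + 1, [] => by simp [takeT]
  | k + 1, x :: l => by simp [takeT, takeT_val k l]

theorem takeT_cost_le {α : Type} : ∀ (k : ℕ) (l : List α), (takeT k l).cost ≤ 4 * l.length + 2
  | 0, _ => by simp [takeT]
  | _ + 1, [] => by simp [takeT]
  | k + 1, x :: l => by
      have := takeT_cost_le k l
      simp only [takeT, bind_cost, step_cost, List.length_cons]
      omega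

theorem splitT_perm {α : Type} : ∀ l : List α, ((splitT l).val.1 ++ (splitT l).val.2).Perm l
  | [] => by simp [splitT]
  | [x] => by simp [splitT]
  | x :: y :: l => by
      have h := splitT_perm l
      simp only [splitT, bind_val, step_val, List.cons_append]
      exact (List.perm_middle.trans (h.cons y)).cons x

theorem splitT_length_fst {α : Type} : ∀ l : List α,
    (splitT l).val.1.length = (l.length + 1) / 2
  | [] => by simp [splitT]
  | [x] => by simp [splitT]
  | x :: y :: l => by
      have h := splitT_length_fst l
      simp only [splitT, bind_val, step_val, List.length_cons, h]
      omega

theorem splitT_cost_le {α : Type} : ∀ l : List α, (splitT l).cost ≤ 3 * l.length + 1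
  | [] => by simp [splitT]
  | [x] => by simp [splitT]
  | x :: y :: l => by
      have h := splitT_cost_le l
      simp only [splitT, bind_cost, step_cost, List.length_cons]
      omega

theorem mergeT_perm {α : Type} (le : α → α → Timed Bool) (xs ys : List α) :
    (mergeT le xs ys).val.Perm (xs ++ ys) := by
  fun_induction mergeT le xs ys with
  | case1 ys => simp
  | case2 x xs => simp
  | case3 x xs y ys ih1 ih2 =>
      by_cases h : (le x y).val = true
      · simpa [h] using ih1
      · simp only [bind_val, h, if_false, step_val, Bool.false_eq_true]
        exact (ih2.cons y).trans List.perm_middle.symm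

theorem mergeT_cost_le {α : Type} (le : α → α → Timed Bool) (c : ℕ)
    (hc : ∀ x y, (le x y).cost ≤ c) (xs ys : List α) :
    (mergeT le xs ys).cost ≤ (c + 5) * (xs.length + ys.length) + 2 := by
  fun_induction mergeT le xs ys with
  | case1 ys => simp
  | case2 x xs => simp
  | case3 x xs y ys ih1 ih2 =>
      have := hc x y
      by_cases h : (le x y).val = true <;>
        simp only [bind_cost, h, if_true, if_false, step_cost, Bool.false_eq_true,
          List.length_cons] at ih1 ih2 ⊢ <;> nlinarith

theorem mergeT_pairwise {α : Type} (le : α → α → Timed Bool)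
    (htotal : ∀ x y, (le x y).val = true ∨ (le y x).val = true)
    (htrans : ∀ x y z, (le x y).val = true → (le y z).val = true → (le x z).val = true)
    (xs ys : List α) (hxs : xs.Pairwise fun x y => (le x y).val = true)
    (hys : ys.Pairwise fun x y => (le x y).val = true) :
    (mergeT le xs ys).val.Pairwise fun x y => (le x y).val = true := by
  fun_induction mergeT le xs ys with
  | case1 ys => simpa using hys
  | case2 x xs => simpa using hxs
  | case3 x xs y ys ih1 ih2 =>
      have hx := List.pairwise_cons.1 hxs
      have hy := List.pairwise_cons.1 hys
      by_cases h : (le x y).val = true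
      · simp only [bind_val, h, if_true, step_val, List.pairwise_cons]
        refine ⟨fun z hz => ?_, ih1 hx.2 hys⟩
        rw [(mergeT_perm le _ _).mem_iff, List.mem_append, List.mem_cons] at hz
        rcases hz with hz | rfl | hz
        · exact hx.1 z hz
        · exact h
        · exact htrans _ _ _ h (hy.1 z hz)
      · simp only [bind_val, h, if_false, step_val, List.pairwise_cons, Bool.false_eq_true]
        have h' := (htotal x y).resolve_left h
        refine ⟨fun z hz => ?_, ih2 hxs hy.2⟩
        rw [(mergeT_perm le _ _).mem_iff, List.mem_append, List.mem_cons] at hz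
        rcases hz with (rfl | hz) | hz
        · exact h'
        · exact htrans _ _ _ h' (hx.1 z hz)
        · exact hy.1 z hz

theorem sortT_perm {α : Type} (le : α → α → Timed Bool) (l : List α) :
    (sortT le l).val.Perm l := by
  fun_induction sortT le l with
  | case1 => simp
  | case2 x => simp
  | case3 x y l s ih1 ih2 =>
      simp only [bind_val]
      refine (mergeT_perm le _ _).trans ((ih1.append ih2).trans ?_)
      rw [List.cons_append]
      exact (List.perm_middle.trans ((splitT_perm l).cons y)).cons x

theorem sortT_pairwise {α : Type} (le : α → α → Timed Bool)
    (htotal : ∀ x y, (le x y).val = true ∨ (le y x).val = true)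
    (htrans : ∀ x y z, (le x y).val = true → (le y z).val = true → (le x z).val = true)
    (l : List α) : (sortT le l).val.Pairwise fun x y => (le x y).val = true := by
  fun_induction sortT le l with
  | case1 => simp
  | case2 x => simp
  | case3 x y l s ih1 ih2 =>
      simp only [bind_val]
      exact mergeT_pairwise le htotal htrans _ _ ih1 ih2

theorem sortT_cost_le {α : Type} (le : α → α → Timed Bool) (c : ℕ)
    (hc : ∀ x y, (le x y).cost ≤ c) (l : List α) :
    (sortT le l).cost ≤ (c + 11) * (l.length * Nat.clog 2 l.length) + 2 * l.length + 1 := by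
  fun_induction sortT le l with
  | case1 => simp
  | case2 x => simp
  | case3 x y l s ih1 ih2 =>
      have h1 := splitT_length_fst l
      have h2 := splitT_length l
      have h3 := splitT_cost_le l
      have h4 := mergeT_cost_le le c hc (sortT le (x :: s.val.1)).val (sortT le (y :: s.val.2)).val
      rw [(sortT_perm le _).length_eq, (sortT_perm le _).length_eq] at h4
      simp only [bind_cost, step_cost, List.length_cons, s] at ih1 ih2 h4 ⊢
      set m := (splitT l).val.1.length
      set k := (splitT l).val.2.length
      -- The larger half has `m + 1`, that is half the length rounded up, elements, so `Nat.clog`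
      -- drops by exactly one per level of the recursion.
      have hclog : Nat.clog 2 (l.length + 1 + 1) = Nat.clog 2 (m + 1) + 1 := by
        rw [Nat.clog_of_two_le (by norm_num) (by omega)]
        congr 2
        omega
      have hle : Nat.clog 2 (k + 1) ≤ Nat.clog 2 (m + 1) := Nat.clog_mono_right _ (by omega)
      rw [hclog]
      set q := Nat.clog 2 (m + 1)
      have hl : l.length = m + k := h2.symm
      rw [hl] at h3 ⊢
      have h5 : (k + 1) * Nat.clog 2 (k + 1) ≤ (k + 1) * q := Nat.mul_le_mul_left _ hle
      have h6 : (c + 11) * ((k + 1) * Nat.clog 2 (k + 1)) ≤ (c + 11) * ((k + 1) * q) :=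
        Nat.mul_le_mul_left _ h5
      nlinarith

/-- The list at least halves in each iteration: walking to the middle costs a geometric series, and
`ok` is called at most once per binary digit of the length. -/
theorem searchT_cost_le (ok : ℝ → Timed Bool) (c : ℕ) (hc : ∀ x, (ok x).cost ≤ c) (lo hi : ℝ)
    (l : List ℝ) : (searchT ok lo hi l).cost ≤ 8 * l.length + (c + 4) * Nat.size l.length + 3 := by
  fun_induction searchT ok lo hi l with
  | case1 lo hi l h => simp
  | case2 lo hi l x l₂ h ih1 ih2 =>
      have hlen := congrArg List.length h
      simp only [List.length_drop, List.length_cons] at hlen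
      have hsize : ∀ m, m ≤ l.length / 2 → Nat.size m + 1 ≤ Nat.size l.length := by
        intro m hm
        have hpos : 0 < l.length := by omega
        have h1 : l.length / 2 < 2 ^ (Nat.size l.length - 1) := by
          have h2 := Nat.lt_size_self l.length
          have h3 : 0 < Nat.size l.length := Nat.size_pos.2 hpos
          obtain ⟨n, hn⟩ : ∃ n, Nat.size l.length = n + 1 := ⟨_, (Nat.succ_pred_eq_of_pos h3).symm⟩
          rw [hn] at h2 ⊢
          rw [pow_succ] at h2
          simp only [Nat.add_sub_cancel]
          omega
        have h2 := Nat.size_le.2 (lt_of_le_of_lt hm h1)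
        have h3 : 0 < Nat.size l.length := Nat.size_pos.2 hpos
        omega
      have hcx := hc x
      by_cases hx : (ok x).val = true
      · have := hsize l₂.length (by omega)
        simp only [bind_cost, step_cost, hx, if_true]
        have h6 : 8 * l₂.length ≤ 4 * l.length := by omega
        nlinarith
      · have h4 := hsize (l.take (l.length / 2)).length (by simp)
        have h5 : (l.take (l.length / 2)).length ≤ l.length / 2 := by simp
        simp only [bind_cost, step_cost, hx, if_false, Bool.false_eq_true]
        have h6 : 8 * (l.take (l.length / 2)).length ≤ 4 * l.length := by omega
        nlinarith

/-- Bisection with a threshold predicate on a sorted list. -/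
theorem searchT_spec (ok : ℝ → Timed Bool) (θ : ℝ) (hok : ∀ x, (ok x).val = true ↔ x ≤ θ)
    (lo hi : ℝ) (l : List ℝ) (hl : l.Pairwise (· ≤ ·)) (hlo : lo ≤ θ) (hhi : θ < hi) :
    (searchT ok lo hi l).val.1 ≤ θ ∧ θ < (searchT ok lo hi l).val.2 ∧
      ((searchT ok lo hi l).val.1 = lo ∨ (searchT ok lo hi l).val.1 ∈ l) ∧
      ((searchT ok lo hi l).val.2 = hi ∨ (searchT ok lo hi l).val.2 ∈ l) ∧
      ∀ x ∈ l, x ≤ (searchT ok lo hi l).val.1 ∨ (searchT ok lo hi l).val.2 ≤ x := by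
  fun_induction searchT ok lo hi l with
  | case1 lo hi l h =>
      have hlen := congrArg List.length h
      simp only [List.length_drop, List.length_nil] at hlen
      have : l = [] := List.eq_nil_of_length_eq_zero (by omega)
      subst this
      simp [hlo, hhi]
  | case2 lo hi l x l₂ h ih1 ih2 =>
      have hsplit : l.take (l.length / 2) ++ x :: l₂ = l := by
        rw [← h]; exact List.take_append_drop _ _
      have hmem : ∀ z, z ∈ l ↔ z ∈ l.take (l.length / 2) ∨ z = x ∨ z ∈ l₂ := fun z => by
        conv_lhs => rw [← hsplit]
        simp
      rw [← hsplit, List.pairwise_append, List.pairwise_cons] at hl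
      obtain ⟨hl1, ⟨hx2, hl2⟩, hl3⟩ := hl
      have h1x : ∀ z ∈ l.take (l.length / 2), z ≤ x := fun z hz => hl3 z hz x List.mem_cons_self
      by_cases hx : (ok x).val = true
      · simp only [bind_val, hx, if_true]
        obtain ⟨i1, i2, i3, i4, i5⟩ := ih1 hl2 ((hok x).1 hx) hhi
        have hge : x ≤ (searchT ok x hi l₂).val.1 := by
          rcases i3 with h | h
          · exact h.ge
          · exact hx2 _ h
        refine ⟨i1, i2, Or.inr ((hmem _).2 ?_), i4.imp_right fun h => (hmem _).2 (by tauto),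
          fun z hz => ?_⟩
        · tauto
        · rcases (hmem z).1 hz with h | rfl | h
          · exact Or.inl ((h1x z h).trans hge)
          · exact Or.inl hge
          · exact i5 z h
      · have hxθ : θ < x := not_le.1 fun h => hx ((hok x).2 h)
        simp only [bind_val, hx, if_false, Bool.false_eq_true]
        obtain ⟨i1, i2, i3, i4, i5⟩ := ih2 hl1 hlo hxθ
        have hle : (searchT ok lo x (l.take (l.length / 2))).val.2 ≤ x := by
          rcases i4 with h | h
          · exact h.le
          · exact h1x _ h
        refine ⟨i1, i2, i3.imp_right fun h => (hmem _).2 (by tauto), Or.inr ((hmem _).2 ?_),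
          fun z hz => ?_⟩
        · tauto
        · rcases (hmem z).1 hz with h | rfl | h
          · exact i5 z h
          · exact Or.inr hle
          · exact Or.inr (hle.trans (hx2 z h))

/-! ### Sweeping over events -/

/-- Contribution of the event `e` to the count at position `θ`. -/
noncomputable def eventCount (θ : ℝ) (e : ℝ × ℤ) : ℤ :=
  (if e.1 ≤ θ then min e.2 0 else 0) + if e.1 < θ then max e.2 0 else 0

theorem eventCount_le_self {θ : ℝ} {e : ℝ × ℤ} (h : e.1 ≤ θ) : eventCount θ e ≤ e.2 := by
  unfold eventCount
  rw [if_pos h]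
  split_ifs <;> omega

theorem eventCount_nonpos {θ : ℝ} {e : ℝ × ℤ} (h : θ ≤ e.1) : eventCount θ e ≤ 0 := by
  unfold eventCount
  rw [if_neg h.not_gt]
  split_ifs <;> omega

theorem sum_eventCount_nonpos {θ : ℝ} {es : List (ℝ × ℤ)} (h : ∀ e ∈ es, θ ≤ e.1) :
    (es.map (eventCount θ)).sum ≤ 0 := by
  induction es with
  | nil => simp
  | cons e es ih =>
      have := eventCount_nonpos (h e List.mem_cons_self)
      have := ih fun e he => h e (List.mem_cons_of_mem _ he)
      simp only [List.map_cons, List.sum_cons]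
      omega

theorem sweepT_eq_true_iff (K : ℕ) (lo hi ρ : ℝ) (c : ℤ) (es : List (ℝ × ℤ)) :
    (sweepT K lo hi ρ c es).val = true ↔ ∃ l₁ e l₂, es = l₁ ++ e :: l₂ ∧ lo ≤ e.1 ∧ e.1 ≤ hi ∧
      e.1 < ρ ∧ c + (l₁.map Prod.snd).sum + min e.2 0 < K := by
  induction es generalizing c with
  | nil => simp [sweepT]
  | cons e es ih =>
      simp only [sweepT, bind_val, step_val]
      by_cases h : lo ≤ e.1 ∧ e.1 ≤ hi ∧ e.1 < ρ ∧ c + min e.2 0 < K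
      · simp only [h, and_self, decide_true, if_true, step_val, true_iff]
        exact ⟨[], e, es, rfl, h.1, h.2.1, h.2.2.1, by simpa using h.2.2.2⟩
      · simp only [h, decide_false, Bool.false_eq_true, if_false, bind_val, step_val, ih]
        constructor
        · rintro ⟨l₁, e', l₂, rfl, h1, h2, h3, h4⟩
          refine ⟨e :: l₁, e', l₂, rfl, h1, h2, h3, ?_⟩
          simp only [List.map_cons, List.sum_cons]
          omega
        · rintro ⟨l₁, e', l₂, h0, h1, h2, h3, h4⟩
          rcases l₁ with _ | ⟨e₁, l₁⟩
          · simp only [List.nil_append, List.cons.injEq] at h0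
            obtain ⟨rfl, rfl⟩ := h0
            exact absurd ⟨h1, h2, h3, by simpa using h4⟩ h
          · simp only [List.cons_append, List.cons.injEq] at h0
            obtain ⟨rfl, rfl⟩ := h0
            refine ⟨l₁, e', l₂, rfl, h1, h2, h3, ?_⟩
            simp only [List.map_cons, List.sum_cons] at h4
            omega

/-- The running count of the sweep may be too large at ties, since it includes raising events at the
current position that take effect only to the right of it and omits lowering events still to come.
It is never too small, so a positive report of the sweep is sound. -/
theorem sum_eventCount_le_of_split {l₁ l₂ : List (ℝ × ℤ)} {e : ℝ × ℤ}
    (h₁ : ∀ x ∈ l₁, x.1 ≤ e.1) (h₂ : ∀ x ∈ l₂, e.1 ≤ x.1) :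
    ((l₁ ++ e :: l₂).map (eventCount e.1)).sum ≤ (l₁.map Prod.snd).sum + min e.2 0 := by
  induction l₁ with
  | nil =>
      have := sum_eventCount_nonpos h₂
      simp only [List.nil_append, List.map_cons, List.sum_cons, eventCount, le_refl, if_true,
        lt_irrefl, if_false, List.map_nil, List.sum_nil] at this ⊢
      omega
  | cons x l₁ ih =>
      have h1 := ih fun y hy => h₁ y (List.mem_cons_of_mem _ hy)
      have h2 := eventCount_le_self (h₁ x List.mem_cons_self)
      simp only [List.cons_append, List.map_cons, List.sum_cons] at h1 ⊢
      omega

/-- Completeness of the sweep: between events the count is constant, and at an event it is no larger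
than just after it, because lowering is inclusive and raising is exclusive. So the last relevant
event at or before `θ` does at least as well as `θ`; among ties, lowering events come first in the
order. -/
theorem exists_split_le_sum_eventCount {lo θ : ℝ} {es : List (ℝ × ℤ)}
    (hs : es.Pairwise fun e e' => e.1 < e'.1 ∨ (e.1 = e'.1 ∧ e.2 ≤ e'.2))
    (hex : ∃ e ∈ es, lo ≤ e.1 ∧ e.1 ≤ θ) :
    ∃ l₁ e l₂, es = l₁ ++ e :: l₂ ∧ lo ≤ e.1 ∧ e.1 ≤ θ ∧
      (l₁.map Prod.snd).sum + min e.2 0 ≤ (es.map (eventCount θ)).sum := by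
  induction es with
  | nil => simp at hex
  | cons e es ih =>
      obtain ⟨h1, h2⟩ := List.pairwise_cons.1 hs
      by_cases hex' : ∃ e ∈ es, lo ≤ e.1 ∧ e.1 ≤ θ
      · obtain ⟨e', he', hlo, hθ⟩ := hex'
        have heθ : e.1 ≤ θ := by rcases h1 e' he' with h | h <;> linarith
        by_cases hcase : e.1 < θ ∨ e.2 ≤ 0
        · obtain ⟨l₁, e'', l₂, rfl, i1, i2, i3⟩ := ih h2 ⟨e', he', hlo, hθ⟩
          refine ⟨e :: l₁, e'', l₂, rfl, i1, i2, ?_⟩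
          have : e.2 ≤ eventCount θ e := by
            unfold eventCount
            rw [if_pos heθ]
            split_ifs with h <;> first | omega | (have := hcase.resolve_left h; omega)
          simp only [List.map_cons, List.sum_cons]
          omega
        -- The head lies at `θ` and raises the count. By the sorting all later events at `θ` are
        -- nonnegative too and contribute nothing there, so the sweep has to stop at the head.
        · push Not at hcase
          have heq : e.1 = θ := le_antisymm heθ hcase.1
          have hzero : ∀ x ∈ es, eventCount θ x = 0 := by
            intro x hx
            unfold eventCount
            rcases h1 x hx with h | h
            · rw [if_neg (by linarith), if_neg (by linarith)]; rfl
            · rw [if_neg (by linarith : ¬ x.1 < θ)]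
              split_ifs <;> omega
          refine ⟨[], e, es, rfl, ?_, heθ, ?_⟩
          · linarith
          · simp only [List.map_cons, List.sum_cons, List.map_nil, List.sum_nil]
            rw [List.sum_eq_zero (l := es.map _) (by
              simp only [List.mem_map, forall_exists_index, and_imp]
              rintro _ x hx rfl
              exact hzero x hx)]
            unfold eventCount
            rw [if_pos heθ]
            split_ifs <;> omega
      · obtain ⟨e', he', hlo, hθ⟩ := hex
        obtain rfl : e' = e := by
          rcases List.mem_cons.1 he' with h | h
          · exact h
          · exact absurd ⟨e', h, hlo, hθ⟩ hex'
        have hzero : ∀ x ∈ es, eventCount θ x = 0 := by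
          intro x hx
          have h3 : lo ≤ x.1 := by rcases h1 x hx with h | h <;> linarith
          have h4 : θ < x.1 := not_le.1 fun h => hex' ⟨x, hx, h3, h⟩
          unfold eventCount
          rw [if_neg (by linarith), if_neg (by linarith)]; rfl
        refine ⟨[], e', es, rfl, hlo, hθ, ?_⟩
        simp only [List.map_cons, List.sum_cons, List.map_nil, List.sum_nil]
        rw [List.sum_eq_zero (l := es.map _) (by
              simp only [List.mem_map, forall_exists_index, and_imp]
              rintro _ x hx rfl
              exact hzero x hx)]
        unfold eventCount
        rw [if_pos hθ]
        split_ifs <;> omega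

/-- Replacing `θ` by an event position to its left preserves the constraints `θ ≤ hi` and `θ < ρ`.
The dummy event at `lo` ensures that such a position exists in the admissible range. -/
theorem sweepT_spec (K : ℕ) (lo hi ρ : ℝ) (c : ℤ) (es : List (ℝ × ℤ))
    (hs : es.Pairwise fun e e' => e.1 < e'.1 ∨ (e.1 = e'.1 ∧ e.2 ≤ e'.2))
    (hlo : ∃ e ∈ es, e.1 = lo) :
    (sweepT K lo hi ρ c es).val = true ↔
      ∃ θ, lo ≤ θ ∧ θ ≤ hi ∧ θ < ρ ∧ c + (es.map (eventCount θ)).sum < K := by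
  rw [sweepT_eq_true_iff]
  constructor
  · rintro ⟨l₁, e, l₂, rfl, h1, h2, h3, h4⟩
    refine ⟨e.1, h1, h2, h3, ?_⟩
    rw [List.pairwise_append, List.pairwise_cons] at hs
    have := sum_eventCount_le_of_split (l₁ := l₁) (l₂ := l₂) (e := e)
      (fun x hx => by
        rcases hs.2.2 x hx e List.mem_cons_self with h | h
        · exact h.le
        · exact h.1.le)
      (fun x hx => by
        rcases hs.2.1.1 x hx with h | h
        · exact h.le
        · exact h.1.le)
    omega
  · rintro ⟨θ, h1, h2, h3, h4⟩
    obtain ⟨e, he, rfl⟩ := hlo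
    obtain ⟨l₁, e', l₂, h0, i1, i2, i3⟩ :=
      exists_split_le_sum_eventCount hs ⟨e, he, le_refl _, h1⟩
    exact ⟨l₁, e', l₂, h0, i1, i2.trans h2, i2.trans_lt h3, by omega⟩

theorem sweepT_cost_le (K : ℕ) (lo hi ρ : ℝ) (c : ℤ) (es : List (ℝ × ℤ)) :
    (sweepT K lo hi ρ c es).cost ≤ 16 * es.length + 1 := by
  induction es generalizing c with
  | nil => simp [sweepT]
  | cons e es ih =>
      have := ih (c + min e.2 0 + max e.2 0)
      simp only [sweepT, bind_cost, step_cost, step_val, List.length_cons]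
      by_cases h : lo ≤ e.1 ∧ e.1 ≤ hi ∧ e.1 < ρ ∧ c + min e.2 0 < K
      · simp only [h, and_self, decide_true, if_true, step_cost]
        omega
      · simp only [h, decide_false, Bool.false_eq_true, if_false, bind_cost, step_cost, step_val]
        omega

/-! ### Optimal rewards -/

section Reward

variable {N K : ℕ} {r w : Fin N → ℝ} {I S : Finset (Fin N)} {θ : ℝ}

theorem one_add_sum_pos (hw : ∀ i, 0 ≤ w i) (S : Finset (Fin N)) : 0 < 1 + ∑ j ∈ S, w j := by
  have := Finset.sum_nonneg fun i (_ : i ∈ S) => hw i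
  linarith

/-- Clearing the positive denominator turns the fractional objective into a linear one for each
fixed `θ`. Optimising the reward becomes choosing at most `K` large values `(r i - θ) * w i`. -/
theorem le_reward_iff (hw : ∀ i, 0 ≤ w i) :
    θ ≤ reward r w S ↔ θ ≤ ∑ i ∈ S, (r i - θ) * w i := by
  rw [reward, le_div_iff₀ (one_add_sum_pos hw S)]
  simp only [sub_mul, Finset.sum_sub_distrib, ← Finset.mul_sum]
  constructor <;> intro h <;> linarith

theorem lt_reward_iff (hw : ∀ i, 0 ≤ w i) :
    θ < reward r w S ↔ θ < ∑ i ∈ S, (r i - θ) * w i := by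
  rw [reward, lt_div_iff₀ (one_add_sum_pos hw S)]
  simp only [sub_mul, Finset.sum_sub_distrib, ← Finset.mul_sum]
  constructor <;> intro h <;> linarith

theorem reward_le_iff (hw : ∀ i, 0 ≤ w i) :
    reward r w S ≤ θ ↔ ∑ i ∈ S, (r i - θ) * w i ≤ θ := by
  rw [← not_lt, ← not_lt, lt_reward_iff hw]

theorem sum_sub_reward_mul (hw : ∀ i, 0 ≤ w i) :
    ∑ i ∈ S, (r i - reward r w S) * w i = reward r w S :=
  le_antisymm ((reward_le_iff hw).1 le_rfl) ((le_reward_iff hw).1 le_rfl)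

theorem mem_feasible : S ∈ feasible K I ↔ S ⊆ I ∧ S.card ≤ K := by
  simp [feasible]

theorem reward_le_optReward (h : S ⊆ I) (hK : S.card ≤ K) :
    reward r w S ≤ optReward r K I w :=
  Finset.le_sup' (reward r w) (mem_feasible.2 ⟨h, hK⟩)

theorem exists_reward_eq_optReward (r w : Fin N → ℝ) (K : ℕ) (I : Finset (Fin N)) :
    ∃ S ⊆ I, S.card ≤ K ∧ reward r w S = optReward r K I w := by
  obtain ⟨S, hS, h⟩ := Finset.exists_mem_eq_sup' (feasible_nonempty K I) (reward r w)
  exact ⟨S, (mem_feasible.1 hS).1, (mem_feasible.1 hS).2, h.symm⟩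

theorem optReward_nonneg (r w : Fin N → ℝ) (K : ℕ) (I : Finset (Fin N)) :
    0 ≤ optReward r K I w := by
  have := reward_le_optReward (r := r) (w := w) (Finset.empty_subset I) (K := K) (by simp)
  simpa [reward] using this

theorem reward_lt_one (hr : ∀ i, r i ≤ 1) (hw : ∀ i, 0 ≤ w i) : reward r w S < 1 := by
  rw [reward, div_lt_one (one_add_sum_pos hw S)]
  have := Finset.sum_le_sum fun i (_ : i ∈ S) => mul_le_of_le_one_left (hw i) (hr i)
  linarith

theorem optReward_lt_one (hr : ∀ i, r i ≤ 1) (hw : ∀ i, 0 ≤ w i) : optReward r K I w < 1 := by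
  obtain ⟨S, -, -, h⟩ := exists_reward_eq_optReward r w K I
  exact h ▸ reward_lt_one hr hw

theorem sum_le_optReward (hw : ∀ i, 0 ≤ w i) (h : S ⊆ I) (hK : S.card ≤ K) :
    ∑ i ∈ S, (r i - optReward r K I w) * w i ≤ optReward r K I w :=
  (reward_le_iff hw).1 (reward_le_optReward h hK)

theorem le_optReward (hw : ∀ i, 0 ≤ w i) (h : S ⊆ I) (hK : S.card ≤ K)
    (hθ : θ ≤ ∑ i ∈ S, (r i - θ) * w i) : θ ≤ optReward r K I w :=
  ((le_reward_iff hw).2 hθ).trans (reward_le_optReward h hK)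

/-- A set that collects the `K` largest values of `g`, as far as they are positive. -/
structure IsGreedy (K : ℕ) (I : Finset (Fin N)) (g : Fin N → ℝ) (S : Finset (Fin N)) : Prop where
  subset : S ⊆ I
  card_le : S.card ≤ K
  nonneg : ∀ i ∈ S, 0 ≤ g i
  dominated : ∀ i ∈ I, i ∉ S → g i ≤ 0 ∨ (S.card = K ∧ ∀ j ∈ S, g i ≤ g j)

/-- Exchange argument on the two differences. Either the competitor only adds nonpositive values, or
the greedy set is full; then it has at least as many private elements, each worth at least any
private element of the competitor. -/
theorem IsGreedy.sum_le {g : Fin N → ℝ} (h : IsGreedy K I g S) {S' : Finset (Fin N)}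
    (hS' : S' ⊆ I) (hK : S'.card ≤ K) : ∑ i ∈ S', g i ≤ ∑ i ∈ S, g i := by
  rw [← Finset.sum_inter_add_sum_sdiff S' S, ← Finset.sum_inter_add_sum_sdiff S S',
    Finset.inter_comm S']
  have hcard : S.card = K → (S' \ S).card ≤ (S \ S').card := by
    intro h1
    have h2 := Finset.card_sdiff_add_card_inter S' S
    have h3 := Finset.card_sdiff_add_card_inter S S'
    rw [Finset.inter_comm] at h3
    omega
  gcongr _ + ?_
  have hnn : 0 ≤ ∑ i ∈ S \ S', g i :=
    Finset.sum_nonneg fun i hi => h.nonneg i (Finset.mem_sdiff.1 hi).1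
  by_cases hneg : ∀ i ∈ S' \ S, g i ≤ 0
  · exact (Finset.sum_nonpos hneg).trans hnn
  · push Not at hneg
    obtain ⟨i₀, hi₀, hpos⟩ := hneg
    rw [Finset.mem_sdiff] at hi₀
    have hSK := ((h.dominated i₀ (hS' hi₀.1) hi₀.2).resolve_left hpos.not_ge).1
    have hc := hcard hSK
    have hne : (S \ S').Nonempty := by
      rw [← Finset.card_pos]
      exact lt_of_lt_of_le (Finset.card_pos.2 ⟨i₀, Finset.mem_sdiff.2 hi₀⟩) hc
    obtain ⟨m, hm, hmin⟩ := Finset.exists_min_image (S \ S') g hne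
    have hm0 := h.nonneg m (Finset.mem_sdiff.1 hm).1
    calc ∑ i ∈ S' \ S, g i ≤ (S' \ S).card • g m := by
          refine Finset.sum_le_card_nsmul _ _ _ fun i hi => ?_
          rw [Finset.mem_sdiff] at hi
          rcases h.dominated i (hS' hi.1) hi.2 with h1 | h1
          · exact h1.trans hm0
          · exact h1.2 m (Finset.mem_sdiff.1 hm).1
      _ ≤ (S \ S').card • g m := by
          rw [nsmul_eq_mul, nsmul_eq_mul]
          gcongr
      _ ≤ _ := Finset.card_nsmul_le_sum _ _ _ fun i hi => hmin i hi

/-- A greedy set decides on which side of the optimum a threshold lies. -/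
theorem IsGreedy.le_reward_iff_le_optReward (hw : ∀ i, 0 ≤ w i)
    (h : IsGreedy K I (fun i => (r i - θ) * w i) S) :
    θ ≤ reward r w S ↔ θ ≤ optReward r K I w := by
  refine ⟨fun h1 => h1.trans (reward_le_optReward h.subset h.card_le), fun h1 => ?_⟩
  obtain ⟨S', hS', hK, h'⟩ := exists_reward_eq_optReward r w K I
  rw [← h', le_reward_iff hw] at h1
  exact (le_reward_iff hw).2 (h1.trans (h.sum_le hS' hK))

theorem IsGreedy.reward_eq (hw : ∀ i, 0 ≤ w i)
    (h : IsGreedy K I (fun i => (r i - optReward r K I w) * w i) S) :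
    reward r w S = optReward r K I w :=
  le_antisymm (reward_le_optReward h.subset h.card_le)
    ((h.le_reward_iff_le_optReward hw).2 le_rfl)

/-- Between two break points a greedy set stays greedy. -/
theorem IsGreedy.of_no_breakpoint (hw : ∀ i, 0 ≤ w i) {lo hi θ' : ℝ}
    (h : IsGreedy K I (fun i => (r i - θ) * w i) S) (hS : ∀ i ∈ S, θ < r i)
    (h1 : lo < θ) (h2 : θ < hi) (h1' : lo ≤ θ') (h2' : θ' ≤ hi)
    (hbr : ∀ i ∈ I, r i ≤ lo ∨ hi ≤ r i)
    (hbw : ∀ i ∈ I, ∀ j ∈ I, w i ≠ w j → (r i * w i - r j * w j) / (w i - w j) ≤ lo ∨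
      hi ≤ (r i * w i - r j * w j) / (w i - w j)) :
    IsGreedy K I (fun i => (r i - θ') * w i) S := by
  refine ⟨h.subset, h.card_le, fun i hi => ?_, fun i hi hiS => ?_⟩
  · have := hbr i (h.subset hi)
    have := hS i hi
    refine mul_nonneg ?_ (hw i)
    rcases hbr i (h.subset hi) with h3 | h3 <;> linarith
  · rcases h.dominated i hi hiS with h3 | ⟨h3, h4⟩
    · left
      rcases (hw i).eq_or_lt with h0 | h0
      · simp [← h0]
      · have h5 : r i ≤ θ := by
          by_contra hc
          have := mul_pos (sub_pos.2 (not_le.1 hc)) h0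
          linarith
        refine mul_nonpos_of_nonpos_of_nonneg ?_ (hw i)
        rcases hbr i hi with h6 | h6 <;> linarith
    · right
      refine ⟨h3, fun j hj => ?_⟩
      have h5 := h4 j hj
      by_cases hij : w j = w i
      · rw [hij] at h5 ⊢
        nlinarith
      · have h6 := hbw j (h.subset hj) i hi hij
        have hne : w j - w i ≠ 0 := sub_ne_zero.2 hij
        -- The value of `j` minus that of `i` is `(x - θ) * (w j - w i)`. As `x` lies outside the
        -- open interval between `lo` and `hi`, its sign cannot flip between `θ` and `θ'`.
        set x := (r j * w j - r i * w i) / (w j - w i) with hx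
        have hx' : r j * w j - r i * w i = x * (w j - w i) := by
          rw [hx, div_mul_cancel₀ _ hne]
        have h7 : 0 ≤ (x - θ) * (w j - w i) := by nlinarith
        suffices 0 ≤ (x - θ') * (w j - w i) by nlinarith
        rcases h6 with h6 | h6
        · have : w j - w i ≤ 0 := by
            by_contra hc
            have := mul_neg_of_neg_of_pos (by linarith : x - θ < 0) (not_le.1 hc)
            linarith
          exact mul_nonneg_of_nonpos_of_nonpos (by linarith) this
        · have : 0 ≤ w j - w i := by
            by_contra hc
            have := mul_neg_of_pos_of_neg (by linarith : 0 < x - θ) (not_le.1 hc)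
            linarith
          exact mul_nonneg (by linarith) this

end Reward

/-! ### The implementation computes the pruning rule -/

section Implementation

variable {N K : ℕ} {r w : Fin N → ℝ}

theorem rewardT_val (r w : Fin N → ℝ) {S : List (Fin N)} (hS : S.Nodup) :
    (rewardT r w S).val = reward r w S.toFinset := by
  have h : ∀ l : List (Fin N), l.Nodup →
      l.foldr (fun i (s : ℝ × ℝ) => (s.1 + r i * w i, s.2 + w i)) (0, 1)
        = (∑ i ∈ l.toFinset, r i * w i, 1 + ∑ i ∈ l.toFinset, w i) := by
    intro l hl
    induction l with
    | nil => simp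
    | cons x l ih =>
        rw [List.nodup_cons] at hl
        rw [List.foldr_cons, ih hl.2, List.toFinset_cons,
          Finset.sum_insert (by simpa using hl.1), Finset.sum_insert (by simpa using hl.1)]
        ext <;> simp only <;> ring
  simp only [rewardT, bind_val, foldT_val, step_val, h S hS, reward]

theorem rewardT_cost_le (r w : Fin N → ℝ) (S : List (Fin N)) :
    (rewardT r w S).cost ≤ 10 * S.length + 4 := by
  have := foldT_cost_le (fun i (s : ℝ × ℝ) => step 8 (s.1 + r i * w i, s.2 + w i)) (0, 1) S 8
    (by simp)
  simp only [rewardT, bind_cost, step_cost]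
  omega

/-- The list of items that `topRewardT` selects. -/
theorem exists_topRewardT_eq (hw : ∀ i, 0 ≤ w i) {I : List (Fin N)} (hI : I.Nodup) (θ : ℝ) :
    ∃ S, (∀ i ∈ S, θ < r i) ∧ IsGreedy K I.toFinset (fun i => (r i - θ) * w i) S ∧
      (topRewardT r K I w θ).val = reward r w S := by
  set J := (sortT (fun i j => step 9 (decide ((r j - θ) * w j ≤ (r i - θ) * w i)))
    (I.filter fun i => decide (θ < r i))).val with hJ
  have hperm : J.Perm (I.filter fun i => decide (θ < r i)) := sortT_perm _ _
  have hsort : J.Pairwise fun i j => (r j - θ) * w j ≤ (r i - θ) * w i := by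
    have := sortT_pairwise
      (fun i j => step 9 (decide ((r j - θ) * w j ≤ (r i - θ) * w i)))
      (fun x y => by simpa using le_total _ _)
      (fun x y z h1 h2 => by
        simp only [step_val, decide_eq_true_eq] at h1 h2 ⊢
        exact h2.trans h1) (I.filter fun i => decide (θ < r i))
    simpa using this
  have hnodup : J.Nodup := hperm.nodup_iff.2 (hI.filter _)
  have hmem : ∀ i, i ∈ J ↔ i ∈ I ∧ θ < r i := fun i => by simp [hperm.mem_iff]
  refine ⟨(J.take K).toFinset, ?_, ⟨?_, ?_, ?_, ?_⟩, ?_⟩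
  · intro i hi
    exact ((hmem i).1 (List.mem_of_mem_take (List.mem_toFinset.1 hi))).2
  · intro i hi
    exact List.mem_toFinset.2 ((hmem i).1 (List.mem_of_mem_take (List.mem_toFinset.1 hi))).1
  · exact (List.toFinset_card_le _).trans (by simp)
  · intro i hi
    have := ((hmem i).1 (List.mem_of_mem_take (List.mem_toFinset.1 hi))).2
    exact mul_nonneg (by linarith) (hw i)
  · intro i hi hiS
    by_cases hθ : θ < r i
    · right
      have hiJ : i ∈ J := (hmem i).2 ⟨List.mem_toFinset.1 hi, hθ⟩
      rw [← List.take_append_drop K J, List.mem_append] at hiJ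
      have hdrop := hiJ.resolve_left fun h => hiS (List.mem_toFinset.2 h)
      constructor
      · rw [List.toFinset_card_of_nodup (hnodup.sublist (List.take_sublist _ _)),
          List.length_take, min_eq_left]
        by_contra hc
        rw [List.drop_eq_nil_of_le (by omega)] at hdrop
        simp at hdrop
      · intro j hj
        rw [← List.take_append_drop K J, List.pairwise_append] at hsort
        exact hsort.2.2 j (List.mem_toFinset.1 hj) i hdrop
    · left
      exact mul_nonpos_of_nonpos_of_nonneg (by linarith) (hw i)
  · simp only [topRewardT, bind_val, filterT_val, step_val, takeT_val]
    exact rewardT_val r w (hnodup.sublist (List.take_sublist _ _))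

theorem topRewardT_cost_le (r : Fin N → ℝ) (K : ℕ) (I : List (Fin N)) (w : Fin N → ℝ) (θ : ℝ) :
    (topRewardT r K I w θ).cost ≤ 20 * (I.length * Nat.clog 2 I.length) + 22 * I.length + 10 := by
  simp only [topRewardT, bind_cost, filterT_val, takeT_val]
  have h1 := filterT_cost_le (fun i => step 2 (decide (θ < r i))) I 2 (by simp)
  set J := I.filter fun x => (step 2 (decide (θ < r x))).val
  have h2 := sortT_cost_le (fun i j => step 9 (decide ((r j - θ) * w j ≤ (r i - θ) * w i))) 9
    (by simp) J
  set J' := (sortT (fun i j => step 9 (decide ((r j - θ) * w j ≤ (r i - θ) * w i))) J)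
  have h3 := takeT_cost_le K J'.val
  have h4 := rewardT_cost_le r w (J'.val.take K)
  have h5 : J'.val.length = J.length := (sortT_perm _ _).length_eq
  have h6 : J.length ≤ I.length := List.length_filter_le _ _
  have h7 : (J'.val.take K).length ≤ J'.val.length := by simp
  have h8 : J.length * Nat.clog 2 J.length ≤ I.length * Nat.clog 2 I.length :=
    Nat.mul_le_mul h6 (Nat.clog_mono_right _ h6)
  omega

/-- The break points at which the greedy set may change. -/
noncomputable def breakpoints (r w : Fin N → ℝ) (I : List (Fin N)) : List ℝ :=
  I.foldr (fun i acc => I.foldr (fun j acc =>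
    if w i = w j then acc else (r i * w i - r j * w j) / (w i - w j) :: acc) (r i :: acc)) []

theorem mem_foldr_breakpoints (r w : Fin N → ℝ) (i : Fin N) (J : List (Fin N)) (acc : List ℝ)
    (x : ℝ) : x ∈ J.foldr (fun j acc =>
      if w i = w j then acc else (r i * w i - r j * w j) / (w i - w j) :: acc) acc ↔
      x ∈ acc ∨ ∃ j ∈ J, w i ≠ w j ∧ x = (r i * w i - r j * w j) / (w i - w j) := by
  induction J with
  | nil => simp
  | cons j J ih =>
      rw [List.foldr_cons]
      by_cases h : w i = w j
      · simp [h] at ih ⊢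
        exact ih
      · simp only [h, if_false, List.mem_cons, ih, exists_eq_or_imp]
        tauto

theorem mem_breakpoints {I : List (Fin N)} {x : ℝ} : x ∈ breakpoints r w I ↔
    ∃ i ∈ I, x = r i ∨ ∃ j ∈ I, w i ≠ w j ∧ x = (r i * w i - r j * w j) / (w i - w j) := by
  have h : ∀ J : List (Fin N), x ∈ J.foldr (fun i acc => I.foldr (fun j acc =>
      if w i = w j then acc else (r i * w i - r j * w j) / (w i - w j) :: acc) (r i :: acc)) [] ↔
      ∃ i ∈ J, x = r i ∨ ∃ j ∈ I, w i ≠ w j ∧ x = (r i * w i - r j * w j) / (w i - w j) := by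
    intro J
    induction J with
    | nil => simp
    | cons i J ih =>
        rw [List.foldr_cons, mem_foldr_breakpoints, List.mem_cons, ih]
        simp only [List.mem_cons, exists_eq_or_imp]
        exact or_right_comm
  exact h I

theorem length_breakpoints_le (r w : Fin N → ℝ) (I : List (Fin N)) :
    (breakpoints r w I).length ≤ I.length * (I.length + 1) := by
  have h1 : ∀ (i : Fin N) (J : List (Fin N)) (acc : List ℝ), (J.foldr (fun j acc =>
      if w i = w j then acc else (r i * w i - r j * w j) / (w i - w j) :: acc) acc).length ≤
      acc.length + J.length := by
    intro i J acc
    induction J with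
    | nil => simp
    | cons j J ih =>
        rw [List.foldr_cons]
        split_ifs <;> simp only [List.length_cons] <;> omega
  have h2 : ∀ J : List (Fin N), (J.foldr (fun i acc => I.foldr (fun j acc =>
      if w i = w j then acc else (r i * w i - r j * w j) / (w i - w j) :: acc)
      (r i :: acc)) []).length ≤ J.length * (I.length + 1) := by
    intro J
    induction J with
    | nil => simp
    | cons i J ih =>
        rw [List.foldr_cons]
        refine (h1 _ _ _).trans ?_
        simp only [List.length_cons]
        nlinarith
  exact h2 I

/-- The predicate `ok` holds exactly below the optimum, so bisection encloses the optimum between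
adjacent break points. The greedy set computed at the midpoint is still greedy at the optimum
itself, where greedy sets are optimal. -/
theorem optRewardT_val (hw : ∀ i, 0 ≤ w i) (hr : ∀ i, r i ≤ 1) {I : List (Fin N)}
    (hI : I.Nodup) : (optRewardT r K I w).val = optReward r K I.toFinset w := by
  set θ := optReward r K I.toFinset w with hθ
  set P := (sortT (fun x y : ℝ => step 1 (decide (x ≤ y))) (breakpoints r w I)).val with hP
  have hsort : P.Pairwise (· ≤ ·) := by
    have := sortT_pairwise (fun x y : ℝ => step 1 (decide (x ≤ y)))
      (fun x y => by simpa using le_total x y)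
      (fun x y z h1 h2 => by
        simp only [step_val, decide_eq_true_eq] at h1 h2 ⊢
        exact h1.trans h2) (breakpoints r w I)
    simpa using this
  have hmem : ∀ x, x ∈ P ↔ x ∈ breakpoints r w I := fun x => (sortT_perm _ _).mem_iff
  set ok : ℝ → Timed Bool := fun θ => do
    let x ← topRewardT r K I w θ
    step 1 (decide (θ ≤ x)) with hok
  have hok' : ∀ x, (ok x).val = true ↔ x ≤ θ := by
    intro x
    obtain ⟨S, -, hS, h⟩ := exists_topRewardT_eq (r := r) (K := K) hw hI x
    simp only [hok, bind_val, step_val, decide_eq_true_eq, h]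
    exact hS.le_reward_iff_le_optReward hw
  obtain ⟨h1, h2, -, -, h3⟩ := searchT_spec ok θ hok' 0 2 P hsort (optReward_nonneg _ _ _ _)
    (by have := optReward_lt_one (K := K) (I := I.toFinset) hr hw; linarith)
  have hval : (optRewardT r K I w).val = (topRewardT r K I w
      (((searchT ok 0 2 P).val.1 + (searchT ok 0 2 P).val.2) / 2)).val := by
    simp only [optRewardT, bind_val, foldT_val, step_val]
    rfl
  rw [hval]
  obtain ⟨S, hS, hg, h⟩ := exists_topRewardT_eq (r := r) (K := K) hw hI
    (((searchT ok 0 2 P).val.1 + (searchT ok 0 2 P).val.2) / 2)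
  rw [h]
  -- The midpoint is used because it lies strictly inside the interval, whereas the optimum may
  -- coincide with the left end, where ties and sign changes occur.
  refine IsGreedy.reward_eq hw (hg.of_no_breakpoint hw hS (lo := (searchT ok 0 2 P).val.1)
    (hi := (searchT ok 0 2 P).val.2) (by linarith) (by linarith) h1 h2.le ?_ ?_)
  · intro i hi
    exact h3 _ ((hmem _).2 (mem_breakpoints.2 ⟨i, List.mem_toFinset.1 hi, Or.inl rfl⟩))
  · intro i hi j hj hij
    exact h3 _ ((hmem _).2 (mem_breakpoints.2
      ⟨i, List.mem_toFinset.1 hi, Or.inr ⟨j, List.mem_toFinset.1 hj, hij, rfl⟩⟩))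

/-- The initial count and the events of the sweep for item `i`. -/
noncomputable def events (r a b : Fin N → ℝ) (lo : ℝ) (i : Fin N) (I : List (Fin N)) :
    ℤ × List (ℝ × ℤ) :=
  I.foldr (fun j (s : ℤ × List (ℝ × ℤ)) =>
      (let p := a j - b i
       let q := r j * a j - r i * b i
       if j = i then s
       else if p = 0 then (if 0 < q then (s.1 + 1, s.2) else s)
       else if 0 < p then (s.1 + 1, (q / p, -1) :: s.2)
       else (s.1, (q / p, 1) :: s.2))) (0, [(lo, 0)])

theorem mem_events (r a b : Fin N → ℝ) (lo : ℝ) (i : Fin N) (I : List (Fin N)) :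
    (lo, 0) ∈ (events r a b lo i I).2 := by
  induction I with
  | nil => simp [events]
  | cons j I ih =>
      rw [events, List.foldr_cons, ← events]
      simp only
      split_ifs <;> simp [ih]

theorem length_events_le (r a b : Fin N → ℝ) (lo : ℝ) (i : Fin N) (I : List (Fin N)) :
    (events r a b lo i I).2.length ≤ I.length + 1 := by
  induction I with
  | nil => simp [events]
  | cons j I ih =>
      rw [events, List.foldr_cons, ← events]
      simp only
      split_ifs <;> simp only [List.length_cons] <;> omega

/-- Item `j` beats `i` iff `θ * (a j - b i) < r j * a j - r i * b i`. According to the sign of the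
slope this is a left half-line (counted initially, removed from its end point on), a right half-line
(added after its end point), everything or nothing. -/
theorem events_count (r a b : Fin N → ℝ) (lo θ : ℝ) (i : Fin N) {I : List (Fin N)}
    (hI : I.Nodup) :
    (events r a b lo i I).1 + ((events r a b lo i I).2.map (eventCount θ)).sum =
      ((I.toFinset.filter fun j => (r i - θ) * Function.update a i (b i) i <
        (r j - θ) * Function.update a i (b i) j).card : ℤ) := by
  induction I with
  | nil => simp [events, eventCount]
  | cons j I ih =>
      rw [List.nodup_cons] at hI
      have ih := ih hI.2
      rw [events, List.foldr_cons, ← events, List.toFinset_cons, Finset.filter_insert]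
      simp only [Function.update_self] at ih ⊢
      have hnot : j ∉ I.toFinset.filter fun j => (r i - θ) * b i <
          (r j - θ) * Function.update a i (b i) j := fun h =>
        hI.1 (List.mem_toFinset.1 (Finset.mem_filter.1 h).1)
      by_cases hji : j = i
      · subst hji
        simpa using ih
      · rw [Function.update_of_ne hji]
        have hiff : (r i - θ) * b i < (r j - θ) * a j ↔
            θ * (a j - b i) < r j * a j - r i * b i := by
          constructor <;> intro h <;> linarith
        simp only [hji, if_false]
        by_cases hp : a j - b i = 0
        · by_cases hq : 0 < r j * a j - r i * b i
          · rw [if_pos (hiff.2 (by rw [hp]; linarith)), Finset.card_insert_of_notMem hnot]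
            simp only [hp, hq, if_true]
            push_cast
            linarith
          · rw [if_neg (show ¬ (r i - θ) * b i < (r j - θ) * a j from
              fun h => hq (by have := hiff.1 h; rw [hp] at this; linarith))]
            simpa only [hp, hq, if_true, if_false] using ih
        · by_cases hpos : 0 < a j - b i
          · simp only [hp, hpos, if_true, if_false, List.map_cons, List.sum_cons]
            by_cases h : θ < (r j * a j - r i * b i) / (a j - b i)
            · rw [if_pos (hiff.2 ((lt_div_iff₀ hpos).1 h)), Finset.card_insert_of_notMem hnot]
              simp only [eventCount, h.not_ge, h.not_gt, if_false]
              push_cast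
              linarith
            · rw [if_neg fun h' => h ((lt_div_iff₀ hpos).2 (hiff.1 h'))]
              simp only [eventCount, not_lt.1 h, if_true]
              norm_num
              linarith
          · have hneg : a j - b i < 0 := lt_of_le_of_ne (not_lt.1 hpos) hp
            simp only [hp, hpos, if_false, List.map_cons, List.sum_cons]
            by_cases h : (r j * a j - r i * b i) / (a j - b i) < θ
            · rw [if_pos (hiff.2 ((div_lt_iff_of_neg hneg).1 h)),
                Finset.card_insert_of_notMem hnot]
              simp only [eventCount, h.le, h, if_true]
              push_cast
              norm_num
              linarith
            · rw [if_neg fun h' => h ((div_lt_iff_of_neg hneg).2 (hiff.1 h'))]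
              simp only [eventCount, h, if_false]
              norm_num
              linarith

theorem surviveT_val (r : Fin N → ℝ) (K : ℕ) (a b : Fin N → ℝ) (lo hi : ℝ) {I : List (Fin N)}
    (hI : I.Nodup) {i : Fin N} (hi' : i ∈ I) : (surviveT r K I a b lo hi i).val = true ↔
      ∃ θ, lo ≤ θ ∧ θ ≤ hi ∧ i ∈ top r K I.toFinset (Function.update a i (b i)) θ := by
  set es := (sortT (fun e e' : ℝ × ℤ =>
    step 7 (decide (e.1 < e'.1 ∨ (e.1 = e'.1 ∧ e.2 ≤ e'.2)))) (events r a b lo i I).2).val with hes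
  have hperm : es.Perm (events r a b lo i I).2 := sortT_perm _ _
  have hsort : es.Pairwise fun e e' => e.1 < e'.1 ∨ (e.1 = e'.1 ∧ e.2 ≤ e'.2) := by
    have := sortT_pairwise (fun e e' : ℝ × ℤ =>
        step 7 (decide (e.1 < e'.1 ∨ (e.1 = e'.1 ∧ e.2 ≤ e'.2))))
      (fun x y => by
        simp only [step_val, decide_eq_true_eq]
        rcases lt_trichotomy x.1 y.1 with h | h | h
        · exact Or.inl (Or.inl h)
        · rcases le_total x.2 y.2 with h' | h'
          · exact Or.inl (Or.inr ⟨h, h'⟩)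
          · exact Or.inr (Or.inr ⟨h.symm, h'⟩)
        · exact Or.inr (Or.inl h))
      (fun x y z h1 h2 => by
        simp only [step_val, decide_eq_true_eq] at h1 h2 ⊢
        rcases h1 with h1 | h1 <;> rcases h2 with h2 | h2
        · exact Or.inl (h1.trans h2)
        · exact Or.inl (h2.1 ▸ h1)
        · exact Or.inl (h1.1 ▸ h2)
        · exact Or.inr ⟨h1.1.trans h2.1, h1.2.trans h2.2⟩) (events r a b lo i I).2
    simpa only [step_val, decide_eq_true_eq] using this
  have hval : (surviveT r K I a b lo hi i).val =
      (sweepT K lo hi (r i) (events r a b lo i I).1 es).val := by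
    simp only [surviveT, bind_val, foldT_val, step_val]
    rfl
  rw [hval, sweepT_spec K lo hi (r i) _ es hsort
    ⟨(lo, 0), hperm.mem_iff.2 (mem_events r a b lo i I), rfl⟩]
  refine exists_congr fun θ => and_congr_right fun h1 => and_congr_right fun h2 => ?_
  rw [(hperm.map _).sum_eq, events_count r a b lo θ i hI, top, Finset.mem_filter,
    List.mem_toFinset]
  simp only [hi', true_and, Nat.cast_lt]

theorem pruneT_val {a b : Fin N → ℝ} (hr : ∀ i, r i ≤ 1) (ha : ∀ i, 0 ≤ a i) (hb : ∀ i, 0 ≤ b i)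
    {I : List (Fin N)} (hI : I.Nodup) :
    (pruneT r K I a b).val.toFinset = prune r K I.toFinset a b := by
  ext i
  simp only [pruneT, bind_val, filterT_val, optRewardT_val ha hr hI, optRewardT_val hb hr hI,
    List.mem_toFinset, List.mem_filter, prune, Finset.mem_filter]
  exact and_congr_right fun hi => surviveT_val r K a b _ _ hI hi

theorem pruneT_nodup {a b : Fin N → ℝ} {I : List (Fin N)} (hI : I.Nodup) :
    (pruneT r K I a b).val.Nodup := by
  simp only [pruneT, bind_val, filterT_val]
  exact hI.filter _

/-! ### Cost of the pruning rule -/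

theorem clog_le_self (n : ℕ) : Nat.clog 2 n ≤ n :=
  Nat.clog_le_of_le_pow Nat.lt_two_pow_self.le

theorem clog_length_le {n : ℕ} (hn : n ≤ N * (N + 1)) :
    Nat.clog 2 n ≤ 2 * Nat.clog 2 N + 1 ∧ Nat.size n ≤ 2 * Nat.clog 2 N + 2 := by
  have h : N ≤ 2 ^ Nat.clog 2 N := Nat.le_pow_clog (by norm_num) N
  have h1 : n ≤ 2 ^ (2 * Nat.clog 2 N + 1) := by
    have h2 : 2 ^ (2 * Nat.clog 2 N + 1) = 2 * (2 ^ Nat.clog 2 N * 2 ^ Nat.clog 2 N) := by ring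
    have h3 : 1 ≤ 2 ^ Nat.clog 2 N := Nat.one_le_two_pow
    rw [h2]
    nlinarith
  refine ⟨Nat.clog_le_of_le_pow h1, Nat.size_le.2 (h1.trans_lt ?_)⟩
  exact Nat.pow_lt_pow_right (by norm_num) (by omega)

theorem sq_mul_clog_bounds (hN : 2 ≤ N) : N ^ 2 ≤ N ^ 2 * Nat.clog 2 N ∧
    N * Nat.clog 2 N ^ 2 ≤ N ^ 2 * Nat.clog 2 N ∧ N * Nat.clog 2 N ≤ N ^ 2 * Nat.clog 2 N ∧
    Nat.clog 2 N ≤ N ^ 2 * Nat.clog 2 N ∧ 1 ≤ Nat.clog 2 N := by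
  have h1 : 1 ≤ Nat.clog 2 N := Nat.clog_pos (by norm_num) hN
  have h2 := clog_le_self N
  set q := Nat.clog 2 N
  have h3 : N ≤ N ^ 2 := by nlinarith
  refine ⟨Nat.le_mul_of_pos_right _ h1, ?_, Nat.mul_le_mul_right _ h3,
    Nat.le_mul_of_pos_left _ (by positivity), h1⟩
  calc N * q ^ 2 = N * q * q := by ring
    _ ≤ N * q * N := Nat.mul_le_mul_left _ h2
    _ = N ^ 2 * q := by ring

/-- The summands are the listing of pairs, the sorting of the break points, the bisection and the
final evaluation. The `N ln² N` part of the bisection is absorbed using `Nat.clog 2 N ≤ N`; the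
additive constant is needed for `N ≤ 1`, where the logarithm vanishes. -/
theorem optRewardT_cost_arith (N : ℕ) :
    (16 * N + 3) * N + 1 +
      (12 * (N * (N + 1) * (2 * Nat.clog 2 N + 1)) + 2 * (N * (N + 1)) + 1) +
      (8 * (N * (N + 1)) +
        (20 * (N * Nat.clog 2 N) + 22 * N + 15) * (2 * Nat.clog 2 N + 2) + 3) +
      (20 * (N * Nat.clog 2 N) + 22 * N + 10) + 4 ≤ 500 * (N ^ 2 * Nat.clog 2 N) + 500 := by
  rcases Nat.lt_or_ge N 2 with hN | hN
  · rw [Nat.clog_of_right_le_one (by omega) 2]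
    interval_cases N <;> norm_num
  · obtain ⟨b1, b2, b3, b4, b5⟩ := sq_mul_clog_bounds hN
    have hNN : 2 * N ≤ N ^ 2 := by nlinarith
    generalize Nat.clog 2 N = q at *
    have e1 : (16 * N + 3) * N = 16 * N ^ 2 + 3 * N := by ring
    have e2 : N * (N + 1) * (2 * q + 1) = 2 * (N ^ 2 * q) + N ^ 2 + 2 * (N * q) + N := by ring
    have e3 : N * (N + 1) = N ^ 2 + N := by ring
    have e4 : (20 * (N * q) + 22 * N + 15) * (2 * q + 2) =
      40 * (N * q ^ 2) + 84 * (N * q) + 44 * N + 30 * q + 30 := by ring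
    rw [e1, e2, e3, e4]
    omega

theorem optRewardT_cost_le (r : Fin N → ℝ) (K : ℕ) {I : List (Fin N)} (hI : I.length ≤ N)
    (w : Fin N → ℝ) : (optRewardT r K I w).cost ≤ 500 * (N ^ 2 * Nat.clog 2 N) + 500 := by
  have htop : ∀ θ, (topRewardT r K I w θ).cost ≤ 20 * (N * Nat.clog 2 N) + 22 * N + 10 := by
    intro θ
    have h1 := topRewardT_cost_le r K I w θ
    have h2 : I.length * Nat.clog 2 I.length ≤ N * Nat.clog 2 N :=
      Nat.mul_le_mul hI (Nat.clog_mono_right _ hI)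
    omega
  set ok : ℝ → Timed Bool := fun θ => do
    let x ← topRewardT r K I w θ
    step 1 (decide (θ ≤ x)) with hok
  set F := foldT (fun i acc => foldT (fun j acc => step 14
        (if w i = w j then acc else (r i * w i - r j * w j) / (w i - w j) :: acc))
        (r i :: acc) I) [] I with hF
  have hFval : F.val = breakpoints r w I := by
    simp only [hF, foldT_val, step_val]
    rfl
  set P := sortT (fun x y : ℝ => step 1 (decide (x ≤ y))) F.val with hP
  have hcost : (optRewardT r K I w).cost = F.cost + (P.cost + ((searchT ok 0 2 P.val).cost +
      (4 + (topRewardT r K I w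
        (((searchT ok 0 2 P.val).val.1 + (searchT ok 0 2 P.val).val.2) / 2)).cost))) := by
    simp only [optRewardT, bind_cost, step_cost, step_val]
    rfl
  have hFc : F.cost ≤ (16 * N + 3) * N + 1 := by
    refine (foldT_cost_le _ _ _ (16 * N + 1) fun i _ acc => ?_).trans ?_
    · refine (foldT_cost_le _ _ _ 14 (by simp)).trans ?_
      omega
    · have := Nat.mul_le_mul_left (16 * N + 3) hI
      show (16 * N + 3) * I.length + 1 ≤ _
      omega
  have hlen : F.val.length ≤ N * (N + 1) := by
    rw [hFval]
    exact (length_breakpoints_le r w I).trans (Nat.mul_le_mul hI (by omega))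
  have hPlen : P.val.length = F.val.length := (sortT_perm _ _).length_eq
  obtain ⟨hclog, hsize⟩ := clog_length_le hlen
  have hPc : P.cost ≤ 12 * (N * (N + 1) * (2 * Nat.clog 2 N + 1)) + 2 * (N * (N + 1)) + 1 := by
    refine (sortT_cost_le _ 1 (by simp) _).trans ?_
    have := Nat.mul_le_mul hlen hclog
    omega
  have hSc : (searchT ok 0 2 P.val).cost ≤ 8 * (N * (N + 1)) +
      (20 * (N * Nat.clog 2 N) + 22 * N + 15) * (2 * Nat.clog 2 N + 2) + 3 := by
    refine (searchT_cost_le ok (20 * (N * Nat.clog 2 N) + 22 * N + 11) (fun x => ?_) _ _ _).trans ?_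
    · have := htop x
      simp only [hok, bind_cost, step_cost]
      omega
    · rw [hPlen]
      have := Nat.mul_le_mul_left (20 * (N * Nat.clog 2 N) + 22 * N + 15) hsize
      show 8 * F.val.length + (20 * (N * Nat.clog 2 N) + 22 * N + 15) * F.val.length.size + 3 ≤ _
      omega
  have hT := htop (((searchT ok 0 2 P.val).val.1 + (searchT ok 0 2 P.val).val.2) / 2)
  rw [hcost]
  have := optRewardT_cost_arith N
  omega

theorem surviveT_cost_le (r : Fin N → ℝ) (K : ℕ) {I : List (Fin N)} (hI : I.length ≤ N)
    (hN : 1 ≤ N) (a b : Fin N → ℝ) (lo hi : ℝ) (i : Fin N) :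
    (surviveT r K I a b lo hi i).cost ≤ 200 * (N * (Nat.clog 2 N + 1)) := by
  set F := foldT (fun j (s : ℤ × List (ℝ × ℤ)) => step 30
      (let p := a j - b i
       let q := r j * a j - r i * b i
       if j = i then s
       else if p = 0 then (if 0 < q then (s.1 + 1, s.2) else s)
       else if 0 < p then (s.1 + 1, (q / p, -1) :: s.2)
       else (s.1, (q / p, 1) :: s.2)))
    (0, [(lo, 0)]) I with hF
  have hFval : F.val = events r a b lo i I := by
    simp only [hF, foldT_val, step_val]
    rfl
  have hFc : F.cost ≤ 32 * I.length + 1 := foldT_cost_le _ _ _ 30 (by simp)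
  have hlen : F.val.2.length ≤ N + 1 := by
    have := length_events_le r a b lo i I
    rw [hFval]
    omega
  have hclog : Nat.clog 2 F.val.2.length ≤ Nat.clog 2 N + 1 := by
    refine Nat.clog_le_of_le_pow (hlen.trans ?_)
    have h : N ≤ 2 ^ Nat.clog 2 N := Nat.le_pow_clog (by norm_num) N
    rw [pow_succ]
    omega
  have h1 := sortT_cost_le (fun e e' : ℝ × ℤ =>
    step 7 (decide (e.1 < e'.1 ∨ (e.1 = e'.1 ∧ e.2 ≤ e'.2)))) 7 (by simp) F.val.2
  set es := sortT (fun e e' : ℝ × ℤ =>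
    step 7 (decide (e.1 < e'.1 ∨ (e.1 = e'.1 ∧ e.2 ≤ e'.2)))) F.val.2
  have h2 := sweepT_cost_le K lo hi (r i) F.val.1 es.val
  have h3 : es.val.length = F.val.2.length := (sortT_perm _ _).length_eq
  rw [h3] at h2
  have hcost : (surviveT r K I a b lo hi i).cost =
      F.cost + (es.cost + (sweepT K lo hi (r i) F.val.1 es.val).cost) := rfl
  rw [hcost]
  have h4 := Nat.mul_le_mul hlen hclog
  have h5 : (N + 1) * (Nat.clog 2 N + 1) ≤ 2 * (N * (Nat.clog 2 N + 1)) := by nlinarith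
  have h6 : N ≤ N * (Nat.clog 2 N + 1) := Nat.le_mul_of_pos_right _ (by omega)
  omega

theorem pruneT_cost_le (r : Fin N → ℝ) (K : ℕ) {I : List (Fin N)} (hI : I.length ≤ N)
    (hN : 1 ≤ N) (a b : Fin N → ℝ) :
    (pruneT r K I a b).cost ≤ 1500 * (N ^ 2 * Nat.clog 2 N) + 1500 := by
  simp only [pruneT, bind_cost]
  have h1 := optRewardT_cost_le r K hI a
  have h2 := optRewardT_cost_le r K hI b
  have h3 := filterT_cost_le (fun i => surviveT r K I a b (optRewardT r K I a).val
    (optRewardT r K I b).val i) I (200 * (N * (Nat.clog 2 N + 1)))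
    (fun i _ => surviveT_cost_le r K hI hN a b _ _ i)
  have h4 := Nat.mul_le_mul_left (200 * (N * (Nat.clog 2 N + 1)) + 4) hI
  have h5 : (200 * (N * (Nat.clog 2 N + 1)) + 4) * N =
    200 * (N ^ 2 * Nat.clog 2 N) + 200 * N ^ 2 + 4 * N := by ring
  rcases Nat.lt_or_ge N 2 with h | h
  · obtain rfl : N = 1 := by omega
    omega
  · obtain ⟨b1, -⟩ := sq_mul_clog_bounds h
    have : N ≤ N ^ 2 := by nlinarith
    omega

end Implementation

/-! ### The best assortment and the gaps -/

/-- The standing assumptions on an instance. -/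
structure Regular {N : ℕ} (K : ℕ) (r v : Fin N → ℝ) : Prop where
  two_le : 2 ≤ N * K
  r_pos : ∀ i, 0 < r i
  r_le_one : ∀ i, r i ≤ 1
  v_pos : ∀ i, 0 < v i
  v_le_one : ∀ i, v i ≤ 1
  gap_ne_zero : ∀ i, gap r K v i ≠ 0

/-! ### Order statistics of the advantages -/

section Rank

variable {N K : ℕ} (r v : Fin N → ℝ)

theorem countP_sort_advantage (p : ℝ → Prop) [DecidablePred p] :
    (((Finset.univ : Finset (Fin N)).val.map (advantage r K v)).sort (· ≥ ·)).countP
      (fun x => decide (p x)) = (Finset.univ.filter fun i => p (advantage r K v i)).card := by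
  rw [← Multiset.coe_countP, Multiset.sort_eq, Multiset.countP_map]
  simp [Finset.card_def]

theorem length_sort_advantage :
    (((Finset.univ : Finset (Fin N)).val.map (advantage r K v)).sort (· ≥ ·)).length = N := by
  simp

theorem advantageRank_eq {j : ℕ} (hj : 1 ≤ j) (hjN : j ≤ N) :
    advantageRank r K v j =
      (((Finset.univ : Finset (Fin N)).val.map (advantage r K v)).sort (· ≥ ·))[j - 1]'(by
        rw [length_sort_advantage]; omega) := by
  rw [advantageRank, List.getD_eq_getElem]

theorem le_countP_getElem {l : List ℝ} (hsort : l.Pairwise (· ≥ ·)) {n : ℕ} (hn : n < l.length) :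
    n + 1 ≤ l.countP fun x => decide (l[n] ≤ x) := by
  have h1 : (l.take (n + 1)).countP (fun x => decide (l[n] ≤ x)) = (l.take (n + 1)).length := by
    rw [List.countP_eq_length]
    intro x hx
    obtain ⟨m, hm, rfl⟩ := List.mem_iff_getElem.1 hx
    rw [List.length_take] at hm
    rw [List.getElem_take, decide_eq_true_eq]
    rcases Nat.lt_or_ge m n with h | h
    · exact List.pairwise_iff_getElem.1 hsort _ _ (by omega) (by omega) h
    · have : m = n := by omega
      subst this
      exact le_rfl
  have h2 := (List.take_sublist (n + 1) l).countP_le (p := fun x => decide (l[n] ≤ x))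
  rw [h1, List.length_take] at h2
  omega

theorem countP_getElem_le {l : List ℝ} (hsort : l.Pairwise (· ≥ ·)) {n : ℕ} (hn : n < l.length) :
    (l.countP fun x => decide (l[n] < x)) ≤ n := by
  have h1 : (l.drop n).countP (fun x => decide (l[n] < x)) = 0 := by
    rw [List.countP_eq_zero]
    intro x hx
    obtain ⟨m, hm, rfl⟩ := List.mem_iff_getElem.1 hx
    rw [List.length_drop] at hm
    rw [List.getElem_drop, decide_eq_true_eq, not_lt]
    rcases Nat.eq_zero_or_pos m with h | h
    · subst h
      exact le_rfl
    · exact List.pairwise_iff_getElem.1 hsort _ _ (by omega) (by omega) (by omega)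
  have h2 : ∀ p : ℝ → Bool, l.countP p = (l.take n).countP p + (l.drop n).countP p := fun p => by
    rw [← List.countP_append, List.take_append_drop]
  rw [h2, h1, add_zero]
  exact List.countP_le_length.trans (by rw [List.length_take]; omega)

/-- A descending list has at least `j` entries that are at least its `j`-th one. Such counts turn
statements on ranks into comparisons of cardinalities. -/
theorem le_card_advantageRank_le {j : ℕ} (hj : 1 ≤ j) (hjN : j ≤ N) :
    j ≤ (Finset.univ.filter fun i => advantageRank r K v j ≤ advantage r K v i).card := by
  rw [← countP_sort_advantage r v fun x => advantageRank r K v j ≤ x, advantageRank_eq r v hj hjN]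
  have := le_countP_getElem (l := ((Finset.univ : Finset (Fin N)).val.map
    (advantage r K v)).sort (· ≥ ·)) (Multiset.pairwise_sort _ _) (n := j - 1)
    (by rw [length_sort_advantage]; omega)
  omega

theorem card_advantageRank_lt {j : ℕ} (hj : 1 ≤ j) (hjN : j ≤ N) :
    (Finset.univ.filter fun i => advantageRank r K v j < advantage r K v i).card < j := by
  rw [← countP_sort_advantage r v fun x => advantageRank r K v j < x, advantageRank_eq r v hj hjN]
  have := countP_getElem_le (l := ((Finset.univ : Finset (Fin N)).val.map
    (advantage r K v)).sort (· ≥ ·)) (Multiset.pairwise_sort _ _) (n := j - 1)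
    (by rw [length_sort_advantage]; omega)
  omega

theorem advantageRank_succ_le {j : ℕ} (hj : 1 ≤ j) (hjN : j + 1 ≤ N) :
    advantageRank r K v (j + 1) ≤ advantageRank r K v j := by
  rw [advantageRank_eq r v hj (by omega), advantageRank_eq r v (by omega) hjN]
  have hsort : (((Finset.univ : Finset (Fin N)).val.map (advantage r K v)).sort (· ≥ ·)).Pairwise
    (· ≥ ·) := Multiset.pairwise_sort _ _
  exact List.pairwise_iff_getElem.1 hsort _ _ _ _ (by omega)

theorem exists_advantageRank_eq {j : ℕ} (hj : 1 ≤ j) (hjN : j ≤ N) :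
    ∃ i, advantageRank r K v j = advantage r K v i := by
  rw [advantageRank_eq r v hj hjN]
  have := List.getElem_mem (l := ((Finset.univ : Finset (Fin N)).val.map
    (advantage r K v)).sort (· ≥ ·)) (n := j - 1) (by rw [length_sort_advantage]; omega)
  rw [Multiset.mem_sort, Multiset.mem_map] at this
  obtain ⟨i, -, h⟩ := this
  exact ⟨i, h.symm⟩

end Rank

/-! ### Exchange properties of the best assortment -/

section Best

variable {N K : ℕ} {r v : Fin N → ℝ}

theorem isBest_best (r : Fin N → ℝ) (K : ℕ) (v : Fin N → ℝ) : IsBest r K v (best r K v) :=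
  (exists_isBest r K v).choose_spec

theorem sum_best (hv : ∀ i, 0 ≤ v i) :
    ∑ i ∈ best r K v, advantage r K v i = optReward r K Finset.univ v := by
  have h := sum_sub_reward_mul (r := r) (S := best r K v) hv
  rwa [(isBest_best r K v).2.1] at h

/-- The advantages in the best assortment sum to `θ_v`. Removing a nonpositive one keeps the
assortment optimal, against its minimal cardinality. -/
theorem lt_of_mem_best (hv : ∀ i, 0 ≤ v i) {i : Fin N} (hi : i ∈ best r K v) :
    optReward r K Finset.univ v < r i := by
  by_contra hc
  have h1 : advantage r K v i ≤ 0 := mul_nonpos_of_nonpos_of_nonneg (by linarith) (hv i)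
  have h2 := sum_best (r := r) (K := K) hv
  rw [← Finset.add_sum_erase _ _ hi] at h2
  have hB := isBest_best r K v
  have hcard := Finset.card_erase_lt_of_mem hi
  have h3 : optReward r K Finset.univ v ≤ reward r v ((best r K v).erase i) := by
    rw [le_reward_iff hv]
    change _ ≤ ∑ i ∈ _, advantage r K v i
    linarith
  have hK : ((best r K v).erase i).card ≤ K := hcard.le.trans hB.1
  have := hB.2.2 _ hK (le_antisymm (reward_le_optReward (Finset.subset_univ _) hK) h3)
  omega

/-- Otherwise swapping `i` for `j` would raise the sum of the advantages above `θ_v`. -/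
theorem advantage_le_of_mem_best (hv : ∀ i, 0 ≤ v i) {i j : Fin N} (hi : i ∈ best r K v)
    (hj : j ∉ best r K v) : advantage r K v j ≤ advantage r K v i := by
  by_contra hc
  have hj' : j ∉ (best r K v).erase i := fun h => hj (Finset.mem_of_mem_erase h)
  have hB := isBest_best r K v
  have hcard : (insert j ((best r K v).erase i)).card ≤ K := by
    rw [Finset.card_insert_of_notMem hj', Finset.card_erase_add_one hi]
    exact hB.1
  have h1 := sum_le_optReward (r := r) hv (Finset.subset_univ _) hcard
  have h2 := sum_best (r := r) (K := K) hv
  rw [← Finset.add_sum_erase _ _ hi] at h2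
  rw [Finset.sum_insert hj'] at h1
  change advantage r K v j + ∑ i ∈ _, advantage r K v i ≤ _ at h1
  linarith

theorem advantage_nonpos_of_card_lt (hv : ∀ i, 0 ≤ v i) (hK : (best r K v).card < K) {j : Fin N}
    (hj : j ∉ best r K v) : advantage r K v j ≤ 0 := by
  have hcard : (insert j (best r K v)).card ≤ K := by
    rw [Finset.card_insert_of_notMem hj]
    exact hK
  have h1 := sum_le_optReward (r := r) hv (Finset.subset_univ _) hcard
  have h2 := sum_best (r := r) (K := K) hv
  rw [Finset.sum_insert hj] at h1
  change advantage r K v j + ∑ i ∈ _, advantage r K v i ≤ _ at h1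
  linarith

/-- If `i` were below `η^(K)`, all items at or above `η^(K)` would belong to the best assortment
without `i`, which has only `K - 1` elements. -/
theorem advantageRank_le_of_mem_best (hv : ∀ i, 0 ≤ v i) (hK : (best r K v).card = K)
    {i : Fin N} (hi : i ∈ best r K v) : advantageRank r K v K ≤ advantage r K v i := by
  by_contra hc
  have hK1 : 1 ≤ K := hK ▸ Finset.card_pos.2 ⟨i, hi⟩
  have hKN : K ≤ N := by
    have := Finset.card_le_univ (best r K v)
    rwa [hK, Fintype.card_fin] at this
  have h1 := le_card_advantageRank_le (K := K) r v hK1 hKN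
  have h2 : (Finset.univ.filter fun i => advantageRank r K v K ≤ advantage r K v i) ⊆
      (best r K v).erase i := by
    intro j hj
    have hj := (Finset.mem_filter.1 hj).2
    rw [Finset.mem_erase]
    constructor
    · rintro rfl
      exact hc hj
    · by_contra hjB
      have := advantage_le_of_mem_best hv hi hjB
      linarith
  have h3 := (Finset.card_le_card h2).trans_lt (Finset.card_erase_lt_of_mem hi)
  omega

theorem advantage_le_advantageRank (hv : ∀ i, 0 ≤ v i) (hK : (best r K v).card = K) (hK1 : 1 ≤ K)
    {j : Fin N} (hj : j ∉ best r K v) : K < N ∧ advantage r K v j ≤ advantageRank r K v (K + 1) := by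
  have hKN : K < N := by
    have := Finset.card_lt_univ_of_notMem hj
    rwa [hK, Fintype.card_fin] at this
  refine ⟨hKN, ?_⟩
  by_contra hc
  have h1 := card_advantageRank_lt (K := K) r v (j := K + 1) (by omega) hKN
  have h2 : insert j (best r K v) ⊆
      Finset.univ.filter fun i => advantageRank r K v (K + 1) < advantage r K v i := by
    intro i hi
    rw [Finset.mem_filter]
    refine ⟨Finset.mem_univ _, ?_⟩
    rcases Finset.mem_insert.1 hi with rfl | hi
    · linarith
    · have := advantage_le_of_mem_best hv hi hj
      linarith
  have h3 := Finset.card_le_card h2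
  rw [Finset.card_insert_of_notMem hj] at h3
  omega

theorem iInf_le_of_mem_best {i : Fin N} (hi : i ∈ best r K v) :
    (⨅ j : {j // j ∈ best r K v}, (r j - optReward r K Finset.univ v)) ≤
      r i - optReward r K Finset.univ v :=
  ciInf_le (f := fun j : {j // j ∈ best r K v} => r j - optReward r K Finset.univ v)
    (Set.finite_range _).bddBelow ⟨i, hi⟩

theorem gap_of_mem_best {i : Fin N} (hi : i ∈ best r K v) : gap r K v i = innerGap r K v := by
  rw [gap, if_pos hi]

theorem innerGap_le_of_mem_best {i : Fin N} (hi : i ∈ best r K v) :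
    innerGap r K v ≤ r i - optReward r K Finset.univ v := by
  rw [innerGap]
  split_ifs
  · exact (min_le_right _ _).trans (iInf_le_of_mem_best hi)
  · exact iInf_le_of_mem_best hi

end Best

/-! ### Consequences of the standing assumptions -/

namespace Regular

variable {N K : ℕ} {r v : Fin N → ℝ}

theorem one_le_N (h : Regular K r v) : 1 ≤ N := by
  rcases Nat.eq_zero_or_pos N with h0 | h0
  · have := h.two_le
    simp [h0] at this
  · exact h0

theorem one_le_K (h : Regular K r v) : 1 ≤ K := by
  rcases Nat.eq_zero_or_pos K with h0 | h0
  · have := h.two_le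
    simp [h0] at this
  · exact h0

theorem v_nonneg (h : Regular K r v) (i : Fin N) : 0 ≤ v i := (h.v_pos i).le

theorem optReward_pos (h : Regular K r v) : 0 < optReward r K Finset.univ v := by
  let i : Fin N := ⟨0, h.one_le_N⟩
  refine lt_of_lt_of_le ?_ (reward_le_optReward (S := {i}) (Finset.subset_univ _)
    (by simpa using h.one_le_K))
  have := h.r_pos i
  have := h.v_pos i
  simp only [reward, Finset.sum_singleton]
  positivity

theorem best_nonempty (h : Regular K r v) : (best r K v).Nonempty := by
  rw [Finset.nonempty_iff_ne_empty]
  intro h0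
  have h1 := sum_best (r := r) (K := K) h.v_nonneg
  have h2 := h.optReward_pos
  rw [h0, Finset.sum_empty] at h1
  linarith

/-- With total preference `V ≤ K` the reward is at most `V / (1 + V) ≤ K / (1 + K)`. -/
theorem optReward_mul_le (h : Regular K r v) : optReward r K Finset.univ v * (1 + K) ≤ K := by
  obtain ⟨S, -, hS, h1⟩ := exists_reward_eq_optReward r v K Finset.univ
  rw [← h1, reward, div_mul_eq_mul_div, div_le_iff₀ (one_add_sum_pos h.v_nonneg S)]
  have h2 : ∑ i ∈ S, r i * v i ≤ ∑ i ∈ S, v i :=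
    Finset.sum_le_sum fun i _ => mul_le_of_le_one_left (h.v_nonneg i) (h.r_le_one i)
  have h3 : ∑ i ∈ S, v i ≤ K := by
    calc ∑ i ∈ S, v i ≤ ∑ i ∈ S, (1 : ℝ) := Finset.sum_le_sum fun i _ => h.v_le_one i
      _ = S.card := by simp
      _ ≤ K := by exact_mod_cast hS
  nlinarith

theorem neg_optReward_le_advantage (h : Regular K r v) (i : Fin N) :
    -optReward r K Finset.univ v ≤ advantage r K v i := by
  have h1 := h.r_pos i
  have h2 := h.v_pos i
  have h3 := h.v_le_one i
  have h4 := h.optReward_pos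
  rw [advantage]
  nlinarith

theorem iInf_pos (h : Regular K r v) : 0 < ⨅ j : {j // j ∈ best r K v}, (r j - optReward r K Finset.univ v) := by
  obtain ⟨i, hi⟩ := h.best_nonempty
  have : Nonempty {j // j ∈ best r K v} := ⟨⟨i, hi⟩⟩
  obtain ⟨j, hj⟩ := exists_eq_ciInf_of_finite
    (f := fun j : {j // j ∈ best r K v} => r j - optReward r K Finset.univ v)
  rw [← hj]
  have := lt_of_mem_best h.v_nonneg j.2
  linarith

theorem innerGap_nonneg (h : Regular K r v) : 0 ≤ innerGap r K v := by
  rw [innerGap]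
  split_ifs with hK
  · refine le_min ?_ h.iInf_pos.le
    have := advantageRank_succ_le (K := K) r v h.one_le_K hK
    linarith
  · exact h.iInf_pos.le

theorem gap_pos (h : Regular K r v) (i : Fin N) : 0 < gap r K v i := by
  refine lt_of_le_of_ne ?_ (h.gap_ne_zero i).symm
  rw [gap]
  split_ifs with h1 h2
  · exact h.innerGap_nonneg
  · obtain ⟨h3, h4⟩ := advantage_le_advantageRank h.v_nonneg h2 h.one_le_K h1
    have := advantageRank_succ_le (K := K) r v h.one_le_K h3
    linarith
  · have := advantage_nonpos_of_card_lt h.v_nonneg (lt_of_le_of_ne (isBest_best r K v).1 h2) h1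
    linarith

theorem innerGap_le_gap (h : Regular K r v) (hK : (best r K v).card = K) (i : Fin N) :
    innerGap r K v ≤ gap r K v i := by
  by_cases hi : i ∈ best r K v
  · rw [gap_of_mem_best hi]
  · obtain ⟨h3, h4⟩ := advantage_le_advantageRank h.v_nonneg hK h.one_le_K hi
    rw [gap, if_neg hi, if_pos hK, innerGap, if_pos h3]
    exact (min_le_left _ _).trans (by linarith)

/-- The `K` best items each contribute at least `η^(K)` to a sum equal to `θ_v`. -/
theorem advantageRank_mul_le (h : Regular K r v) (hK : (best r K v).card = K) :
    advantageRank r K v K * K ≤ optReward r K Finset.univ v := by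
  have h1 := Finset.card_nsmul_le_sum (best r K v) (advantage r K v) (advantageRank r K v K)
    fun i hi => advantageRank_le_of_mem_best h.v_nonneg hK hi
  rw [sum_best h.v_nonneg, nsmul_eq_mul, hK] at h1
  linarith

/-- For a full best assortment, `η^(K) - η_i ≤ θ/K + θ = θ (1 + K) / K ≤ 1`; this is where the bound
`K / (1 + K)` on the optimum enters. -/
theorem gap_le_one (h : Regular K r v) (i : Fin N) : gap r K v i ≤ 1 := by
  have hθ := h.optReward_pos
  have hθ1 := optReward_lt_one (K := K) (I := Finset.univ) h.r_le_one h.v_nonneg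
  have hη := h.neg_optReward_le_advantage i
  by_cases hi : i ∈ best r K v
  · have h1 := innerGap_le_of_mem_best hi
    have h2 := h.r_le_one i
    rw [gap_of_mem_best hi]
    linarith
  · rw [gap, if_neg hi]
    split_ifs with hK
    · have h1 := h.advantageRank_mul_le hK
      have h2 := h.optReward_mul_le
      have hK0 : (0 : ℝ) < K := by exact_mod_cast h.one_le_K
      have h3 : (advantageRank r K v K + optReward r K Finset.univ v) * K ≤ 1 * K := by nlinarith
      have h4 := le_of_mul_le_mul_right h3 hK0
      linarith
    · linarith

/-- For `K = 1` the inner gap is at most `1 - θ` and at most `η^(1) - η^(2) ≤ 2θ`, hence at most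
`2/3`. This keeps `ln (K / min Δ)` away from zero in the case where `K` alone does not. -/
theorem exists_gap_le (h : Regular K r v) (hK : K = 1) : ∃ i, gap r K v i ≤ 2 / 3 := by
  obtain ⟨i, hi⟩ := h.best_nonempty
  have hcard : (best r K v).card = 1 :=
    le_antisymm (hK ▸ (isBest_best r K v).1) (Finset.card_pos.2 ⟨i, hi⟩)
  have hN : K < N := by
    have := h.two_le
    rw [hK] at this ⊢
    omega
  have hB : best r K v = {i} := by
    obtain ⟨j, hj⟩ := Finset.card_eq_one.1 hcard
    rw [hj, Finset.mem_singleton] at hi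
    rw [hj, hi]
  have hsum := sum_best (r := r) (K := K) h.v_nonneg
  rw [hB, Finset.sum_singleton] at hsum
  have h1 := advantageRank_le_of_mem_best h.v_nonneg (hcard.trans hK.symm) hi
  obtain ⟨j, hj⟩ := exists_advantageRank_eq (K := K) r v (j := K + 1) (by omega) hN
  have h2 := h.neg_optReward_le_advantage j
  refine ⟨i, ?_⟩
  have h3 := innerGap_le_of_mem_best hi
  have h4 : innerGap r K v ≤ advantageRank r K v K - advantageRank r K v (K + 1) := by
    rw [innerGap, if_pos hN]
    exact min_le_left _ _
  rw [gap_of_mem_best hi]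
  have h5 : advantage r K v i = (r i - optReward r K Finset.univ v) * v i := rfl
  have h6 := h.r_le_one i
  have h7 := h.v_pos i
  have h8 := lt_of_mem_best h.v_nonneg hi
  linarith

end Regular

/-! ### Instance complexities -/

section Complexity

variable {N K : ℕ} {r v : Fin N → ℝ}

theorem le_iSup_gap (i : Fin N) : 1 / gap r K v i ^ 2 ≤ ⨆ i, 1 / gap r K v i ^ 2 :=
  le_ciSup (f := fun i => 1 / gap r K v i ^ 2) (Set.finite_range _).bddAbove i

theorem H₂_le_three_mul_H₁ (h : Regular K r v) : H₂ r K v ≤ 3 * H₁ r K v := by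
  have hK : (1 : ℝ) ≤ K := by exact_mod_cast h.one_le_K
  have : Nonempty (Fin N) := ⟨⟨0, h.one_le_N⟩⟩
  have h1 : (∑ i, (v i + 1 / K) / gap r K v i ^ 2) ≤ 2 * H₁ r K v := by
    rw [H₁, Finset.mul_sum]
    refine Finset.sum_le_sum fun i _ => ?_
    have h2 : (1 : ℝ) / K ≤ 1 := by rw [div_le_one (by linarith)]; exact hK
    have h3 := h.v_le_one i
    have h4 := h.gap_pos i
    rw [mul_one_div]
    gcongr
    linarith
  have h2 : (⨆ i, 1 / gap r K v i ^ 2) ≤ H₁ r K v :=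
    ciSup_le fun i => Finset.single_le_sum (f := fun i => 1 / gap r K v i ^ 2)
      (fun j _ => by positivity) (Finset.mem_univ i)
  rw [H₂]
  linarith

/-- The maximum in `H₂` supplies one extra summand `1 / Δ_i²`. It pays for the constant in `1 + ∑ v`
when the preferences of the best assortment are charged to `H₂`. -/
theorem sum_add_le_H₂ (h : Regular K r v) (S : Finset (Fin N)) (i : Fin N) :
    (∑ j ∈ S, v j / gap r K v j ^ 2) + 1 / gap r K v i ^ 2 ≤ H₂ r K v := by
  rw [H₂]
  refine add_le_add ?_ (le_iSup_gap i)
  calc ∑ j ∈ S, v j / gap r K v j ^ 2 ≤ ∑ j, v j / gap r K v j ^ 2 :=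
        Finset.sum_le_sum_of_subset_of_nonneg (Finset.subset_univ _) fun j _ _ => by
          have := h.v_pos j
          positivity
    _ ≤ _ := Finset.sum_le_sum fun j _ => by
          have := h.gap_pos j
          gcongr
          simp

theorem one_le_one_div_gap_sq (h : Regular K r v) (i : Fin N) : 1 ≤ 1 / gap r K v i ^ 2 := by
  have h1 := h.gap_pos i
  rw [le_div_iff₀ (by positivity), one_mul]
  exact pow_le_one₀ h1.le (h.gap_le_one i)

theorem one_div_gap_le (h : Regular K r v) (i : Fin N) :
    1 / gap r K v i ≤ 1 / gap r K v i ^ 2 := by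
  have h1 := h.gap_pos i
  refine one_div_le_one_div_of_le (by positivity) ?_
  have := h.gap_le_one i
  nlinarith

theorem one_add_sum_le_H₂ (h : Regular K r v) (S : Finset (Fin N)) :
    1 + ∑ j ∈ S, v j ≤ H₂ r K v := by
  have h1 := sum_add_le_H₂ h S ⟨0, h.one_le_N⟩
  have h2 := one_le_one_div_gap_sq h ⟨0, h.one_le_N⟩
  have h3 : ∑ j ∈ S, v j ≤ ∑ j ∈ S, v j / gap r K v j ^ 2 := by
    refine Finset.sum_le_sum fun j _ => ?_
    have h4 := one_le_one_div_gap_sq h j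
    have h5 := h.v_pos j
    rw [div_eq_mul_one_div]
    nlinarith
  linarith

theorem one_div_gap_sq_le_H₂ (h : Regular K r v) (i : Fin N) : 1 / gap r K v i ^ 2 ≤ H₂ r K v := by
  simpa using sum_add_le_H₂ h ∅ i

/-- As all gaps are at most one, `K * H₂ ≥ N + K ≥ 3`, because `N` and `K` are not both `1`. Since
`3 > e`, the iterated logarithm in the bound is positive. -/
theorem three_le_mul_H₂ (h : Regular K r v) : 3 ≤ K * H₂ r K v := by
  have hK : (1 : ℝ) ≤ K := by exact_mod_cast h.one_le_K
  have hsup := (one_le_one_div_gap_sq h ⟨0, h.one_le_N⟩).trans (le_iSup_gap _)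
  have h1 : (N : ℝ) / K ≤ ∑ i, (v i + 1 / K) / gap r K v i ^ 2 := by
    calc (N : ℝ) / K = ∑ _i : Fin N, 1 / (K : ℝ) := by simp [div_eq_mul_inv]
      _ ≤ _ := Finset.sum_le_sum fun i _ => by
        have h2 := h.v_pos i
        have h3 := one_le_one_div_gap_sq h i
        rw [div_eq_mul_one_div (v i + 1 / K)]
        have h4 : (0 : ℝ) ≤ 1 / K := by positivity
        nlinarith
  have h2 : (3 : ℝ) ≤ N + K := by
    have h3 := h.two_le
    have h4 := h.one_le_N
    have h5 := h.one_le_K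
    have : 3 ≤ N + K := by
      by_contra hc
      have : N = 1 := by omega
      have : K = 1 := by omega
      simp_all
    exact_mod_cast this
  have h3 : (K : ℝ) * (N / K) = N := by field_simp
  rw [H₂]
  nlinarith

end Complexity

/-! ### One application of the pruning rule -/

section Prune

variable {N K : ℕ} {r v a b : Fin N → ℝ} {I : Finset (Fin N)} {ε : ℝ}

theorem mem_prune {i : Fin N} : i ∈ prune r K I a b ↔ i ∈ I ∧ ∃ θ : ℝ, optReward r K I a ≤ θ ∧
    θ ≤ optReward r K I b ∧ i ∈ top r K I (Function.update a i (b i)) θ := by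
  classical
  exact Finset.mem_filter

theorem optReward_of_best_subset (hI : best r K v ⊆ I) :
    optReward r K I v = optReward r K Finset.univ v := by
  have hB := isBest_best r K v
  refine le_antisymm ?_ (hB.2.1 ▸ reward_le_optReward hI hB.1)
  obtain ⟨S, -, hS, h⟩ := exists_reward_eq_optReward r v K I
  exact h ▸ reward_le_optReward (Finset.subset_univ _) hS

/-- The reward of a fixed set is not monotone in the preferences, but the optimum is: discard from
an optimal set the items with `r i` below the optimal value; for the others larger preferences only
help. -/
theorem optReward_mono {w w' : Fin N → ℝ} (hw : ∀ i, 0 ≤ w i) (hw' : ∀ i, 0 ≤ w' i)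
    (hle : ∀ i ∈ I, w i ≤ w' i) : optReward r K I w ≤ optReward r K I w' := by
  obtain ⟨S, hS, hK, h⟩ := exists_reward_eq_optReward r w K I
  rw [← h]
  set θ := reward r w S
  refine le_optReward (S := S.filter fun i => θ ≤ r i) hw' ((Finset.filter_subset _ _).trans hS)
    ((Finset.card_filter_le _ _).trans hK) ?_
  calc θ = ∑ i ∈ S, (r i - θ) * w i := (sum_sub_reward_mul hw).symm
    _ ≤ ∑ i ∈ S.filter (fun i => θ ≤ r i), (r i - θ) * w i := by
      rw [← Finset.sum_filter_add_sum_filter_not S fun i => θ ≤ r i]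
      have : ∑ i ∈ S.filter (fun i => ¬ θ ≤ r i), (r i - θ) * w i ≤ 0 :=
        Finset.sum_nonpos fun i hi =>
          mul_nonpos_of_nonpos_of_nonneg (by linarith [(Finset.mem_filter.1 hi).2]) (hw i)
      linarith
    _ ≤ _ := Finset.sum_le_sum fun i hi => by
      rw [Finset.mem_filter] at hi
      exact mul_le_mul_of_nonneg_left (hle i (hS hi.1)) (by linarith [hi.2])

/-- The bounds `a`, `b` enclose the preferences of the surviving items up to the accuracy `ε`. -/
structure Encloses (K : ℕ) (r v : Fin N → ℝ) (I : Finset (Fin N)) (a b : Fin N → ℝ) (ε : ℝ) :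
    Prop where
  best_subset : best r K v ⊆ I
  nonneg_left : ∀ i, 0 ≤ a i
  nonneg_right : ∀ i, 0 ≤ b i
  left_le : ∀ i ∈ I, a i ≤ v i
  le_right : ∀ i ∈ I, v i ≤ b i
  le_left_add : ∀ i ∈ I, v i ≤ a i + 2 * ε
  right_le_add : ∀ i ∈ I, b i ≤ v i + 2 * ε

namespace Encloses

theorem eps_nonneg (h : Regular K r v) (e : Encloses K r v I a b ε) : 0 ≤ ε := by
  obtain ⟨i, hi⟩ := h.best_nonempty
  have h1 := e.le_right i (e.best_subset hi)
  have h2 := e.right_le_add i (e.best_subset hi)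
  linarith

theorem optReward_left_le (h : Regular K r v) (e : Encloses K r v I a b ε) :
    optReward r K I a ≤ optReward r K Finset.univ v := by
  rw [← optReward_of_best_subset e.best_subset]
  exact optReward_mono e.nonneg_left h.v_nonneg e.left_le

theorem le_optReward_right (h : Regular K r v) (e : Encloses K r v I a b ε) :
    optReward r K Finset.univ v ≤ optReward r K I b := by
  rw [← optReward_of_best_subset e.best_subset]
  exact optReward_mono h.v_nonneg e.nonneg_right e.le_right

/-- Evaluating the best assortment under `a` loses exactly `∑ (r i - θ) * (v i - a i)` after
clearing the denominator. The denominator is kept on the left, because it is needed to bound the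
total preference of the best assortment. -/
theorem sub_optReward_left_mul_le (h : Regular K r v) (e : Encloses K r v I a b ε) :
    (optReward r K Finset.univ v - optReward r K I a) * (1 + ∑ i ∈ best r K v, a i) ≤
      2 * K * ε := by
  set θ := optReward r K Finset.univ v with hθ
  have hB := isBest_best r K v
  have hpos := one_add_sum_pos e.nonneg_left (best r K v)
  have h1 : reward r a (best r K v) ≤ optReward r K I a :=
    reward_le_optReward e.best_subset hB.1
  have h2 : (θ - reward r a (best r K v)) * (1 + ∑ i ∈ best r K v, a i) =
      ∑ i ∈ best r K v, (r i - θ) * (v i - a i) := by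
    have h3 := sum_best (r := r) (K := K) h.v_nonneg
    simp only [advantage] at h3
    rw [sub_mul, reward, div_mul_cancel₀ _ hpos.ne']
    simp only [mul_sub, Finset.sum_sub_distrib]
    rw [h3]
    simp only [sub_mul, Finset.sum_sub_distrib, ← Finset.mul_sum]
    ring
  have h3 : ∑ i ∈ best r K v, (r i - θ) * (v i - a i) ≤ 2 * K * ε := by
    have hε := e.eps_nonneg h
    calc ∑ i ∈ best r K v, (r i - θ) * (v i - a i) ≤ ∑ i ∈ best r K v, 2 * ε := by
          refine Finset.sum_le_sum fun i hi => ?_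
          have h4 := lt_of_mem_best h.v_nonneg hi
          have h5 := h.r_le_one i
          have h6 := h.optReward_pos
          have h7 := e.left_le i (e.best_subset hi)
          have h8 := e.le_left_add i (e.best_subset hi)
          nlinarith
      _ = (best r K v).card * (2 * ε) := by simp
      _ ≤ K * (2 * ε) := by
          have : ((best r K v).card : ℝ) ≤ K := by exact_mod_cast hB.1
          gcongr
      _ = _ := by ring
  nlinarith

theorem sub_optReward_left_le (h : Regular K r v) (e : Encloses K r v I a b ε) :
    optReward r K Finset.univ v - optReward r K I a ≤ 2 * K * ε := by
  have h1 := e.sub_optReward_left_mul_le h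
  have h2 := e.optReward_left_le h
  have h3 := Finset.sum_nonneg fun i (_ : i ∈ best r K v) => e.nonneg_left i
  nlinarith

theorem optReward_right_sub_le (h : Regular K r v) (e : Encloses K r v I a b ε) :
    optReward r K I b - optReward r K Finset.univ v ≤ 2 * K * ε := by
  obtain ⟨S, hS, hK, hopt⟩ := exists_reward_eq_optReward r b K I
  have hε := e.eps_nonneg h
  have hlt := optReward_lt_one (K := K) (I := I) h.r_le_one e.nonneg_right
  have hnn := optReward_nonneg r b K I
  set θ := optReward r K I b
  have hsum : ∑ i ∈ S, (r i - θ) * b i = θ := by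
    rw [← hopt]
    exact sum_sub_reward_mul e.nonneg_right
  suffices h' : θ - 2 * K * ε ≤ optReward r K Finset.univ v by linarith
  refine le_optReward (S := S) h.v_nonneg (Finset.subset_univ _) hK ?_
  have h1 : ∑ i ∈ S, (r i - θ) * b i - ∑ i ∈ S, (r i - θ) * v i ≤ 2 * K * ε := by
    rw [← Finset.sum_sub_distrib]
    calc ∑ i ∈ S, ((r i - θ) * b i - (r i - θ) * v i) ≤ ∑ i ∈ S, 2 * ε := by
          refine Finset.sum_le_sum fun i hi => ?_
          have h5 := h.r_le_one i
          have h7 := e.le_right i (hS hi)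
          have h8 := e.right_le_add i (hS hi)
          have h9 : (1 - (r i - θ)) * (b i - v i) ≥ 0 :=
            mul_nonneg (by linarith) (by linarith)
          nlinarith
      _ = S.card * (2 * ε) := by simp
      _ ≤ K * (2 * ε) := by
          have : (S.card : ℝ) ≤ K := by exact_mod_cast hK
          gcongr
      _ = _ := by ring
  have h2 : ∑ i ∈ S, (r i - θ) * v i ≤ ∑ i ∈ S, (r i - (θ - 2 * K * ε)) * v i := by
    refine Finset.sum_le_sum fun i _ => mul_le_mul_of_nonneg_right ?_ (h.v_nonneg i)
    have : 0 ≤ 2 * K * ε := by positivity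
    linarith
  linarith

/-- The true optimum `θ_v` is the witness. An item beating `i` there, with its lower bound against
the upper bound of `i`, truly has a larger advantage and so lies in the best assortment, which
leaves at most `K - 1` of them. -/
theorem best_subset_prune (h : Regular K r v) (e : Encloses K r v I a b ε) :
    best r K v ⊆ prune r K I a b := by
  intro i hi
  set θ := optReward r K Finset.univ v with hθ
  have hri := lt_of_mem_best h.v_nonneg hi
  rw [mem_prune]
  refine ⟨e.best_subset hi, θ, e.optReward_left_le h, e.le_optReward_right h, ?_⟩
  rw [top, Finset.mem_filter]
  refine ⟨e.best_subset hi, hri, ?_⟩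
  have hsub : (I.filter fun j => (r i - θ) * Function.update a i (b i) i <
      (r j - θ) * Function.update a i (b i) j) ⊆ (best r K v).erase i := by
    intro j hj
    rw [Finset.mem_filter, Function.update_self] at hj
    have hji : j ≠ i := by
      rintro rfl
      simp at hj
    rw [Function.update_of_ne hji] at hj
    rw [Finset.mem_erase]
    refine ⟨hji, ?_⟩
    by_contra hjB
    have h1 := advantage_le_of_mem_best h.v_nonneg hi hjB
    simp only [advantage, ← hθ] at h1
    have h2 := mul_le_mul_of_nonneg_left (e.le_right i (e.best_subset hi))
      (sub_nonneg.2 hri.le)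
    have h3 : 0 ≤ (r i - θ) * b i := mul_nonneg (by linarith) (e.nonneg_right i)
    have h4 : 0 ≤ r j - θ := by
      by_contra hc
      have := mul_nonpos_of_nonpos_of_nonneg (not_le.1 hc).le (e.nonneg_left j)
      linarith [hj.2]
    have h5 := mul_le_mul_of_nonneg_left (e.left_le j hj.1) h4
    linarith [hj.2]
  calc _ ≤ ((best r K v).erase i).card := Finset.card_le_card hsub
    _ < (best r K v).card := Finset.card_erase_lt_of_mem hi
    _ ≤ K := (isBest_best r K v).1

/-- The test `r i > R(C, b)` yields `R(C, b) ≥ θ_v`. A superfluous item of `C` would then have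
positive advantage although the best assortment has room for it. -/
theorem prune_eq_best (h : Regular K r v) (e : Encloses K r v I a b ε)
    (hcard : (prune r K I a b).card ≤ K)
    (habove : ∀ i ∈ prune r K I a b, reward r b (prune r K I a b) < r i) :
    prune r K I a b = best r K v := by
  set C := prune r K I a b
  have hBC : best r K v ⊆ C := e.best_subset_prune h
  have hCI : C ⊆ I := fun i hi => (mem_prune.1 hi).1
  refine (Finset.Subset.antisymm hBC fun i hi => ?_).symm
  by_contra hiB
  set θ' := reward r b C
  have h1 : optReward r K Finset.univ v ≤ θ' := by
    rw [← (isBest_best r K v).2.1, reward_le_iff h.v_nonneg]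
    calc ∑ i ∈ best r K v, (r i - θ') * v i ≤ ∑ i ∈ C, (r i - θ') * v i :=
          Finset.sum_le_sum_of_subset_of_nonneg hBC fun i hi _ =>
            mul_nonneg (by linarith [habove i hi]) (h.v_nonneg i)
      _ ≤ ∑ i ∈ C, (r i - θ') * b i := Finset.sum_le_sum fun i hi =>
            mul_le_mul_of_nonneg_left (e.le_right i (hCI hi)) (by linarith [habove i hi])
      _ = θ' := sum_sub_reward_mul e.nonneg_right
  have hlt : (best r K v).card < K :=
    (Finset.card_lt_card ((Finset.ssubset_iff_of_subset hBC).2 ⟨i, hi, hiB⟩)).trans_le hcard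
  have h2 := advantage_nonpos_of_card_lt h.v_nonneg hlt hiB
  have h3 : 0 < advantage r K v i := mul_pos (by linarith [habove i hi]) (h.v_pos i)
  linarith

/-- At an admissible threshold the optimistic value of `i` exceeds `η_i` by at most `4Kε`, and the
pessimistic value of a best item falls below its advantage by at most `4Kε`; in both, `2Kε` comes
from the threshold and `2ε ≤ 2Kε` from the preference. With a gap above `8Kε` all `K` best items
would beat `i`. -/
theorem gap_le_of_mem_prune_of_card_eq (h : Regular K r v) (e : Encloses K r v I a b ε)
    (hcard : (best r K v).card = K) {i : Fin N} (hi : i ∈ prune r K I a b)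
    (hiB : i ∉ best r K v) : gap r K v i ≤ 8 * K * ε := by
  rw [mem_prune] at hi
  obtain ⟨hiI, θ', hlo, hhi, htop⟩ := hi
  rw [top, Finset.mem_filter] at htop
  obtain ⟨-, hri, hcount⟩ := htop
  have ha0 := optReward_nonneg r a K I
  have h1 := e.sub_optReward_left_le h
  have h2 := e.optReward_right_sub_le h
  have hε := e.eps_nonneg h
  have hK : (1 : ℝ) ≤ K := by exact_mod_cast h.one_le_K
  have hlt := optReward_lt_one (K := K) (I := Finset.univ) h.r_le_one h.v_nonneg
  have hθ0 := h.optReward_pos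
  set θ := optReward r K Finset.univ v with hθ
  by_contra hc
  rw [gap, if_neg hiB, if_pos hcard] at hc
  have hKε : ε ≤ K * ε := by nlinarith
  have hup : (r i - θ') * b i ≤ advantage r K v i + 4 * K * ε := by
    have e1 := e.le_right i hiI
    have e2 := e.right_le_add i hiI
    have e3 := h.v_le_one i
    have e4 := h.v_pos i
    have e5 := h.r_le_one i
    have e6 : (r i - θ') * (b i - v i) ≤ 1 * (2 * ε) :=
      mul_le_mul (by linarith) (by linarith) (by linarith) (by norm_num)
    have e7 : (θ - θ') * v i ≤ 2 * K * ε := by nlinarith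
    have : advantage r K v i = (r i - θ) * v i := rfl
    nlinarith
  have hsub : best r K v ⊆ I.filter fun j => (r i - θ') * Function.update a i (b i) i <
      (r j - θ') * Function.update a i (b i) j := by
    intro j hj
    have hji : j ≠ i := by
      rintro rfl
      exact hiB hj
    rw [Finset.mem_filter, Function.update_self, Function.update_of_ne hji]
    refine ⟨e.best_subset hj, ?_⟩
    have hjI := e.best_subset hj
    have e1 := e.left_le j hjI
    have e2 := e.le_left_add j hjI
    have e3 := h.v_le_one j
    have e4 := e.nonneg_left j
    have e5 := h.r_le_one j
    have e6 := lt_of_mem_best h.v_nonneg hj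
    have e7 : (r j - θ) * (v j - a j) ≤ 1 * (2 * ε) :=
      mul_le_mul (by linarith) (by linarith) (by linarith) (by norm_num)
    have e8 : (θ' - θ) * a j ≤ 2 * K * ε := by nlinarith
    have e9 := advantageRank_le_of_mem_best h.v_nonneg hcard hj
    have : advantage r K v j = (r j - θ) * v j := rfl
    nlinarith
  have := Finset.card_le_card hsub
  omega

/-- Survival forces `r i > θ' ≥ θ_a`, so the gap `(θ_v - r i) * v i` is at most `θ_v - θ_a`, and the
factor `1 + ∑ a` is inherited from the bound on that difference. -/
theorem gap_mul_le_of_mem_prune (h : Regular K r v) (e : Encloses K r v I a b ε)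
    (hcard : (best r K v).card ≠ K) {i : Fin N} (hi : i ∈ prune r K I a b)
    (hiB : i ∉ best r K v) : gap r K v i * (1 + ∑ j ∈ best r K v, a j) ≤ 2 * K * ε := by
  rw [mem_prune] at hi
  obtain ⟨hiI, θ', hlo, hhi, htop⟩ := hi
  rw [top, Finset.mem_filter] at htop
  have hri := htop.2.1
  refine le_trans (mul_le_mul_of_nonneg_right ?_ (one_add_sum_pos e.nonneg_left _).le)
    (e.sub_optReward_left_mul_le h)
  have h1 := h.gap_pos i
  rw [gap, if_neg hiB, if_neg hcard, advantage] at h1 ⊢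
  have h2 := h.v_pos i
  have h3 := h.v_le_one i
  have h4 : 0 < optReward r K Finset.univ v - r i := by
    by_contra hc
    have := mul_nonneg (by linarith : 0 ≤ r i - optReward r K Finset.univ v) h2.le
    linarith
  nlinarith

theorem gap_le_of_mem_prune (h : Regular K r v) (e : Encloses K r v I a b ε)
    {i : Fin N} (hi : i ∈ prune r K I a b) (hiB : i ∉ best r K v) :
    gap r K v i ≤ 8 * K * ε := by
  by_cases hcard : (best r K v).card = K
  · exact e.gap_le_of_mem_prune_of_card_eq h hcard hi hiB
  · have h1 := e.gap_mul_le_of_mem_prune h hcard hi hiB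
    have h2 := h.gap_pos i
    have h3 := Finset.sum_nonneg fun i (_ : i ∈ best r K v) => e.nonneg_left i
    have h4 : 0 ≤ K * ε := mul_nonneg (by positivity) (e.eps_nonneg h)
    nlinarith

/-- If exactly the best assortment survives and is not returned, some item has `r i ≤ R(C, b) ≤ θ_v
+ 2Kε`. -/
theorem exists_mem_prune_or_innerGap_le (h : Regular K r v) (e : Encloses K r v I a b ε)
    (hns : ¬ ((prune r K I a b).card ≤ K ∧
      ∀ i ∈ prune r K I a b, reward r b (prune r K I a b) < r i)) :
    (∃ i ∈ prune r K I a b, i ∉ best r K v) ∨ innerGap r K v ≤ 2 * K * ε := by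
  by_cases hex : ∃ i ∈ prune r K I a b, i ∉ best r K v
  · exact Or.inl hex
  · right
    push Not at hex
    have hC : prune r K I a b = best r K v :=
      Finset.Subset.antisymm hex (e.best_subset_prune h)
    rw [hC] at hns
    push Not at hns
    obtain ⟨i, hi, hle⟩ := hns (isBest_best r K v).1
    have h1 := innerGap_le_of_mem_best hi
    have h2 := e.optReward_right_sub_le h
    have h3 : reward r b (best r K v) ≤ optReward r K I b :=
      reward_le_optReward e.best_subset (isBest_best r K v).1
    linarith

theorem exists_gap_le (h : Regular K r v) (e : Encloses K r v I a b ε)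
    (hns : ¬ ((prune r K I a b).card ≤ K ∧
      ∀ i ∈ prune r K I a b, reward r b (prune r K I a b) < r i)) :
    ∃ i, gap r K v i ≤ 8 * K * ε := by
  have h4 : 0 ≤ K * ε := mul_nonneg (by positivity) (e.eps_nonneg h)
  rcases e.exists_mem_prune_or_innerGap_le h hns with ⟨i, hi, hiB⟩ | h1
  · exact ⟨i, e.gap_le_of_mem_prune h hi hiB⟩
  · obtain ⟨i, hi⟩ := h.best_nonempty
    refine ⟨i, ?_⟩
    rw [gap_of_mem_best hi]
    linarith

/-- If the inner gap is of order `Kε`, the claim follows because all best items share this gap and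
the maximum in `H₂` covers the `1`. If instead an outside item survives beside an unfilled best
assortment, its gap times `1 + V` is of order `Kε`, and `1 + V ≤ (1 + V)²` brings in `1 / Δ_i² ≤
H₂`. -/
theorem one_add_sum_best_le (h : Regular K r v) (e : Encloses K r v I a b ε)
    (hns : ¬ ((prune r K I a b).card ≤ K ∧
      ∀ i ∈ prune r K I a b, reward r b (prune r K I a b) < r i)) :
    1 + ∑ i ∈ best r K v, v i ≤ 64 * K ^ 2 * H₂ r K v * ε ^ 2 := by
  have hKε : 0 ≤ K * ε := mul_nonneg (by positivity) (e.eps_nonneg h)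
  have hinner : innerGap r K v ≤ 8 * K * ε →
      1 + ∑ i ∈ best r K v, v i ≤ 64 * K ^ 2 * H₂ r K v * ε ^ 2 := by
    intro h1
    obtain ⟨i, hi⟩ := h.best_nonempty
    have h2 := sum_add_le_H₂ h (best r K v) i
    have h3 : ∑ j ∈ best r K v, v j / gap r K v j ^ 2 =
        (∑ j ∈ best r K v, v j) / innerGap r K v ^ 2 := by
      rw [Finset.sum_div]
      exact Finset.sum_congr rfl fun j hj => by rw [gap_of_mem_best hj]
    have h4 := h.gap_pos i
    rw [gap_of_mem_best hi] at h2 h4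
    rw [h3, ← add_div, div_le_iff₀ (by positivity)] at h2
    have h5 : innerGap r K v ^ 2 ≤ (8 * K * ε) ^ 2 := pow_le_pow_left₀ h4.le h1 2
    have h6 : 0 ≤ H₂ r K v := by
      have := one_div_gap_sq_le_H₂ h i
      have := one_le_one_div_gap_sq h i
      linarith
    nlinarith [mul_le_mul_of_nonneg_left h5 h6]
  rcases e.exists_mem_prune_or_innerGap_le h hns with ⟨i, hi, hiB⟩ | h1
  · by_cases hcard : (best r K v).card = K
    · exact hinner ((h.innerGap_le_gap hcard i).trans (e.gap_le_of_mem_prune_of_card_eq h hcard hi hiB))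
    · have h1 := e.gap_mul_le_of_mem_prune h hcard hi hiB
      have h2 := h.gap_pos i
      have hV := one_add_sum_le_H₂ h (best r K v)
      have hV0 : 0 ≤ ∑ j ∈ best r K v, v j := Finset.sum_nonneg fun j _ => h.v_nonneg j
      set V := ∑ j ∈ best r K v, v j with hVdef
      -- For `4Kε ≤ 1` the lower bounds satisfy `1 + ∑ a ≥ (1 + V) / 2`. For larger `ε` the trivial
      -- estimate `1 + V ≤ H₂` suffices.
      rcases le_or_gt (4 * K * ε) 1 with hsmall | hbig
      · have h3 : V - 2 * K * ε ≤ ∑ j ∈ best r K v, a j := by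
          have h4 : V - ∑ j ∈ best r K v, a j ≤ 2 * K * ε := by
            rw [hVdef, ← Finset.sum_sub_distrib]
            calc ∑ j ∈ best r K v, (v j - a j) ≤ ∑ j ∈ best r K v, 2 * ε :=
                  Finset.sum_le_sum fun j hj => by
                    linarith [e.le_left_add j (e.best_subset hj)]
              _ = (best r K v).card * (2 * ε) := by simp
              _ ≤ K * (2 * ε) := by
                  have : ((best r K v).card : ℝ) ≤ K := by
                    exact_mod_cast (isBest_best r K v).1
                  have := e.eps_nonneg h
                  gcongr
              _ = _ := by ring
          linarith
        have h4 : gap r K v i * (1 + V) ≤ 4 * K * ε := by nlinarith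
        have h5 : (gap r K v i * (1 + V)) ^ 2 ≤ (4 * K * ε) ^ 2 :=
          pow_le_pow_left₀ (by positivity) h4 2
        have h6 := one_div_gap_sq_le_H₂ h i
        rw [div_le_iff₀ (by positivity)] at h6
        have h7 : 1 + V ≤ (1 + V) ^ 2 := by nlinarith
        have h8 : (1 + V) ^ 2 ≤ H₂ r K v * (gap r K v i * (1 + V)) ^ 2 := by
          have := mul_le_mul_of_nonneg_right h6 (sq_nonneg (1 + V))
          nlinarith
        have h9 : 0 ≤ H₂ r K v := by linarith
        nlinarith [mul_le_mul_of_nonneg_left h5 h9]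
      · have h3 : 1 ≤ (4 * K * ε) ^ 2 := one_le_pow₀ hbig.le
        nlinarith
  · exact hinner (by linarith)

end Encloses

end Prune

/-! ### Adaptive programs and supermartingales -/

/-- How often each item was chosen, and how many no-purchases occurred while it was offered. -/
structure Counts (N : ℕ) where
  chosen : Fin N → ℕ
  quits : Fin N → ℕ

/-- The counts after the choice `x` from the assortment `S`. -/
def Counts.next {N : ℕ} (k : Counts N) (S : Finset (Fin N)) : Option (Fin N) → Counts N
  | none => { k with quits := fun i => k.quits i + if i ∈ S then 1 else 0 }
  | some x => { k with chosen := Function.update k.chosen x (k.chosen x + 1) }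

/-- `Wins K Good Q t k m`: whatever the choices from pull number `t` on are, the program `m`
arrives at a result with property `Q`, or at counts that are not `Good`. -/
inductive Wins {N : ℕ} {β : Type} (K : ℕ) (Good : Counts N → Prop)
    (Q : ℕ → Counts N → β → Prop) :
    ℕ → Counts N → ((ℕ → Finset (Fin N) → Option (Fin N)) → Option β) → Prop
  | ret {t : ℕ} {k : Counts N} {b : β} (h : Q t k b) : Wins K Good Q t k fun _ => some b
  | bad {t : ℕ} {k : Counts N} {m : (ℕ → Finset (Fin N) → Option (Fin N)) → Option β}
      (h : ¬ Good k) : Wins K Good Q t k m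
  | ask {t : ℕ} {k : Counts N} (S : Finset (Fin N)) (hS : S.card ≤ K)
      {m : Option (Fin N) → (ℕ → Finset (Fin N) → Option (Fin N)) → Option β}
      (h : ∀ x, (∀ i, x = some i → i ∈ S) → Wins K Good Q (t + 1) (k.next S x) (m x)) :
      Wins K Good Q t k fun env => m (env t S) env

theorem Wins.bind {N : ℕ} {β γ : Type} {K : ℕ} {Good : Counts N → Prop}
    {Q : ℕ → Counts N → β → Prop} {Q' : ℕ → Counts N → γ → Prop} {t : ℕ} {k : Counts N}
    {m : (ℕ → Finset (Fin N) → Option (Fin N)) → Option β}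
    {g : (ℕ → Finset (Fin N) → Option (Fin N)) → β → Option γ}
    (hm : Wins K Good Q t k m)
    (hg : ∀ t' k' b, Q t' k' b → Wins K Good Q' t' k' fun env => g env b) :
    Wins K Good Q' t k fun env => (m env).bind (g env) := by
  induction hm with
  | ret h => exact hg _ _ _ h
  | bad h => exact Wins.bad h
  | ask S hS h ih => exact Wins.ask S hS (m := fun x env => (_ : Option β).bind (g env)) ih

theorem Wins.mono {N : ℕ} {β : Type} {K : ℕ} {Good : Counts N → Prop}
    {Q Q' : ℕ → Counts N → β → Prop} {t : ℕ} {k : Counts N}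
    {m : (ℕ → Finset (Fin N) → Option (Fin N)) → Option β} (hm : Wins K Good Q t k m)
    (h : ∀ t k b, Q t k b → Q' t k b) : Wins K Good Q' t k m := by
  induction hm with
  | ret h' => exact Wins.ret (h _ _ _ h')
  | bad h' => exact Wins.bad h'
  | ask S hS _ ih => exact Wins.ask S hS ih

/-! ### Independence of successive users -/

section Cylinder

variable {N : ℕ} {Ω : Type*} {X : ℕ → Finset (Fin N) → Ω → Option (Fin N)}

/-- The event that the first `t` users behave as prescribed by `B`. -/
def cylinder (X : ℕ → Finset (Fin N) → Ω → Option (Fin N))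
    (B : ℕ → Set (Finset (Fin N) → Option (Fin N))) (t : ℕ) : Set Ω :=
  ⋂ n ∈ Finset.range t, (fun ω S => X n S ω) ⁻¹' B n

theorem cylinder_update (B : ℕ → Set (Finset (Fin N) → Option (Fin N))) (t : ℕ)
    (A : Set (Finset (Fin N) → Option (Fin N))) :
    cylinder X (Function.update B t A) (t + 1) =
      cylinder X B t ∩ (fun ω S => X t S ω) ⁻¹' A := by
  ext ω
  simp only [cylinder, Finset.mem_range, Set.mem_iInter, Set.mem_inter_iff]
  constructor
  · intro h
    refine ⟨fun n hn => ?_, ?_⟩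
    · have := h n (by omega)
      rwa [Function.update_of_ne (by omega)] at this
    · have := h t (by omega)
      rwa [Function.update_self] at this
  · rintro ⟨h1, h2⟩ n hn
    rcases Nat.lt_succ_iff_lt_or_eq.1 hn with h | rfl
    · rw [Function.update_of_ne (by omega)]
      exact h1 n h
    · rwa [Function.update_self]

end Cylinder

section Probability

variable {N K : ℕ} {Ω : Type*} [MeasurableSpace Ω] {μ : Measure Ω}
  {v : Fin N → ℝ} {X : ℕ → Finset (Fin N) → Ω → Option (Fin N)}

theorem measure_cylinder (hX : IsFeedback μ K v X)
    (B : ℕ → Set (Finset (Fin N) → Option (Fin N))) (t : ℕ) :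
    μ (cylinder X B t) = ∏ n ∈ Finset.range t, μ ((fun ω S => X n S ω) ⁻¹' B n) :=
  hX.indep.measure_inter_preimage_eq_mul (Finset.range t) fun _ _ => trivial

/-- User `t` is unconstrained by a cylinder of length `t`, so prescribing the answer to a single
assortment multiplies the measure by one choice probability. The joint law of the answers to
different assortments plays no role. -/
theorem measure_cylinder_update (hX : IsFeedback μ K v X)
    (B : ℕ → Set (Finset (Fin N) → Option (Fin N))) (t : ℕ) {S : Finset (Fin N)}
    (hS : S.card ≤ K) (x : Option (Fin N)) :
    μ (cylinder X (Function.update B t {f | f S = x}) (t + 1)) =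
      μ (cylinder X B t) * ENNReal.ofReal (choiceProb v S x) := by
  rw [measure_cylinder hX, Finset.prod_range_succ, Function.update_self, measure_cylinder hX,
    ← hX.law t S x hS]
  congr 1
  refine Finset.prod_congr rfl fun n hn => ?_
  rw [Function.update_of_ne (Finset.mem_range.1 hn).ne]

theorem choiceProb_nonneg (hv : ∀ i, 0 ≤ v i) (S : Finset (Fin N)) (x : Option (Fin N)) :
    0 ≤ choiceProb v S x := by
  have h := one_add_sum_pos hv S
  cases x with
  | none => exact (one_div_pos.2 h).le
  | some i =>
      simp only [choiceProb]
      split_ifs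
      · exact div_nonneg (hv i) h.le
      · exact le_rfl

/-- A program that wins against every sequence of good counts fails at most with the probability
bounded by a nonnegative supermartingale `Φ` that is at least `1` at counts that are not good. -/
theorem Wins.measure_fail_le {β : Type} {Good : Counts N → Prop} {Q : ℕ → Counts N → β → Prop}
    {Φ : Counts N → ℝ} (hX : IsFeedback μ K v X) (hv : ∀ i, 0 ≤ v i) (hΦ0 : ∀ k, 0 ≤ Φ k)
    (hΦ : ∀ k S, ∑ x, choiceProb v S x * Φ (k.next S x) ≤ Φ k)
    (hgood : ∀ k, ¬ Good k → 1 ≤ Φ k) {t : ℕ} {k : Counts N}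
    {m : (ℕ → Finset (Fin N) → Option (Fin N)) → Option β} (h : Wins K Good Q t k m)
    (B : ℕ → Set (Finset (Fin N) → Option (Fin N))) :
    μ (cylinder X B t ∩ {ω | ¬ ∃ t' k' b, m (fun t S => X t S ω) = some b ∧ Q t' k' b}) ≤
      μ (cylinder X B t) * ENNReal.ofReal (Φ k) := by
  induction h generalizing B with
  | ret h =>
      rename_i t k b
      have : {ω | ¬ ∃ t' k' b', (some b : Option β) = some b' ∧ Q t' k' b'} = (∅ : Set Ω) := by
        ext ω
        simp only [Set.mem_ofPred_eq, Set.mem_empty_iff_false, iff_false, not_not]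
        exact ⟨t, k, b, rfl, h⟩
      rw [this]
      simp
  | bad h =>
      refine (measure_mono Set.inter_subset_left).trans ?_
      have : (1 : ENNReal) ≤ ENNReal.ofReal (Φ _) := ENNReal.one_le_ofReal.2 (hgood _ h)
      exact le_mul_of_one_le_right' this
  | ask S hS h ih =>
      rename_i t k m
      -- The first question is split according to its answer, which is recorded in a longer
      -- cylinder. The rest of the program only asks users from number `t + 1` on.
      have hcover : cylinder X B t ∩ {ω | ¬ ∃ t' k' b,
          m (X t S ω) (fun t S => X t S ω) = some b ∧ Q t' k' b} ⊆
          ⋃ x, cylinder X (Function.update B t {f | f S = x}) (t + 1) ∩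
            {ω | ¬ ∃ t' k' b, m x (fun t S => X t S ω) = some b ∧ Q t' k' b} := by
        intro ω hω
        rw [Set.mem_iUnion]
        refine ⟨X t S ω, ?_, hω.2⟩
        rw [cylinder_update]
        exact ⟨hω.1, rfl⟩
      refine (measure_mono hcover).trans ((measure_iUnion_fintype_le _ _).trans ?_)
      have hterm : ∀ x, μ (cylinder X (Function.update B t {f | f S = x}) (t + 1) ∩
            {ω | ¬ ∃ t' k' b, m x (fun t S => X t S ω) = some b ∧ Q t' k' b}) ≤
          μ (cylinder X B t) * ENNReal.ofReal (choiceProb v S x * Φ (k.next S x)) := by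
        intro x
        rw [ENNReal.ofReal_mul (choiceProb_nonneg hv S x), ← mul_assoc,
          ← measure_cylinder_update hX B t hS x]
        by_cases hx : ∀ i, x = some i → i ∈ S
        · exact ih x hx _
        -- Answers outside the offered assortment are not covered by the induction hypothesis, but
        -- have probability zero.
        · push Not at hx
          obtain ⟨i, rfl, hi⟩ := hx
          refine (measure_mono Set.inter_subset_left).trans ?_
          rw [measure_cylinder_update hX B t hS]
          simp [choiceProb, hi]
      refine (Finset.sum_le_sum fun x _ => hterm x).trans ?_
      rw [← Finset.mul_sum, ← ENNReal.ofReal_sum_of_nonneg fun x _ =>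
        mul_nonneg (choiceProb_nonneg hv S x) (hΦ0 _)]
      gcongr
      exact hΦ k S

/-- Passing to the complement uses only subadditivity, so the event of success need not be
measurable. -/
theorem Wins.le_measure [IsProbabilityMeasure μ] {β : Type} {Good : Counts N → Prop} {Q : ℕ → Counts N → β → Prop}
    {Φ : Counts N → ℝ} (hX : IsFeedback μ K v X) (hv : ∀ i, 0 ≤ v i) (hΦ0 : ∀ k, 0 ≤ Φ k)
    (hΦ : ∀ k S, ∑ x, choiceProb v S x * Φ (k.next S x) ≤ Φ k)
    (hgood : ∀ k, ¬ Good k → 1 ≤ Φ k) {k : Counts N}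
    {m : (ℕ → Finset (Fin N) → Option (Fin N)) → Option β} (h : Wins K Good Q 0 k m) :
    ENNReal.ofReal (1 - Φ k) ≤
      μ {ω | ∃ t' k' b, m (fun t S => X t S ω) = some b ∧ Q t' k' b} := by
  have h1 := h.measure_fail_le hX hv hΦ0 hΦ hgood fun _ => Set.univ
  simp only [cylinder, Finset.range_zero, Finset.notMem_empty, Set.iInter_of_empty,
    Set.iInter_univ, Set.univ_inter, measure_univ, one_mul] at h1
  set E := {ω | ∃ t' k' b, m (fun t S => X t S ω) = some b ∧ Q t' k' b} with hE
  have h2 : μ Set.univ ≤ μ E + μ Eᶜ := by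
    rw [← Set.union_compl_self E]
    exact measure_union_le _ _
  rw [measure_univ] at h2
  rw [ENNReal.ofReal_sub _ (hΦ0 k), ENNReal.ofReal_one, tsub_le_iff_right]
  exact h2.trans (add_le_add le_rfl h1)

end Probability

/-! ### Exponential supermartingales for the empirical preferences -/

section Chernoff

variable {N K : ℕ} {v : Fin N → ℝ}

/-- The exponential martingale of item `i` with base `y`. -/
noncomputable def expWeight (v : Fin N → ℝ) (y : ℝ) (i : Fin N) (k : Counts N) : ℝ :=
  y ^ k.chosen i * (1 + v i * (1 - y)) ^ k.quits i

theorem expWeight_next_none (y : ℝ) (i : Fin N) (k : Counts N) (S : Finset (Fin N)) :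
    expWeight v y i (k.next S none) =
      (if i ∈ S then 1 + v i * (1 - y) else 1) * expWeight v y i k := by
  simp only [expWeight, Counts.next]
  split_ifs
  · rw [pow_succ]; ring
  · simp

theorem expWeight_next_some (y : ℝ) (i j : Fin N) (k : Counts N) (S : Finset (Fin N)) :
    expWeight v y i (k.next S (some j)) = (if j = i then y else 1) * expWeight v y i k := by
  simp only [expWeight, Counts.next]
  by_cases h : j = i
  · subst h
    rw [Function.update_self, pow_succ, if_pos rfl]; ring
  · rw [Function.update_of_ne (Ne.symm h), if_neg h, one_mul]

/-- If `i ∈ S`, the mean factor is `((1 + v i * (1 - y)) + v i * y + (V - v i)) / (1 + V) = 1`,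
where `V` is the total preference of `S`; otherwise the weight does not change. -/
theorem sum_choiceProb_mul_expWeight (hv : ∀ i, 0 ≤ v i) (y : ℝ) (i : Fin N) (k : Counts N)
    (S : Finset (Fin N)) :
    ∑ x, choiceProb v S x * expWeight v y i (k.next S x) = expWeight v y i k := by
  have hpos := one_add_sum_pos hv S
  rw [Fintype.sum_option, expWeight_next_none]
  simp only [expWeight_next_some, choiceProb]
  have h1 : ∑ j, (if j ∈ S then v j / (1 + ∑ j ∈ S, v j) else 0) *
      ((if j = i then y else 1) * expWeight v y i k) =
      (∑ j ∈ S, v j * (if j = i then y else 1)) / (1 + ∑ j ∈ S, v j) * expWeight v y i k := by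
    rw [Finset.sum_div, Finset.sum_mul, ← Finset.sum_filter_add_sum_filter_not Finset.univ (· ∈ S)]
    rw [Finset.sum_eq_zero (s := Finset.univ.filter (¬ · ∈ S)) fun j hj => by
      rw [if_neg (Finset.mem_filter.1 hj).2, zero_mul], add_zero]
    refine Finset.sum_congr (by ext; simp) fun j hj => ?_
    have hj : j ∈ S := by simpa using hj
    rw [if_pos hj]
    ring
  have h2 : ∑ j ∈ S, v j * (if j = i then y else 1) =
      (∑ j ∈ S, v j) + if i ∈ S then v i * (y - 1) else 0 := by
    rw [← Finset.sum_ite_eq S i fun j => v j * (y - 1), ← Finset.sum_add_distrib]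
    refine Finset.sum_congr rfl fun j _ => ?_
    by_cases h : j = i
    · simp [h]
      ring
    · simp [h, Ne.symm h]
  rw [h1, h2]
  split_ifs <;> field_simp <;> ring

theorem abs_exp_sub_one_sub_le {x : ℝ} (hx : |x| ≤ 1 / 8) :
    |Real.exp x - 1 - x| ≤ 3 / 5 * x ^ 2 := by
  have h := Real.exp_bound (x := x) (by linarith) (n := 3) (by norm_num)
  simp only [Finset.sum_range_succ, Finset.sum_range_zero] at h
  norm_num [Nat.factorial] at h
  have h2 : |x| ^ 3 ≤ 1 / 8 * x ^ 2 := by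
    rw [← sq_abs x, pow_succ]
    nlinarith [sq_nonneg |x|]
  rw [abs_le] at h ⊢
  constructor <;> nlinarith [sq_nonneg x]

/-- Controls the weight per no-purchase. The second-order loss `2 * l ^ 2` is at most half the gain
`l * ε` when `l = ε / 4`, which leaves `ε² / 8` per exploration, the rate built into `schedule`. -/
theorem exp_neg_le_one_add {x l : ℝ} (hx0 : 0 ≤ x) (hx1 : x ≤ 1) (hl0 : 0 ≤ l) (hl : l ≤ 1 / 32) :
    Real.exp (-(l * x + 2 * l ^ 2)) ≤ 1 + x * (1 - Real.exp l) := by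
  have h0 : 0 ≤ l * x + 2 * l ^ 2 := by positivity
  have h1 : l * x + 2 * l ^ 2 ≤ 17 / 16 * l := by nlinarith
  have h2 := abs_exp_sub_one_sub_le (x := -(l * x + 2 * l ^ 2))
    (by rw [abs_neg, abs_of_nonneg h0]; linarith)
  have h3 := abs_exp_sub_one_sub_le (x := l) (by rw [abs_of_nonneg hl0]; linarith)
  have h4 := (abs_le.1 h2).2
  have h5 := (abs_le.1 h3).2
  have h6 : (-(l * x + 2 * l ^ 2)) ^ 2 ≤ (17 / 16 * l) ^ 2 := by
    rw [neg_sq]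
    exact pow_le_pow_left₀ h0 h1 2
  have h7 : x * (Real.exp l - 1 - l) ≤ 1 * (3 / 5 * l ^ 2) :=
    (mul_le_mul_of_nonneg_left h5 hx0).trans
      (mul_le_mul_of_nonneg_right hx1 (by positivity))
  nlinarith

theorem exp_sub_le_one_add {x l : ℝ} (hx0 : 0 ≤ x) (hx1 : x ≤ 1) (hl0 : 0 ≤ l) (hl : l ≤ 1 / 32) :
    Real.exp (l * x - 2 * l ^ 2) ≤ 1 + x * (1 - Real.exp (-l)) := by
  have h0 : |l * x - 2 * l ^ 2| ≤ l := by
    rw [abs_le]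
    constructor <;> nlinarith [mul_nonneg hl0 hx0, mul_le_mul_of_nonneg_left hx1 hl0]
  have h2 := abs_exp_sub_one_sub_le (x := l * x - 2 * l ^ 2) (by linarith)
  have h3 := abs_exp_sub_one_sub_le (x := -l) (by rw [abs_neg, abs_of_nonneg hl0]; linarith)
  have h4 := (abs_le.1 h2).2
  have h5 := (abs_le.1 h3).2
  have h6 : (l * x - 2 * l ^ 2) ^ 2 ≤ l ^ 2 := by
    rw [← sq_abs (l * x - 2 * l ^ 2)]
    exact pow_le_pow_left₀ (abs_nonneg _) h0 2
  have h7 : x * (Real.exp (-l) - 1 - -l) ≤ 1 * (3 / 5 * (-l) ^ 2) :=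
    (mul_le_mul_of_nonneg_left h5 hx0).trans
      (mul_le_mul_of_nonneg_right hx1 (by positivity))
  nlinarith

theorem accuracy_pos (τ : ℕ) : 0 < accuracy τ := by
  unfold accuracy
  positivity

theorem accuracy_le (τ : ℕ) : accuracy τ ≤ 1 / 8 := by
  unfold accuracy
  calc ((1 : ℝ) / 2) ^ (τ + 3) ≤ (1 / 2) ^ 3 :=
        pow_le_pow_of_le_one (by norm_num) (by norm_num) (by omega)
    _ = 1 / 8 := by norm_num

theorem accuracy_succ (τ : ℕ) : accuracy τ = 2 * accuracy (τ + 1) := by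
  unfold accuracy
  rw [show τ + 1 + 3 = τ + 3 + 1 by ring, pow_succ]
  ring

/-- The confidence level of round `τ`. -/
noncomputable def level (N : ℕ) (δ : ℝ) (τ : ℕ) : ℝ := 16 * N * ((τ : ℝ) + 1) ^ 2 / δ

theorem level_pos (hN : 1 ≤ N) {δ : ℝ} (hδ : 0 < δ) (τ : ℕ) : 0 < level N δ τ := by
  have : (0 : ℝ) < N := by exact_mod_cast hN
  unfold level
  positivity

theorem level_le_exp (hN : 1 ≤ N) {δ : ℝ} (hδ : 0 < δ) (τ : ℕ) :
    level N δ τ ≤ Real.exp (schedule N δ τ * accuracy τ ^ 2 / 8) := by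
  rw [← Real.log_le_iff_le_exp (level_pos hN hδ τ)]
  have h1 : 8 / accuracy τ ^ 2 * Real.log (level N δ τ) ≤ schedule N δ τ := Nat.le_ceil _
  have h2 : 0 < accuracy τ ^ 2 := by have := accuracy_pos τ; positivity
  rw [div_mul_eq_mul_div, div_le_iff₀ h2] at h1
  linarith

/-- The counts agree with the preferences, within the accuracies of the first `L` rounds. -/
def Accurate (v : Fin N → ℝ) (δ : ℝ) (L : ℕ) (k : Counts N) : Prop :=
  ∀ τ < L, ∀ i,
    (k.quits i ≤ schedule N δ τ → (k.chosen i : ℝ) ≤ schedule N δ τ * (v i + accuracy τ)) ∧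
    (k.quits i = schedule N δ τ → schedule N δ τ * (v i - accuracy τ) ≤ (k.chosen i : ℝ))

/-- Fewer than `T` no-purchases only help, since each of them lowers the lower bound for the weight.
So upper deviations are already detected during an unfinished exploration, which is what bounds the
fuel. -/
theorem exp_le_expWeight_of_lt {i : Fin N} (hv0 : 0 ≤ v i) (hv1 : v i ≤ 1) {k : Counts N}
    {T : ℕ} {ε : ℝ} (hε0 : 0 ≤ ε) (hε : ε ≤ 1 / 8) (hC : k.quits i ≤ T)
    (hF : T * (v i + ε) < k.chosen i) :
    Real.exp (T * ε ^ 2 / 8) ≤ expWeight v (Real.exp (ε / 4)) i k := by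
  have h1 := exp_neg_le_one_add hv0 hv1 (l := ε / 4) (by linarith) (by linarith)
  have h2 := pow_le_pow_left₀ (Real.exp_pos _).le h1 (k.quits i)
  rw [← Real.exp_nat_mul] at h2
  rw [expWeight, ← Real.exp_nat_mul]
  refine le_trans ?_ (mul_le_mul_of_nonneg_left h2 (Real.exp_pos _).le)
  rw [← Real.exp_add, Real.exp_le_exp]
  have hC' : (k.quits i : ℝ) ≤ T := by exact_mod_cast hC
  have h3 : 0 ≤ ε / 4 * v i + 2 * (ε / 4) ^ 2 := by positivity
  have h4 := mul_le_mul_of_nonneg_right hC' h3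
  have h5 := mul_le_mul_of_nonneg_right hF.le (by positivity : 0 ≤ ε / 4)
  nlinarith

theorem exp_le_expWeight_of_gt {i : Fin N} (hv0 : 0 ≤ v i) (hv1 : v i ≤ 1) {k : Counts N}
    {T : ℕ} {ε : ℝ} (hε0 : 0 ≤ ε) (hε : ε ≤ 1 / 8) (hC : k.quits i = T)
    (hF : k.chosen i < T * (v i - ε)) :
    Real.exp (T * ε ^ 2 / 8) ≤ expWeight v (Real.exp (-(ε / 4))) i k := by
  have h1 := exp_sub_le_one_add hv0 hv1 (l := ε / 4) (by linarith) (by linarith)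
  have h2 := pow_le_pow_left₀ (Real.exp_pos _).le h1 (k.quits i)
  rw [← Real.exp_nat_mul] at h2
  rw [expWeight, ← Real.exp_nat_mul]
  refine le_trans ?_ (mul_le_mul_of_nonneg_left h2 (Real.exp_pos _).le)
  rw [← Real.exp_add, Real.exp_le_exp, hC]
  have h5 := mul_le_mul_of_nonneg_right hF.le (by positivity : 0 ≤ ε / 4)
  nlinarith

/-- The supermartingale that controls all empirical preferences of the first `L` rounds. -/
noncomputable def potential (v : Fin N → ℝ) (δ : ℝ) (L : ℕ) (k : Counts N) : ℝ :=
  ∑ τ ∈ Finset.range L, ∑ i, (expWeight v (Real.exp (accuracy τ / 4)) i k +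
    expWeight v (Real.exp (-(accuracy τ / 4))) i k) / level N δ τ

theorem expWeight_nonneg_of_pos {i : Fin N} (hv0 : 0 ≤ v i) (hv1 : v i ≤ 1) (k : Counts N) (τ : ℕ) :
    0 ≤ expWeight v (Real.exp (accuracy τ / 4)) i k := by
  have h1 := accuracy_pos τ
  have h2 := accuracy_le τ
  have h3 := exp_neg_le_one_add hv0 hv1 (l := accuracy τ / 4) (by linarith) (by linarith)
  exact mul_nonneg (by positivity) (pow_nonneg ((Real.exp_pos _).le.trans h3) _)

theorem expWeight_nonneg_of_neg {i : Fin N} (hv0 : 0 ≤ v i) (hv1 : v i ≤ 1) (k : Counts N) (τ : ℕ) :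
    0 ≤ expWeight v (Real.exp (-(accuracy τ / 4))) i k := by
  have h1 := accuracy_pos τ
  have h2 := accuracy_le τ
  have h3 := exp_sub_le_one_add hv0 hv1 (l := accuracy τ / 4) (by linarith) (by linarith)
  exact mul_nonneg (by positivity) (pow_nonneg ((Real.exp_pos _).le.trans h3) _)

theorem potential_nonneg (hv0 : ∀ i, 0 ≤ v i) (hv1 : ∀ i, v i ≤ 1) (hN : 1 ≤ N) {δ : ℝ}
    (hδ : 0 < δ) (L : ℕ) (k : Counts N) : 0 ≤ potential v δ L k :=
  Finset.sum_nonneg fun τ _ => Finset.sum_nonneg fun i _ => div_nonneg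
    (add_nonneg (expWeight_nonneg_of_pos (hv0 i) (hv1 i) k τ)
      (expWeight_nonneg_of_neg (hv0 i) (hv1 i) k τ)) (level_pos hN hδ τ).le

theorem sum_choiceProb_mul_potential (hv : ∀ i, 0 ≤ v i) (δ : ℝ) (L : ℕ) (k : Counts N)
    (S : Finset (Fin N)) :
    ∑ x, choiceProb v S x * potential v δ L (k.next S x) = potential v δ L k := by
  simp only [potential, Finset.mul_sum]
  rw [Finset.sum_comm]
  refine Finset.sum_congr rfl fun τ _ => ?_
  rw [Finset.sum_comm]
  refine Finset.sum_congr rfl fun i _ => ?_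
  rw [← sum_choiceProb_mul_expWeight hv (Real.exp (accuracy τ / 4)) i k S,
    ← sum_choiceProb_mul_expWeight hv (Real.exp (-(accuracy τ / 4))) i k S,
    ← Finset.sum_add_distrib, Finset.sum_div]
  exact Finset.sum_congr rfl fun x _ => by ring

theorem one_le_potential (hv0 : ∀ i, 0 ≤ v i) (hv1 : ∀ i, v i ≤ 1) (hN : 1 ≤ N) {δ : ℝ}
    (hδ : 0 < δ) (L : ℕ) (k : Counts N) (h : ¬ Accurate v δ L k) : 1 ≤ potential v δ L k := by
  have hterm : ∀ τ i, 0 ≤ (expWeight v (Real.exp (accuracy τ / 4)) i k +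
      expWeight v (Real.exp (-(accuracy τ / 4))) i k) / level N δ τ := fun τ i => div_nonneg
    (add_nonneg (expWeight_nonneg_of_pos (hv0 i) (hv1 i) k τ)
      (expWeight_nonneg_of_neg (hv0 i) (hv1 i) k τ)) (level_pos hN hδ τ).le
  unfold Accurate at h
  push Not at h
  obtain ⟨τ, hτ, i, h⟩ := h
  have hε0 := accuracy_pos τ
  have hε := accuracy_le τ
  have hlev := level_le_exp hN hδ τ
  have hp := expWeight_nonneg_of_pos (hv0 i) (hv1 i) k τ
  have hn := expWeight_nonneg_of_neg (hv0 i) (hv1 i) k τ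
  have hone : 1 ≤ (expWeight v (Real.exp (accuracy τ / 4)) i k +
      expWeight v (Real.exp (-(accuracy τ / 4))) i k) / level N δ τ := by
    rw [le_div_iff₀ (level_pos hN hδ τ), one_mul]
    by_cases hcase : k.quits i ≤ schedule N δ τ ∧
        schedule N δ τ * (v i + accuracy τ) < (k.chosen i : ℝ)
    · have := exp_le_expWeight_of_lt (hv0 i) (hv1 i) hε0.le hε hcase.1 hcase.2
      linarith
    · have h' := h fun h1 => not_lt.1 fun h2 => hcase ⟨h1, h2⟩
      have := exp_le_expWeight_of_gt (hv0 i) (hv1 i) hε0.le hε h'.1 h'.2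
      linarith
  refine hone.trans ?_
  refine le_trans ?_ (Finset.single_le_sum
    (f := fun τ => ∑ i, (expWeight v (Real.exp (accuracy τ / 4)) i k +
      expWeight v (Real.exp (-(accuracy τ / 4))) i k) / level N δ τ)
    (fun τ _ => Finset.sum_nonneg fun i _ => hterm τ i) (Finset.mem_range.2 hτ))
  exact Finset.single_le_sum (f := fun i => (expWeight v (Real.exp (accuracy τ / 4)) i k +
      expWeight v (Real.exp (-(accuracy τ / 4))) i k) / level N δ τ)
    (fun i _ => hterm τ i) (Finset.mem_univ i)

theorem sum_inv_sq_le (L : ℕ) :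
    ∑ τ ∈ Finset.range L, 1 / ((τ : ℝ) + 1) ^ 2 ≤ 2 - 1 / (L : ℝ) := by
  induction L with
  | zero => norm_num
  | succ L ih =>
      rw [Finset.sum_range_succ]
      rcases Nat.eq_zero_or_pos L with rfl | hL
      · norm_num
      · have hL' : (0 : ℝ) < L := by exact_mod_cast hL
        have h : 1 / ((L : ℝ) + 1) ^ 2 ≤ 1 / L - 1 / (L + 1) := by
          rw [div_sub_div _ _ (by positivity) (by positivity),
            div_le_div_iff₀ (by positivity) (by positivity)]
          nlinarith
        push_cast
        linarith

/-- Initially all weights are `1`, so round `τ` contributes `2N / level = δ / (8 (τ + 1)²)`, and the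
sum of the inverse squares is at most `2`. -/
theorem potential_zero_le (hN : 1 ≤ N) {δ : ℝ} (hδ : 0 < δ) (L : ℕ) :
    potential v δ L ⟨fun _ => 0, fun _ => 0⟩ ≤ δ := by
  have hN' : (0 : ℝ) < N := by exact_mod_cast hN
  have h1 : potential v δ L ⟨fun _ => 0, fun _ => 0⟩ =
      ∑ τ ∈ Finset.range L, δ / 8 * (1 / ((τ : ℝ) + 1) ^ 2) := by
    refine Finset.sum_congr rfl fun τ _ => ?_
    have : (τ : ℝ) + 1 ≠ 0 := by positivity
    simp only [expWeight, pow_zero, mul_one, level, Finset.sum_const, Finset.card_univ,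
      Fintype.card_fin, nsmul_eq_mul]
    field_simp
    norm_num
  rw [h1, ← Finset.mul_sum]
  have h2 := sum_inv_sq_le L
  have h3 : (0 : ℝ) ≤ 1 / (L : ℝ) := by positivity
  nlinarith

end Chernoff

/-! ### Program logic for executions -/

/-- Started with the ledger `s` and the counts `k`, the execution `m` arrives at a result with
property `Q`, or at counts that are not `Good`. -/
def Runs {N : ℕ} {α : Type} (K : ℕ) (Good : Counts N → Prop)
    (m : (ℕ → Finset (Fin N) → Option (Fin N)) → Exec N α) (s : Ledger N) (k : Counts N)
    (Q : Counts N → α → Ledger N → Prop) : Prop :=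
  Wins K Good (fun t k' (p : α × Ledger N) => p.2.pulls = t ∧ Q k' p.1 p.2) s.pulls k
    fun env => m env s

namespace Runs

variable {N K : ℕ} {α β : Type} {Good : Counts N → Prop} {s : Ledger N} {k : Counts N}

theorem bad {m : (ℕ → Finset (Fin N) → Option (Fin N)) → Exec N α}
    {Q : Counts N → α → Ledger N → Prop} (h : ¬ Good k) : Runs K Good m s k Q :=
  Wins.bad h

theorem bind {m : (ℕ → Finset (Fin N) → Option (Fin N)) → Exec N α}
    {g : (ℕ → Finset (Fin N) → Option (Fin N)) → α → Exec N β}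
    {Q : Counts N → α → Ledger N → Prop} {Q' : Counts N → β → Ledger N → Prop}
    (hm : Runs K Good m s k Q)
    (hg : ∀ k' a s', Q k' a s' → Runs K Good (fun env => g env a) s' k' Q') :
    Runs K Good (fun env => m env >>= g env) s k Q' := by
  refine Wins.bind (g := fun env p => g env p.1 p.2) hm ?_
  rintro t' k' ⟨a, s'⟩ ⟨rfl, h⟩
  exact hg k' a s' h

theorem perform {x : Timed α} {Q : Counts N → α → Ledger N → Prop}
    (h : Q k x.val { s with time := s.time + x.cost }) :
    Runs K Good (fun _ => MNL.perform x) s k Q :=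
  Wins.ret ⟨rfl, h⟩

theorem perform_bind {x : Timed α} {g : (ℕ → Finset (Fin N) → Option (Fin N)) → α → Exec N β}
    {Q : Counts N → β → Ledger N → Prop}
    (h : Runs K Good (fun env => g env x.val) { s with time := s.time + x.cost } k Q) :
    Runs K Good (fun env => MNL.perform x >>= g env) s k Q :=
  h

theorem get_bind {g : (ℕ → Finset (Fin N) → Option (Fin N)) → Ledger N → Exec N β}
    {Q : Counts N → β → Ledger N → Prop} (h : Runs K Good (fun env => g env s) s k Q) :
    Runs K Good (fun env => get >>= g env) s k Q :=
  h

theorem pull_bind {S : List (Fin N)} (hS : S.length ≤ K)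
    {g : (ℕ → Finset (Fin N) → Option (Fin N)) → Option (Fin N) → Exec N β}
    {Q : Counts N → β → Ledger N → Prop}
    (h : ∀ x, (∀ i, x = some i → i ∈ S) → Runs K Good (fun env => g env x)
      { hist := x :: s.hist, time := s.time + (S.length + 1) } (k.next S.toFinset x) Q) :
    Runs K Good (fun env => pull env S >>= g env) s k Q := by
  refine Wins.ask S.toFinset ((List.toFinset_card_le S).trans hS)
    (m := fun x env => g env x { hist := x :: s.hist, time := s.time + (S.length + 1) }) ?_
  intro x hx
  exact h x fun i hi => List.mem_toFinset.1 (hx i hi)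

end Runs

/-! ### Effect and cost of explorations -/

section Exploration

variable {N K : ℕ} {Good : Counts N → Prop}

/-- Every pull that does not end the loop raises the total number of choices, which is at most `M`
while the counts are good. So `fuel` plus this total is preserved and exhausting the fuel means that
the counts are bad. Pulls are balanced as choices plus the one no-purchase. -/
theorem exploreLoop_runs {S : List (Fin N)} (hS : S.length ≤ K) (hSN : S.length ≤ N) {T M : ℕ}
    (hM : ∀ k : Counts N, Good k → (∀ i, k.quits i ≤ T) → ∑ i, k.chosen i ≤ M)
    (fuel : ℕ) (f : Fin N → ℕ) (s : Ledger N) (k : Counts N) (hk : ∀ i, k.quits i ≤ T)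
    (hfuel : M < fuel + ∑ i, k.chosen i) :
    Runs K Good (fun env => exploreLoop env S fuel f) s k fun k' f' s' =>
      (∀ i, k'.chosen i + f i = k.chosen i + f' i) ∧ (∀ i, i ∉ S → f' i = f i) ∧
      (∀ i, k'.quits i = k.quits i + if i ∈ S then 1 else 0) ∧
      s'.pulls + ∑ i, k.chosen i = s.pulls + 1 + ∑ i, k'.chosen i ∧
      s'.time + (3 * N + 5) * s.pulls ≤ s.time + (3 * N + 5) * s'.pulls ∧
      s.pulls + 1 ≤ s'.pulls := by
  induction fuel generalizing f s k with
  | zero =>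
      refine Runs.bad fun hg => ?_
      have := hM k hg hk
      omega
  | succ fuel ih =>
      unfold exploreLoop
      refine Runs.pull_bind hS fun x hx => ?_
      cases x with
      | none =>
          refine Runs.perform ⟨fun i => rfl, fun i _ => rfl, fun i => ?_, ?_, ?_, ?_⟩
          · simp [Counts.next]
          · simp [Counts.next, Ledger.pulls]
          · simp only [Ledger.pulls, List.length_cons, step_cost]
            nlinarith
          · simp [Ledger.pulls]
      | some x =>
          have hxS := hx x rfl
          refine Runs.perform_bind ?_
          have hsum : ∑ i, (k.next S.toFinset (some x)).chosen i = ∑ i, k.chosen i + 1 := by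
            simp only [Counts.next]
            rw [Finset.sum_update_of_mem (Finset.mem_univ x),
              ← Finset.add_sum_erase _ _ (Finset.mem_univ x), Finset.erase_eq]
            ring
          refine Wins.mono (ih _ _ (k.next S.toFinset (some x)) hk (by rw [hsum]; omega)) ?_
          rintro t k' ⟨f', s'⟩ ⟨h0, h1, h2, h3, h4, h5, h6⟩
          simp only [step_val, if_pos hxS, Ledger.pulls, List.length_cons, step_cost] at *
          refine ⟨h0, fun i => ?_, fun i hi => ?_, h3, by omega, by nlinarith, by omega⟩
          · have := h1 i
            by_cases hi : i = x
            · subst hi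
              simp only [Counts.next, Function.update_self] at this
              omega
            · simpa [Counts.next, Function.update_of_ne hi] using this
          · rw [h2 i hi, Function.update_of_ne]
            rintro rfl
            exact hi hxS

theorem foldT_stats_val (f : Fin N → ℕ) {S : List (Fin N)} (hS : S.Nodup) (st : Stats N) :
    (foldT (fun i (st : Stats N) => step 8
      { sum := Function.update st.sum i (st.sum i + f i)
        calls := Function.update st.calls i (st.calls i + 1) : Stats N }) st S).val =
      { sum := fun i => st.sum i + if i ∈ S then f i else 0
        calls := fun i => st.calls i + if i ∈ S then 1 else 0 } := by
  rw [foldT_val]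
  induction S with
  | nil => simp
  | cons x S ih =>
      rw [List.nodup_cons] at hS
      rw [List.foldr_cons, ih hS.2]
      simp only [step_val, hS.1, if_false, add_zero, Stats.mk.injEq]
      constructor <;> funext i <;> by_cases hi : i = x
      · subst hi; simp
      · simp [hi]
      · subst hi; simp
      · simp [hi]

theorem exploreTimes_runs {S : List (Fin N)} (hS : S.length ≤ K) (hSN : S.Nodup) {T M fuel : ℕ}
    (hM : ∀ k : Counts N, Good k → (∀ i, k.quits i ≤ T) → ∑ i, k.chosen i ≤ M) (hfuel : M < fuel)
    (n : ℕ) (st : Stats N) (s : Ledger N) (k : Counts N)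
    (hk : ∀ i, k.quits i + (if i ∈ S then n else 0) ≤ T)
    (hsum : st.sum = k.chosen) (hcalls : st.calls = k.quits) :
    Runs K Good (fun env => exploreTimes fuel env S n st) s k fun k' st' s' =>
      st'.sum = k'.chosen ∧ st'.calls = k'.quits ∧ (∀ i, i ∉ S → k'.chosen i = k.chosen i) ∧
      (∀ i, k'.quits i = k.quits i + if i ∈ S then n else 0) ∧
      s'.pulls + ∑ i, k.chosen i = s.pulls + n + ∑ i, k'.chosen i ∧
      s'.time + (14 * N + 9) * s.pulls ≤ s.time + (14 * N + 9) * s'.pulls + 1 ∧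
      s.pulls + n ≤ s'.pulls := by
  have hlen : S.length ≤ N := by simpa using hSN.length_le_card
  induction n generalizing st s k with
  | zero =>
      unfold exploreTimes
      refine Runs.perform ⟨hsum, hcalls, fun i _ => rfl, fun i => by simp, ?_, ?_, ?_⟩ <;>
        simp only [Ledger.pulls, step_cost] <;> omega
  | succ n ih =>
      unfold exploreTimes exploreSet
      refine Runs.bind (Runs.perform_bind (exploreLoop_runs hS hlen hM fuel _ _ k
        (fun i => (Nat.le_add_right _ _).trans (hk i)) (by omega))) ?_
      rintro k₁ f s₁ ⟨h1, h2, h3, h4, h5, h6⟩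
      refine Runs.perform_bind (Runs.perform_bind ?_)
      rw [foldT_stats_val f hSN st]
      simp only [step_val]
      have hcost := foldT_cost_le (fun i (st : Stats N) => step 8
        { sum := Function.update st.sum i (st.sum i + f i)
          calls := Function.update st.calls i (st.calls i + 1) : Stats N }) st S 8 (by simp)
      refine Wins.mono (ih _ _ k₁ (fun i => ?_) ?_ ?_) ?_
      · have := hk i
        rw [h3]
        split_ifs at this ⊢ <;> omega
      · funext i
        have := h1 i
        simp only [step_val] at this
        show st.sum i + (if i ∈ S then f i else 0) = k₁.chosen i
        split_ifs with hi
        · rw [hsum]; omega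
        · have h2' := h2 i hi
          simp only [step_val] at h2'
          rw [hsum]; omega
      · funext i
        rw [hcalls, h3]
      · rintro t k' ⟨st', s'⟩ ⟨i0, i1, i2, i3, i4, i5, i6, i7⟩
        refine ⟨i0, i1, i2, fun i hi => ?_, fun i => ?_, ?_, ?_, ?_⟩
        · have := h1 i
          have h2' := h2 i hi
          simp only [step_val] at this h2'
          rw [i3 i hi]
          omega
        · rw [i4, h3]
          split_ifs <;> omega
        · simp only [Ledger.pulls] at *
          omega
        · simp only [Ledger.pulls, step_cost] at *
          nlinarith
        · simp only [Ledger.pulls] at *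
          omega

theorem exploreBlocks_runs {T M fuel : ℕ}
    (hM : ∀ k : Counts N, Good k → (∀ i, k.quits i ≤ T) → ∑ i, k.chosen i ≤ M) (hfuel : M < fuel)
    (n : ℕ) (Ss : List (List (Fin N))) (hSs : ∀ S ∈ Ss, S.length ≤ K) (hnodup : Ss.flatten.Nodup)
    (st : Stats N) (s : Ledger N) (k : Counts N)
    (hk : ∀ i, k.quits i + (if i ∈ Ss.flatten then n else 0) ≤ T)
    (hsum : st.sum = k.chosen) (hcalls : st.calls = k.quits) :
    Runs K Good (fun env => exploreBlocks fuel env n Ss st) s k fun k' st' s' =>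
      st'.sum = k'.chosen ∧ st'.calls = k'.quits ∧
      (∀ i, i ∉ Ss.flatten → k'.chosen i = k.chosen i) ∧
      (∀ i, k'.quits i = k.quits i + if i ∈ Ss.flatten then n else 0) ∧
      s'.pulls + ∑ i, k.chosen i = s.pulls + n * Ss.length + ∑ i, k'.chosen i ∧
      s'.time + (14 * N + 9) * s.pulls ≤
        s.time + (14 * N + 9) * s'.pulls + 3 * Ss.length + 1 ∧
      s.pulls + n * Ss.length ≤ s'.pulls := by
  induction Ss generalizing st s k with
  | nil =>
      unfold exploreBlocks
      refine Runs.perform ⟨hsum, hcalls, fun i _ => rfl, fun i => by simp, ?_, ?_, ?_⟩ <;>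
        simp only [Ledger.pulls, step_cost, List.length_nil] <;> omega
  | cons S Ss ih =>
      rw [List.flatten_cons, List.nodup_append] at hnodup
      obtain ⟨hS1, hS2, hS3⟩ := hnodup
      have hdisj : ∀ i, i ∈ S → i ∉ Ss.flatten := fun i h1 h2 => hS3 i h1 i h2 rfl
      have hmem : ∀ i, i ∈ (S :: Ss).flatten ↔ i ∈ S ∨ i ∈ Ss.flatten := fun i => by
        rw [List.flatten_cons, List.mem_append]
      have hsplit : ∀ i, (if i ∈ (S :: Ss).flatten then n else 0) =
          (if i ∈ S then n else 0) + if i ∈ Ss.flatten then n else 0 := by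
        intro i
        have := hdisj i
        by_cases h1 : i ∈ S <;> by_cases h2 : i ∈ Ss.flatten <;> simp_all
      simp only [hsplit] at hk ⊢
      unfold exploreBlocks
      refine Runs.bind (exploreTimes_runs (hSs S List.mem_cons_self) hS1 hM hfuel n st s k
        (fun i => by have := hk i; omega) hsum hcalls) ?_
      rintro k₁ st₁ s₁ ⟨h1, h2, h3, h4, h5, h6, h7⟩
      refine Runs.perform_bind ?_
      simp only [step_val]
      refine Wins.mono (ih (fun S hS => hSs S (List.mem_cons_of_mem _ hS)) hS2 st₁ _ k₁
        (fun i => by have := hk i; rw [h4]; omega) h1 h2) ?_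
      rintro t k' ⟨st', s'⟩ ⟨i0, i1, i2, i3, i4, i5, i6, i7⟩
      refine ⟨i0, i1, i2, fun i hi => ?_, fun i => ?_, ?_, ?_, ?_⟩
      · rw [hmem, not_or] at hi
        rw [i3 i hi.2, h3 i hi.1]
      · rw [i4, h4]
        omega
      · simp only [Ledger.pulls, List.length_cons, mul_add, mul_one] at *
        omega
      · simp only [Ledger.pulls, step_cost, List.length_cons] at *
        omega
      · simp only [Ledger.pulls, List.length_cons, mul_add, mul_one] at *
        omega

end Exploration

/-! ### The schedule -/

section Schedule

variable {N : ℕ} {δ : ℝ}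

/-- `T_{τ-1}`, the number of explorations of each surviving item before round `τ`. -/
noncomputable def priorCalls (N : ℕ) (δ : ℝ) : ℕ → ℕ
  | 0 => 0
  | τ + 1 => schedule N δ τ

theorem two_le_log_level (hN : 1 ≤ N) (hδ : 0 < δ) (hδ1 : δ < 1) (τ : ℕ) :
    2 ≤ Real.log (level N δ τ) := by
  rw [Real.le_log_iff_exp_le (level_pos hN hδ τ)]
  have h1 : Real.exp 2 ≤ 16 := by
    have h2 := Real.exp_one_lt_d9
    have h3 : Real.exp 2 = Real.exp 1 * Real.exp 1 := by rw [← Real.exp_add]; norm_num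
    have h4 := Real.exp_pos 1
    rw [h3]
    nlinarith
  refine h1.trans ?_
  have hN' : (1 : ℝ) ≤ N := by exact_mod_cast hN
  have h2 : (1 : ℝ) ≤ ((τ : ℝ) + 1) ^ 2 := one_le_pow₀ (by linarith [Nat.cast_nonneg (α := ℝ) τ])
  rw [level, le_div_iff₀ hδ]
  have : (1 : ℝ) ≤ N * ((τ : ℝ) + 1) ^ 2 := by nlinarith
  nlinarith

/-- Halving `ε` quadruples `8 / ε²`, and the logarithm does not decrease. The strict growth
guarantees a new exploration in each round, so linear costs of a round can be charged to pulls. -/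
theorem schedule_succ_le (hN : 1 ≤ N) (hδ : 0 < δ) (hδ1 : δ < 1) (τ : ℕ) :
    schedule N δ τ + 1 ≤ schedule N δ (τ + 1) := by
  have h1 := two_le_log_level hN hδ hδ1 τ
  have hε := accuracy_pos (τ + 1)
  have hε1 := accuracy_le τ
  have h2 : Real.log (level N δ τ) ≤ Real.log (level N δ (τ + 1)) := by
    refine Real.log_le_log (level_pos hN hδ τ) ?_
    unfold level
    push_cast
    gcongr
    linarith
  have hx : 1 ≤ 8 / accuracy τ ^ 2 * Real.log (level N δ τ) := by
    have h3 : 1 ≤ 8 / accuracy τ ^ 2 := by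
      rw [le_div_iff₀ (by have := accuracy_pos τ; positivity)]
      nlinarith [accuracy_pos τ]
    nlinarith
  have h3 : 8 / accuracy τ ^ 2 * Real.log (level N δ τ) + 1 ≤
      8 / accuracy (τ + 1) ^ 2 * Real.log (level N δ (τ + 1)) := by
    have h4 : 8 / accuracy (τ + 1) ^ 2 = 4 * (8 / accuracy τ ^ 2) := by
      rw [accuracy_succ τ]
      field_simp
      norm_num
    rw [h4]
    have h5 : 0 < 8 / accuracy τ ^ 2 := by have := accuracy_pos τ; positivity
    nlinarith [mul_le_mul_of_nonneg_left h2 h5.le]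
  change ⌈8 / accuracy τ ^ 2 * Real.log (level N δ τ)⌉₊ + 1 ≤
    ⌈8 / accuracy (τ + 1) ^ 2 * Real.log (level N δ (τ + 1))⌉₊
  rw [← Nat.ceil_add_one (by linarith)]
  exact Nat.ceil_mono h3

theorem schedule_mono (hN : 1 ≤ N) (hδ : 0 < δ) (hδ1 : δ < 1) : Monotone (schedule N δ) :=
  monotone_nat_of_le_succ fun τ => (Nat.le_succ _).trans (schedule_succ_le hN hδ hδ1 τ)

theorem schedule_pos (hN : 1 ≤ N) (hδ : 0 < δ) (hδ1 : δ < 1) (τ : ℕ) : 1 ≤ schedule N δ τ := by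
  refine Nat.ceil_pos.2 ?_
  have h1 : 2 ≤ Real.log (16 * N * ((τ : ℝ) + 1) ^ 2 / δ) := two_le_log_level hN hδ hδ1 τ
  have := accuracy_pos τ
  positivity

theorem priorCalls_add_newCalls (hN : 1 ≤ N) (hδ : 0 < δ) (hδ1 : δ < 1) (τ : ℕ) :
    priorCalls N δ τ + newCalls N δ τ = schedule N δ τ := by
  cases τ with
  | zero => simp [priorCalls, newCalls]
  | succ τ =>
      have := schedule_succ_le hN hδ hδ1 τ
      simp only [priorCalls, newCalls]
      omega

theorem one_le_newCalls (hN : 1 ≤ N) (hδ : 0 < δ) (hδ1 : δ < 1) (τ : ℕ) :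
    1 ≤ newCalls N δ τ := by
  cases τ with
  | zero => exact schedule_pos hN hδ hδ1 0
  | succ τ =>
      have := schedule_succ_le hN hδ hδ1 τ
      simp only [newCalls]
      omega

end Schedule

/-! ### The rounds of the algorithm -/

section Rounds

variable {N K : ℕ} {r v : Fin N → ℝ} {δ : ℝ}

theorem foldT_bounds_val (f g : Fin N → ℝ) (I : List (Fin N)) :
    (foldT (fun i (ab : (Fin N → ℝ) × (Fin N → ℝ)) => step 12
      (Function.update ab.1 i (f i), Function.update ab.2 i (g i)))
      ((fun _ => 0), (fun _ => 0)) I).val =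
      (fun i => if i ∈ I then f i else 0, fun i => if i ∈ I then g i else 0) := by
  rw [foldT_val]
  induction I with
  | nil => simp
  | cons x I ih =>
      rw [List.foldr_cons, ih]
      simp only [step_val, Prod.mk.injEq]
      constructor <;> funext i <;> by_cases hi : i = x
      · subst hi; simp
      · simp [hi]
      · subst hi; simp
      · simp [hi]

theorem foldT_above_val (R : ℝ) (C : List (Fin N)) :
    (foldT (fun i t => step 3 (decide (R < r i) && t)) true C).val = true ↔
      ∀ i ∈ C, R < r i := by
  rw [foldT_val]
  induction C with
  | nil => simp
  | cons x C ih =>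
      rw [List.foldr_cons]
      simp only [step_val, Bool.and_eq_true, decide_eq_true_eq, List.forall_mem_cons] at ih ⊢
      rw [ih]

/-- Number of steps of a round apart from the exploration. -/
def roundCost (N : ℕ) : ℕ := 37 * N + 1533 + 1500 * (N ^ 2 * Nat.clog 2 N)

/-- Round `τ` is entered only while the accuracy is not yet sufficient. -/
structure Active (K : ℕ) (r v : Fin N → ℝ) (τ : ℕ) : Prop where
  exists_gap_le : ∃ i, gap r K v i ≤ 16 * K * accuracy τ
  sum_best_le : 1 + ∑ i ∈ best r K v, v i ≤ 256 * K ^ 2 * H₂ r K v * accuracy τ ^ 2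

/-- What holds at the beginning of round `τ`. -/
structure RoundInv (K : ℕ) (r v : Fin N → ℝ) (δ : ℝ) (Z : Fin N → ℝ) (τ : ℕ) (I : List (Fin N))
    (st : Stats N) (k : Counts N) (s : Ledger N) : Prop where
  nodup : I.Nodup
  best_subset : best r K v ⊆ I.toFinset
  sum_eq : st.sum = k.chosen
  calls_eq : st.calls = k.quits
  quits_eq : ∀ i ∈ I, k.quits i = priorCalls N δ τ
  quits_le : ∀ i, k.quits i ≤ priorCalls N δ τ
  item_le : ∀ i, i ∉ best r K v → (k.chosen i : ℝ) + k.quits i / K ≤ Z i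
  pulls_le : (s.pulls : ℝ) ≤
    (∑ i, (k.chosen i : ℝ)) + (∑ i, (k.quits i : ℝ)) / K + priorCalls N δ τ
  le_pulls : τ ≤ s.pulls
  time_le : s.time ≤ (14 * N + 9) * s.pulls + roundCost N * τ + (4 * N + 2)
  gap_le : ∀ i ∈ I, i ∉ best r K v → gap r K v i ≤ 16 * K * accuracy τ
  active : Active K r v τ

/-- What holds when the algorithm returns `C` in round `τ`. -/
structure Returned (K : ℕ) (r v : Fin N → ℝ) (δ : ℝ) (Z : Fin N → ℝ) (τ : ℕ) (C : List (Fin N))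
    (s : Ledger N) : Prop where
  eq_best : C.toFinset = best r K v
  active : Active K r v τ
  pulls_le : (s.pulls : ℝ) ≤ (∑ i ∈ Finset.univ \ best r K v, Z i) +
    schedule N δ τ * (∑ i ∈ best r K v, (v i + accuracy τ + 1 / K)) + schedule N δ τ
  le_pulls : τ + 1 ≤ s.pulls
  time_le : s.time ≤ (14 * N + 9) * s.pulls + roundCost N * (τ + 1) + (4 * N + 2)

theorem encloses_of_accurate (h : Regular K r v) (hδ : 0 < δ) (hδ1 : δ < 1) {L τ : ℕ}
    (hτ : τ < L) {I : List (Fin N)} (hI : best r K v ⊆ I.toFinset) {k : Counts N}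
    (hk : Accurate v δ L k) (hq : ∀ i ∈ I, k.quits i = schedule N δ τ) :
    Encloses K r v I.toFinset
      (fun i => if i ∈ I then max 0 ((k.chosen i : ℝ) / k.quits i - accuracy τ) else 0)
      (fun i => if i ∈ I then min ((k.chosen i : ℝ) / k.quits i + accuracy τ) 1 else 0)
      (accuracy τ) := by
  have hε := accuracy_pos τ
  have hT : (0 : ℝ) < schedule N δ τ := by exact_mod_cast schedule_pos h.one_le_N hδ hδ1 τ
  have hest : ∀ i ∈ I, (k.chosen i : ℝ) / k.quits i ≤ v i + accuracy τ ∧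
      v i - accuracy τ ≤ (k.chosen i : ℝ) / k.quits i := by
    intro i hi
    obtain ⟨h1, h2⟩ := hk τ hτ i
    rw [hq i hi]
    rw [div_le_iff₀ hT, le_div_iff₀ hT]
    have h1 := h1 (hq i hi).le
    have h2 := h2 (hq i hi)
    constructor <;> linarith
  refine ⟨hI, fun i => ?_, fun i => ?_, fun i hi => ?_, fun i hi => ?_, fun i hi => ?_,
    fun i hi => ?_⟩
  · split_ifs
    · exact le_max_left _ _
    · exact le_rfl
  · split_ifs
    · exact le_min (by positivity) zero_le_one
    · exact le_rfl
  all_goals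
    rw [List.mem_toFinset] at hi
    simp only [hi, if_true]
    obtain ⟨h1, h2⟩ := hest i hi
  · exact max_le (h.v_nonneg i) (by linarith)
  · exact le_min (by linarith) (h.v_le_one i)
  · have := le_max_right 0 ((k.chosen i : ℝ) / k.quits i - accuracy τ)
    linarith
  · have := min_le_left ((k.chosen i : ℝ) / k.quits i + accuracy τ) 1
    linarith

theorem sum_chosen_le (h : Regular K r v) {L τ : ℕ} (hτ : τ < L) {k : Counts N}
    (hk : Accurate v δ L k) (hq : ∀ i, k.quits i ≤ schedule N δ τ) :
    ∑ i, k.chosen i ≤ N * (2 * schedule N δ τ) := by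
  have : ∀ i, k.chosen i ≤ 2 * schedule N δ τ := by
    intro i
    have h1 := (hk τ hτ i).1 (hq i)
    have h2 := h.v_le_one i
    have h3 := accuracy_le τ
    have h4 : (0 : ℝ) ≤ schedule N δ τ := by positivity
    have h5 : (k.chosen i : ℝ) ≤ 2 * schedule N δ τ := by nlinarith
    exact_mod_cast h5
  calc ∑ i, k.chosen i ≤ ∑ _i : Fin N, 2 * schedule N δ τ := Finset.sum_le_sum fun i _ => this i
    _ = _ := by simp

/-- The allowance `Z i` bounds the pulls charged to an item outside the best assortment in whichever
round it is last explored; afterwards its counts are frozen. By `hL` the rounds end before the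
supply `j` does. -/
theorem rounds_runs (h : Regular K r v) (hδ : 0 < δ) (hδ1 : δ < 1)
    {part : List (Option (Fin N)) → List (Fin N) → List (List (Fin N))}
    (hpart : IsPartitionRule K part) {L fuel : ℕ} {Z : Fin N → ℝ}
    (hL : ∀ τ, Active K r v τ → τ < L)
    (hfuel : N * (2 * schedule N δ L) < fuel)
    (hZ : ∀ τ i, Active K r v τ → gap r K v i ≤ 16 * K * accuracy τ →
      schedule N δ τ * (v i + accuracy τ + 1 / K) ≤ Z i)
    (j τ : ℕ) (hj : L ≤ j + τ) (I : List (Fin N)) (st : Stats N) (k : Counts N) (s : Ledger N)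
    (inv : RoundInv K r v δ Z τ I st k s) :
    Runs K (Accurate v δ L) (fun env => rounds fuel env part r K δ j τ I st) s k
      fun _ C s' => ∃ τ', Returned K r v δ Z τ' C s' := by
  have hN := h.one_le_N
  have hK : (0 : ℝ) < K := by exact_mod_cast h.one_le_K
  induction j generalizing τ I st k s with
  | zero =>
      have := hL τ inv.active
      omega
  | succ j ih =>
      have hτ := hL τ inv.active
      have hlenI : I.length ≤ N := by simpa using inv.nodup.length_le_card
      obtain ⟨hp1, hp2, hp3⟩ := hpart s.hist I inv.nodup
      have hcalls := priorCalls_add_newCalls hN hδ hδ1 τ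
      have hnew := one_le_newCalls hN hδ hδ1 τ
      have hmem : ∀ i, i ∈ (part s.hist I).flatten ↔ i ∈ I := fun i => hp3.mem_iff
      have hlenP : (part s.hist I).length ≤ I.length := by
        rw [hp1, Nat.ceil_le]
        exact div_le_self (by positivity) (by exact_mod_cast h.one_le_K)
      unfold rounds
      refine Runs.perform_bind (Runs.perform_bind (Runs.get_bind (Runs.perform_bind ?_)))
      simp only [step_val]
      refine Runs.bind (exploreBlocks_runs (T := schedule N δ τ) (M := N * (2 * schedule N δ L))
        (fun k' hk' hq => (sum_chosen_le h hτ hk' hq).trans ?_) hfuel _ _ hp2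
        (hp3.nodup_iff.2 inv.nodup) st _ k (fun i => ?_) inv.sum_eq inv.calls_eq) ?_
      · have := schedule_mono hN hδ hδ1 hτ.le
        gcongr
      · have := inv.quits_le i
        split_ifs <;> omega
      rintro k₁ st₁ s₁ ⟨h1, h2, h3, h4, h5, h6, h7⟩
      -- Accuracy is checked once the exploration is complete; inaccurate counts count as a win by
      -- definition and are paid for by the potential.
      by_cases hacc : Accurate v δ L k₁
      swap
      · exact Runs.bad hacc
      simp only [hmem] at h3 h4
      have hq1 : ∀ i ∈ I, k₁.quits i = schedule N δ τ := fun i hi => by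
        rw [h4, if_pos hi, inv.quits_eq i hi, hcalls]
      have hq2 : ∀ i, k₁.quits i ≤ schedule N δ τ := fun i => by
        have := inv.quits_le i
        rw [h4]
        split_ifs <;> omega
      have henc := encloses_of_accurate h hδ hδ1 hτ inv.best_subset hacc hq1
      refine Runs.perform_bind (Runs.perform_bind (Runs.perform_bind (Runs.perform_bind
        (Runs.perform_bind ?_))))
      rw [foldT_bounds_val, h1, h2]
      simp only [step_val]
      set a : Fin N → ℝ := fun i =>
        if i ∈ I then max 0 ((k₁.chosen i : ℝ) / k₁.quits i - accuracy τ) else 0 with ha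
      set b : Fin N → ℝ := fun i =>
        if i ∈ I then min ((k₁.chosen i : ℝ) / k₁.quits i + accuracy τ) 1 else 0 with hb
      have hcost1 := foldT_cost_le (fun i (ab : (Fin N → ℝ) × (Fin N → ℝ)) => step 12
        (Function.update ab.1 i (max 0 ((k₁.chosen i : ℝ) / k₁.quits i - accuracy τ)),
          Function.update ab.2 i (min ((k₁.chosen i : ℝ) / k₁.quits i + accuracy τ) 1)))
        ((fun _ => 0), (fun _ => 0)) I 12 (by simp)
      have hcost2 := pruneT_cost_le r K hlenI hN a b
      have hCval := pruneT_val (K := K) h.r_le_one henc.nonneg_left henc.nonneg_right inv.nodup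
      have hCnodup := pruneT_nodup (r := r) (K := K) (a := a) (b := b) inv.nodup
      have hRval := rewardT_val r b hCnodup
      set C := (pruneT r K I a b).val with hC
      have hlenC : C.length ≤ N := by simpa using hCnodup.length_le_card
      have hcost3 := rewardT_cost_le r b C
      have hcost4 := foldT_cost_le (fun i t => step 3 (decide ((rewardT r b C).val < r i) && t))
        true C 3 (by simp)
      have habove := foldT_above_val (r := r) (rewardT r b C).val C
      simp only [step_cost, Ledger.pulls] at h5 h6 h7 ⊢
      have htime := inv.time_le
      simp only [Ledger.pulls] at htime
      generalize htime₂ : s₁.time + _ + _ + _ + _ + _ = time₂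
      have htime₂' : time₂ ≤ (14 * N + 9) * s₁.hist.length + roundCost N * (τ + 1) +
          (4 * N + 2) := by
        unfold roundCost at htime ⊢
        rw [mul_add, mul_one]
        omega
      clear htime₂ hcost1 hcost2 hcost3 hcost4 h6 htime
      have hIne : 1 ≤ (part s.hist I).length := by
        rw [hp1, Nat.one_le_ceil_iff]
        obtain ⟨i, hi⟩ := h.best_nonempty
        have : 0 < I.length := List.length_pos_of_mem (List.mem_toFinset.1 (inv.best_subset hi))
        positivity
      have hpulls : τ + 1 ≤ s₁.hist.length := by
        have h8 := inv.le_pulls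
        simp only [Ledger.pulls] at h8
        nlinarith
      have hchosen : ∀ i ∈ I, (k₁.chosen i : ℝ) + k₁.quits i / K ≤
          schedule N δ τ * (v i + accuracy τ + 1 / K) := by
        intro i hi
        have := (hacc τ hτ i).1 (hq2 i)
        rw [hq1 i hi]
        calc _ ≤ schedule N δ τ * (v i + accuracy τ) + (schedule N δ τ : ℝ) / K := by linarith
          _ = _ := by ring
      have hitem : ∀ i, i ∉ best r K v → (k₁.chosen i : ℝ) + k₁.quits i / K ≤ Z i := by
        intro i hi
        by_cases hiI : i ∈ I
        · exact (hchosen i hiI).trans (hZ τ i inv.active (inv.gap_le i hiI hi))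
        · rw [h3 i hiI, h4, if_neg hiI, add_zero]
          exact inv.item_le i hi
      -- The no-purchases of this round number `newCalls * ⌈|I| / K⌉ ≤ newCalls * (|I| / K + 1)`.
      -- The first part is the increase of `∑ quits / K`, and the roundings up add to `T_τ` in
      -- total.
      have hpulls_le : (s₁.hist.length : ℝ) ≤
          (∑ i, (k₁.chosen i : ℝ)) + (∑ i, (k₁.quits i : ℝ)) / K + schedule N δ τ := by
        have h8 := inv.pulls_le
        simp only [Ledger.pulls] at h8
        have h9 : (∑ i, (k₁.quits i : ℝ)) = (∑ i, (k.quits i : ℝ)) + newCalls N δ τ * I.length := by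
          have : ∀ i, (k₁.quits i : ℝ) =
              (k.quits i : ℝ) + if i ∈ I.toFinset then (newCalls N δ τ : ℝ) else 0 := by
            intro i
            rw [h4]
            simp only [List.mem_toFinset]
            split_ifs <;> simp
          simp only [this, Finset.sum_add_distrib, Finset.sum_ite_mem, Finset.univ_inter,
            Finset.sum_const, List.toFinset_card_of_nodup inv.nodup, nsmul_eq_mul]
          ring
        have h10 : ((part s.hist I).length : ℝ) ≤ I.length / K + 1 := by
          rw [hp1]
          exact (Nat.ceil_lt_add_one (by positivity)).le
        have h11 : (s₁.hist.length : ℝ) + ∑ i, (k.chosen i : ℝ) =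
            s.hist.length + newCalls N δ τ * (part s.hist I).length + ∑ i, (k₁.chosen i : ℝ) := by
          exact_mod_cast h5
        have h12 : (schedule N δ τ : ℝ) = priorCalls N δ τ + newCalls N δ τ := by
          rw [← hcalls]
          push_cast
          ring
        have h13 := mul_le_mul_of_nonneg_left h10 (Nat.cast_nonneg (α := ℝ) (newCalls N δ τ))
        rw [h9, h12, add_div]
        have h14 : (newCalls N δ τ : ℝ) * (I.length / K + 1) =
          newCalls N δ τ * I.length / K + newCalls N δ τ := by ring
        linarith
      by_cases hdone : C.toFinset.card ≤ K ∧ ∀ i ∈ C.toFinset, reward r b C.toFinset < r i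
      · have hcond : (decide (C.length ≤ K) &&
            (foldT (fun i t => step 3 (decide ((rewardT r b C).val < r i) && t)) true C).val) =
            true := by
          rw [Bool.and_eq_true, decide_eq_true_eq, habove, hRval,
            ← List.toFinset_card_of_nodup hCnodup]
          exact ⟨hdone.1, fun i hi => hdone.2 i (List.mem_toFinset.2 hi)⟩
        simp only [hcond, if_true]
        refine Wins.ret ⟨rfl, τ, ?_, inv.active, ?_, hpulls, htime₂'⟩
        · rw [hCval] at hdone ⊢
          exact henc.prune_eq_best h hdone.1 hdone.2
        · refine hpulls_le.trans (add_le_add ?_ le_rfl)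
          rw [Finset.sum_div, ← Finset.sum_add_distrib,
            ← Finset.sum_sdiff (Finset.subset_univ (best r K v)), Finset.mul_sum]
          exact add_le_add (Finset.sum_le_sum fun i hi => hitem i (Finset.mem_sdiff.1 hi).2)
            (Finset.sum_le_sum fun i hi => hchosen i (List.mem_toFinset.1 (inv.best_subset hi)))
      · have hcond : ¬ (decide (C.length ≤ K) &&
            (foldT (fun i t => step 3 (decide ((rewardT r b C).val < r i) && t)) true C).val) =
            true := by
          rw [Bool.and_eq_true, decide_eq_true_eq, habove, hRval,
            ← List.toFinset_card_of_nodup hCnodup]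
          exact fun hc => hdone ⟨hc.1, fun i hi => hc.2 i (List.mem_toFinset.1 hi)⟩
        simp only [hcond]
        rw [hCval] at hdone
        have hCI : ∀ i ∈ C, i ∈ I := fun i hi => by
          have : i ∈ C.toFinset := List.mem_toFinset.2 hi
          rw [hCval] at this
          exact List.mem_toFinset.1 (mem_prune.1 this).1
        have hacc2 := accuracy_succ τ
        refine ih (τ + 1) (by omega) C st₁ k₁ _ ⟨hCnodup, ?_, h1, h2, fun i hi => hq1 i (hCI i hi),
          hq2, hitem, hpulls_le, hpulls, htime₂', ?_, ?_, ?_⟩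
        · rw [hCval]
          exact henc.best_subset_prune h
        · intro i hi hiB
          have hiC : i ∈ C.toFinset := List.mem_toFinset.2 hi
          rw [hCval] at hiC
          have := henc.gap_le_of_mem_prune h hiC hiB
          rw [hacc2] at this
          linarith
        · obtain ⟨i, hi⟩ := henc.exists_gap_le h hdone
          rw [hacc2] at hi
          exact ⟨i, by linarith⟩
        · have := henc.one_add_sum_best_le h hdone
          rw [hacc2] at this
          linarith

end Rounds

/-! ### The complexity bounds -/

section Bounds

variable {N K : ℕ} {r v : Fin N → ℝ} {δ : ℝ}

theorem accuracy_eq (τ : ℕ) : accuracy τ = 1 / (8 * 2 ^ τ) := by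
  rw [accuracy, pow_add, one_div_pow]
  norm_num

theorem Active.exists_two_pow_mul_gap_le {τ : ℕ} (ha : Active K r v τ) :
    ∃ i, 2 ^ τ * gap r K v i ≤ 2 * K := by
  obtain ⟨i, hi⟩ := ha.exists_gap_le
  refine ⟨i, ?_⟩
  rw [accuracy_eq, mul_one_div, le_div_iff₀ (by positivity)] at hi
  linarith

theorem nat_mul_log_two_le {τ : ℕ} {x : ℝ} (hx : 0 < x) (h : 2 ^ τ ≤ 2 * x) :
    τ + 1 ≤ 2 + 3 / 2 * max (Real.log x) 0 := by
  have h1 := Real.log_le_log (by positivity) h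
  rw [Real.log_pow, Real.log_mul (by norm_num) hx.ne'] at h1
  have h2 := Real.log_two_gt_d9
  have h3 := le_max_left (Real.log x) 0
  have h4 := le_max_right (Real.log x) 0
  nlinarith

theorem le_log_mul_H₂ (h : Regular K r v) : 1.09 ≤ Real.log (K * H₂ r K v) := by
  have h3 := three_le_mul_H₂ h
  rw [Real.le_log_iff_exp_le (by linarith)]
  refine le_trans ?_ h3
  have h1 := Real.exp_one_lt_d9
  have h2 := Real.exp_bound_div_one_sub_of_interval (x := 0.09) (by norm_num) (by norm_num)
  have h4 : Real.exp 1.09 = Real.exp 1 * Real.exp 0.09 := by rw [← Real.exp_add]; norm_num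
  rw [h4]
  norm_num at h2
  have h5 := Real.exp_pos 1
  have h6 : Real.exp 0.09 ≤ 100 / 91 := by norm_num; exact h2
  nlinarith [Real.exp_pos (0.09 : ℝ)]

/-- Activity gives `2 ^ τ ≤ 2K / Δ_i` for some `i`, and `1 / Δ_i ≤ H₂`. The additive constant is
absorbed because `ln (K * H₂) ≥ 1.09`. -/
theorem Active.le_log {τ : ℕ} (h : Regular K r v) (ha : Active K r v τ) :
    (τ : ℝ) + 1 ≤ 4 * Real.log (K * H₂ r K v) := by
  obtain ⟨i, hi⟩ := ha.exists_two_pow_mul_gap_le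
  have hg := h.gap_pos i
  have hK : (1 : ℝ) ≤ K := by exact_mod_cast h.one_le_K
  have h1 : 1 / gap r K v i ≤ H₂ r K v := (one_div_gap_le h i).trans (one_div_gap_sq_le_H₂ h i)
  have h2 := le_log_mul_H₂ h
  have h3 : (2 : ℝ) ^ τ ≤ 2 * (K * H₂ r K v) := by
    calc (2 : ℝ) ^ τ ≤ 2 * K / gap r K v i := by rwa [le_div_iff₀ hg]
      _ = 2 * (K * (1 / gap r K v i)) := by ring
      _ ≤ _ := by gcongr
  have h4 := nat_mul_log_two_le (by linarith [three_le_mul_H₂ h]) h3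
  rw [max_eq_left (by linarith)] at h4
  linarith

/-- The logarithmic factor of `pullBound`. -/
noncomputable def logFactor (r : Fin N → ℝ) (K : ℕ) (v : Fin N → ℝ) (δ : ℝ) : ℝ :=
  Real.log ((N / δ) * Real.log (K * H₂ r K v))

theorem logFactor_eq (h : Regular K r v) (hδ : 0 < δ) :
    logFactor r K v δ = Real.log (N / δ) + Real.log (Real.log (K * H₂ r K v)) := by
  have hN : (0 : ℝ) < N := by exact_mod_cast h.one_le_N
  have h1 := le_log_mul_H₂ h
  rw [logFactor, Real.log_mul (by positivity) (by linarith)]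

theorem log_div_nonneg (h : Regular K r v) (hδ : 0 < δ) (hδ1 : δ < 1) :
    0 ≤ Real.log (N / δ) := by
  have hN : (1 : ℝ) ≤ N := by exact_mod_cast h.one_le_N
  refine Real.log_nonneg ?_
  rw [le_div_iff₀ hδ]
  linarith

theorem le_logFactor (h : Regular K r v) (hδ : 0 < δ) (hδ1 : δ < 1) :
    0.08 ≤ logFactor r K v δ := by
  have h1 := le_log_mul_H₂ h
  have h2 := Real.one_sub_inv_le_log_of_pos (x := Real.log (K * H₂ r K v)) (by linarith)
  have h3 : (Real.log (K * H₂ r K v))⁻¹ ≤ 0.92 := by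
    rw [inv_le_comm₀ (by linarith) (by norm_num)]
    refine le_trans ?_ h1
    norm_num
  have h4 := log_div_nonneg h hδ hδ1
  rw [logFactor_eq h hδ]
  linarith

/-- The level is at most `2 ^ 8 * (N / δ) * y ^ 2` with `y = ln (K * H₂)`, so its logarithm is at
most `5.6 + 2Λ` with `Λ = logFactor`. The constants, including the rounding of `T_τ`, are absorbed
by `Λ ≥ 0.08`. -/
theorem Active.schedule_mul_le {τ : ℕ} (h : Regular K r v) (hδ : 0 < δ) (hδ1 : δ < 1)
    (ha : Active K r v τ) :
    (schedule N δ τ : ℝ) * accuracy τ ^ 2 ≤ 600 * logFactor r K v δ := by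
  have hN : (0 : ℝ) < N := by exact_mod_cast h.one_le_N
  have hε := accuracy_pos τ
  have hε1 := accuracy_le τ
  have hy := le_log_mul_H₂ h
  have hΛ := le_logFactor h hδ hδ1
  have hΛ' := logFactor_eq h hδ
  have hNδ := log_div_nonneg h hδ hδ1
  have hτ := ha.le_log h
  set y := Real.log (K * H₂ r K v) with hydef
  have hlevel : Real.log (level N δ τ) ≤ 5.6 + 2 * logFactor r K v δ := by
    have h1 : level N δ τ ≤ 2 ^ 8 * (N / δ) * y ^ 2 := by
      have h2 : ((τ : ℝ) + 1) ^ 2 ≤ (4 * y) ^ 2 := pow_le_pow_left₀ (by positivity) hτ 2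
      calc level N δ τ = 16 * (N / δ) * ((τ : ℝ) + 1) ^ 2 := by rw [level]; ring
        _ ≤ 16 * (N / δ) * (4 * y) ^ 2 := by gcongr
        _ = _ := by ring
    have h2 := Real.log_le_log (level_pos h.one_le_N hδ τ) h1
    rw [Real.log_mul (by positivity) (by positivity), Real.log_mul (by positivity) (by positivity),
      Real.log_pow, Real.log_pow] at h2
    have h3 := Real.log_two_lt_d9
    push_cast at h2
    linarith
  have h1 : (schedule N δ τ : ℝ) ≤ 8 / accuracy τ ^ 2 * Real.log (level N δ τ) + 1 :=
    (Nat.ceil_lt_add_one (mul_nonneg (by positivity)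
      (zero_le_two.trans (two_le_log_level h.one_le_N hδ hδ1 τ)))).le
  have h2 := mul_le_mul_of_nonneg_right h1 (by positivity : 0 ≤ accuracy τ ^ 2)
  have h3 : (8 / accuracy τ ^ 2 * Real.log (level N δ τ) + 1) * accuracy τ ^ 2 =
      8 * Real.log (level N δ τ) + accuracy τ ^ 2 := by
    field_simp
  have h4 : accuracy τ ^ 2 ≤ 1 := pow_le_one₀ hε.le (by linarith)
  linarith

/-- Bound on the choices of, and the share of the explorations spent on, an item outside the best
assortment. -/
noncomputable def itemBound (r : Fin N → ℝ) (K : ℕ) (v : Fin N → ℝ) (δ : ℝ) (i : Fin N) : ℝ :=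
  163200 * logFactor r K v δ * K ^ 2 * ((v i + 1 / K) / gap r K v i ^ 2)

theorem itemBound_nonneg (h : Regular K r v) (hδ : 0 < δ) (hδ1 : δ < 1) (i : Fin N) :
    0 ≤ itemBound r K v δ i := by
  have h1 := le_logFactor h hδ hδ1
  have h2 := h.v_pos i
  unfold itemBound
  have : 0 ≤ logFactor r K v δ := by linarith
  positivity

theorem schedule_mul_le_itemBound (h : Regular K r v) (hδ : 0 < δ) (hδ1 : δ < 1) (τ : ℕ)
    (i : Fin N) (ha : Active K r v τ) (hi : gap r K v i ≤ 16 * K * accuracy τ) :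
    schedule N δ τ * (v i + accuracy τ + 1 / K) ≤ itemBound r K v δ i := by
  have hT := ha.schedule_mul_le h hδ hδ1
  have hΛ := le_logFactor h hδ hδ1
  have hε := accuracy_pos τ
  have hg := h.gap_pos i
  have hg1 := h.gap_le_one i
  have hv := h.v_pos i
  have hK : (0 : ℝ) < K := by exact_mod_cast h.one_le_K
  set ε := accuracy τ
  set g := gap r K v i
  set Λ := logFactor r K v δ
  set T : ℝ := (schedule N δ τ : ℝ)
  have hT0 : 0 ≤ T := Nat.cast_nonneg _
  have h1 : T * g ^ 2 ≤ 256 * K ^ 2 * (600 * Λ) := by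
    calc T * g ^ 2 ≤ T * (16 * K * ε) ^ 2 := by gcongr
      _ = 256 * K ^ 2 * (T * ε ^ 2) := by ring
      _ ≤ _ := by gcongr
  have h2 : T * ε * g ^ 2 ≤ 16 * K * (600 * Λ) := by
    calc T * ε * g ^ 2 ≤ T * ε * g := by
          have : g ^ 2 ≤ g := by nlinarith
          gcongr
      _ ≤ T * ε * (16 * K * ε) := by gcongr
      _ = 16 * K * (T * ε ^ 2) := by ring
      _ ≤ _ := by gcongr
  have h3 : 16 * K * (600 * Λ) ≤ 16 * K ^ 2 * (600 * Λ) * (v i + 1 / K) := by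
    have : (16 : ℝ) * K ^ 2 * (600 * Λ) * (v i + 1 / K) =
        16 * K ^ 2 * (600 * Λ) * v i + 16 * K * (600 * Λ) := by
      field_simp
    rw [this]
    have : 0 ≤ 16 * (K : ℝ) ^ 2 * (600 * Λ) * v i := by positivity
    linarith
  -- The constant is `163200 = 600 * (256 + 16)`: the part with `v i + 1 / K` uses the squared gap
  -- bound, the part with `ε` uses `Δ_i² ≤ Δ_i` and the gap bound once.
  rw [itemBound, ← mul_div_assoc, le_div_iff₀ (by positivity)]
  calc T * (v i + ε + 1 / K) * g ^ 2 = T * g ^ 2 * (v i + 1 / K) + T * ε * g ^ 2 := by ring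
    _ ≤ 256 * K ^ 2 * (600 * Λ) * (v i + 1 / K) + 16 * K ^ 2 * (600 * Λ) * (v i + 1 / K) :=
        add_le_add (mul_le_mul_of_nonneg_right h1 (by positivity)) (h2.trans h3)
    _ = _ := by ring

/-- The outside items contribute `163200`. For the best items and the rounding of the blocks, `T (1
+ V)` is used twice, with `256 * 600` each, and `T K ε` once, with `16 * 600`; altogether `480000`.
-/
theorem Returned.pulls_le_pullBound {τ : ℕ} {C : List (Fin N)} {s : Ledger N}
    (h : Regular K r v) (hδ : 0 < δ) (hδ1 : δ < 1)
    (hr : Returned K r v δ (itemBound r K v δ) τ C s) :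
    (s.pulls : ℝ) ≤ 480000 * pullBound r K v δ := by
  have hT := hr.active.schedule_mul_le h hδ hδ1
  have hΛ := le_logFactor h hδ hδ1
  have hε := accuracy_pos τ
  have hK : (0 : ℝ) < K := by exact_mod_cast h.one_le_K
  have hsum := hr.active.sum_best_le
  obtain ⟨i, hi⟩ := hr.active.exists_gap_le
  have hg := h.gap_pos i
  have hgH := (one_div_gap_le h i).trans (one_div_gap_sq_le_H₂ h i)
  have hH : 1 ≤ H₂ r K v := (one_le_one_div_gap_sq h i).trans (one_div_gap_sq_le_H₂ h i)
  have hZ : ∑ i ∈ Finset.univ \ best r K v, itemBound r K v δ i ≤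
      163200 * logFactor r K v δ * K ^ 2 * H₂ r K v := by
    refine (Finset.sum_le_sum_of_subset_of_nonneg (Finset.subset_univ _)
      fun i _ _ => itemBound_nonneg h hδ hδ1 i).trans ?_
    simp only [itemBound, ← Finset.mul_sum]
    have h0 : 0 ≤ logFactor r K v δ := by linarith
    have : ∑ i, (v i + 1 / K) / gap r K v i ^ 2 ≤ H₂ r K v := by
      have h1 := (one_le_one_div_gap_sq h i).trans (le_iSup_gap i)
      rw [H₂]
      linarith
    gcongr
  have hbest : ∑ i ∈ best r K v, (v i + accuracy τ + 1 / K) ≤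
      ∑ i ∈ best r K v, v i + K * accuracy τ + 1 := by
    have hc : ((best r K v).card : ℝ) ≤ K := by exact_mod_cast (isBest_best r K v).1
    rw [Finset.sum_add_distrib, Finset.sum_add_distrib]
    simp only [Finset.sum_const, nsmul_eq_mul]
    have h1 : ((best r K v).card : ℝ) * (1 / K) ≤ 1 := by
      rw [mul_one_div, div_le_one hK]
      exact hc
    have h2 : ((best r K v).card : ℝ) * accuracy τ ≤ K * accuracy τ := by gcongr
    linarith
  have hpulls := hr.pulls_le
  have hpb : pullBound r K v δ = K ^ 2 * H₂ r K v * logFactor r K v δ := rfl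
  set ε := accuracy τ
  set Λ := logFactor r K v δ
  set T : ℝ := (schedule N δ τ : ℝ)
  set V := ∑ i ∈ best r K v, v i
  have hT0 : 0 ≤ T := Nat.cast_nonneg _
  have h1 : T * (1 + V) ≤ 256 * K ^ 2 * H₂ r K v * (600 * Λ) := by
    calc T * (1 + V) ≤ T * (256 * K ^ 2 * H₂ r K v * ε ^ 2) := by gcongr
      _ = 256 * K ^ 2 * H₂ r K v * (T * ε ^ 2) := by ring
      _ ≤ _ := by gcongr
  have h2 : T * (K * ε) ≤ 16 * K ^ 2 * H₂ r K v * (600 * Λ) := by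
    -- Some gap is at most `16Kε` and its inverse at most `H₂`; this inserts the missing factor `ε`.
    have h3 : 1 ≤ 16 * K * ε * H₂ r K v := by
      calc (1 : ℝ) = gap r K v i * (1 / gap r K v i) := by field_simp
        _ ≤ 16 * K * ε * H₂ r K v := by gcongr
    calc T * (K * ε) ≤ T * (K * ε) * (16 * K * ε * H₂ r K v) :=
          le_mul_of_one_le_right (by positivity) h3
      _ = 16 * K ^ 2 * H₂ r K v * (T * ε ^ 2) := by ring
      _ ≤ _ := by gcongr
  have h3 := mul_le_mul_of_nonneg_left hbest hT0
  have h4 : 0 ≤ T * V := mul_nonneg hT0 (Finset.sum_nonneg fun i _ => h.v_nonneg i)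
  rw [hpb]
  linarith

/-- For `K ≥ 2` gaps at most one suffice; for `K = 1` some gap is at most `2/3`. -/
theorem three_halves_le_div (h : Regular K r v) : 3 / 2 ≤ K / ⨅ i, gap r K v i := by
  have : Nonempty (Fin N) := ⟨⟨0, h.one_le_N⟩⟩
  obtain ⟨j, hj⟩ := exists_eq_ciInf_of_finite (f := gap r K v)
  have hpos : 0 < ⨅ i, gap r K v i := hj ▸ h.gap_pos j
  have hle : ∀ i, ⨅ i, gap r K v i ≤ gap r K v i :=
    fun i => ciInf_le (Set.finite_range _).bddBelow i
  rw [le_div_iff₀ hpos]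
  rcases h.one_le_K.eq_or_lt with hK | hK
  · obtain ⟨i, hi⟩ := h.exists_gap_le hK.symm
    have := hle i
    rw [← hK]
    push_cast
    rw [← hK] at this hi
    linarith
  · have hK' : (2 : ℝ) ≤ K := by exact_mod_cast hK
    have := (hle j).trans (h.gap_le_one j)
    linarith

theorem Active.le_log_div {τ : ℕ} (h : Regular K r v) (ha : Active K r v τ) :
    (τ : ℝ) + 1 ≤ 8 * Real.log (K / ⨅ i, gap r K v i) := by
  have : Nonempty (Fin N) := ⟨⟨0, h.one_le_N⟩⟩
  obtain ⟨i, hi⟩ := ha.exists_two_pow_mul_gap_le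
  have hx := three_halves_le_div h
  obtain ⟨j, hj⟩ := exists_eq_ciInf_of_finite (f := gap r K v)
  have hpos : 0 < ⨅ i, gap r K v i := hj ▸ h.gap_pos j
  have hle : ⨅ i, gap r K v i ≤ gap r K v i := ciInf_le (Set.finite_range _).bddBelow i
  have h1 : (2 : ℝ) ^ τ ≤ 2 * (K / ⨅ i, gap r K v i) := by
    rw [← mul_div_assoc, le_div_iff₀ hpos]
    refine le_trans ?_ hi
    gcongr
  have h2 := nat_mul_log_two_le (by linarith) h1
  have h3 : 1 / 3 ≤ Real.log (K / ⨅ i, gap r K v i) := by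
    have h4 := Real.one_sub_inv_le_log_of_pos (x := 3 / 2) (by norm_num)
    have h5 := Real.log_le_log (by norm_num) hx
    norm_num at h4 h5 ⊢
    linarith
  rw [max_eq_left (by linarith)] at h2
  linarith

theorem clog_le_log (N : ℕ) : (Nat.clog 2 N : ℝ) ≤ 3 * Real.log N := by
  rcases Nat.lt_or_ge N 2 with hN | hN
  · rw [Nat.clog_of_right_le_one (by omega)]
    interval_cases N <;> simp
  · have h1 : 1 ≤ Nat.clog 2 N := Nat.clog_pos (by norm_num) hN
    have h2 : 2 ^ (Nat.clog 2 N - 1) < N := Nat.pow_pred_clog_lt_self (by norm_num) hN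
    have h3 : (2 : ℝ) ^ (Nat.clog 2 N - 1) ≤ N := by exact_mod_cast h2.le
    have h4 := Real.log_le_log (by positivity) h3
    rw [Real.log_pow, Nat.cast_sub h1] at h4
    have h5 := Real.log_two_gt_d9
    have h6 : Real.log 2 ≤ Real.log N := Real.log_le_log (by norm_num) (by exact_mod_cast hN)
    have h7 : (1 : ℝ) ≤ Nat.clog 2 N := by exact_mod_cast h1
    push_cast at h4
    nlinarith

theorem Returned.time_le_timeBound {τ : ℕ} {C : List (Fin N)} {s : Ledger N}
    (h : Regular K r v) (hδ : 0 < δ) (hδ1 : δ < 1)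
    (hr : Returned K r v δ (itemBound r K v δ) τ C s) :
    (s.time : ℝ) ≤ 1000000000 * timeBound r K v δ := by
  have hpulls := hr.pulls_le_pullBound h hδ hδ1
  have hN : 1 ≤ N := h.one_le_N
  -- The linear cost of a round is charged to pulls, since each round makes at least one; only the
  -- pruning cost is multiplied by the number of rounds.
  have h1 : s.time ≤ 1600 * (N * s.pulls) + 1500 * (N ^ 2 * Nat.clog 2 N * (τ + 1)) := by
    have h2 := hr.time_le
    have h3 := hr.le_pulls
    unfold roundCost at h2
    have h4 : (37 * N + 1533) * (τ + 1) ≤ (37 * N + 1533) * s.pulls := Nat.mul_le_mul_left _ h3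
    have h5 : s.pulls ≤ N * s.pulls := Nat.le_mul_of_pos_left _ hN
    have h6 : N ≤ N * s.pulls := Nat.le_mul_of_pos_right _ (by omega)
    nlinarith
  have h2 : (s.time : ℝ) ≤ 1600 * (N * s.pulls) + 1500 * (N ^ 2 * Nat.clog 2 N * (τ + 1)) := by
    exact_mod_cast h1
  have h3 := clog_le_log N
  have h4 := hr.active.le_log_div h
  have h5 : (0 : ℝ) ≤ Real.log N := Real.log_natCast_nonneg N
  set z := Real.log (K / ⨅ i, gap r K v i) with hz
  have hz0 : 0 ≤ z := by
    have : (0 : ℝ) ≤ (τ : ℝ) + 1 := by positivity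
    linarith
  have h6 : (N : ℝ) ^ 2 * Nat.clog 2 N * (τ + 1) ≤ 24 * ((N : ℝ) ^ 2 * Real.log N * z) := by
    calc (N : ℝ) ^ 2 * Nat.clog 2 N * (τ + 1) ≤ (N : ℝ) ^ 2 * (3 * Real.log N) * (8 * z) := by
          gcongr
      _ = _ := by ring
  have h7 : (N : ℝ) * s.pulls ≤ N * (480000 * pullBound r K v δ) := by gcongr
  have h8 : 0 ≤ (N : ℝ) ^ 2 * Real.log N * z := by positivity
  have h9 : 0 ≤ (N : ℝ) * pullBound r K v δ := by
    have : (0 : ℝ) ≤ s.pulls := by positivity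
    have : 0 ≤ pullBound r K v δ := by linarith
    positivity
  rw [timeBound, ← hz]
  linarith

/-! ### The whole algorithm -/

theorem active_zero (h : Regular K r v) : Active K r v 0 := by
  have hK : (1 : ℝ) ≤ K := by exact_mod_cast h.one_le_K
  have h1 : accuracy 0 = 1 / 8 := by rw [accuracy]; norm_num
  refine ⟨⟨⟨0, h.one_le_N⟩, (h.gap_le_one _).trans ?_⟩, ?_⟩
  · rw [h1]
    linarith
  · have h2 := one_add_sum_le_H₂ h (best r K v)
    have h3 := Finset.sum_nonneg fun i (_ : i ∈ best r K v) => h.v_nonneg i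
    have h4 : (1 : ℝ) ≤ (K : ℝ) ^ 2 := one_le_pow₀ hK
    rw [h1]
    nlinarith

theorem exists_forall_active_lt (h : Regular K r v) : ∃ L, ∀ τ, Active K r v τ → τ < L := by
  refine ⟨⌈4 * Real.log (K * H₂ r K v)⌉₊, fun τ ha => ?_⟩
  have h1 := ha.le_log h
  rw [Nat.lt_ceil]
  linarith

theorem algorithm_runs (h : Regular K r v) (hδ : 0 < δ) (hδ1 : δ < 1)
    {part : List (Option (Fin N)) → List (Fin N) → List (List (Fin N))}
    (hpart : IsPartitionRule K part) {L fuel : ℕ} (hL : ∀ τ, Active K r v τ → τ < L)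
    (hLf : L ≤ fuel) (hfuel : N * (2 * schedule N δ L) < fuel) :
    Runs K (Accurate v δ L) (fun env => algorithm fuel env part r K δ)
      { hist := [], time := 0 } ⟨fun _ => 0, fun _ => 0⟩
      fun _ C s => ∃ τ, Returned K r v δ (itemBound r K v δ) τ C s := by
  unfold algorithm
  refine Runs.perform_bind (Runs.perform_bind ?_)
  simp only [step_val]
  have hK : (1 : ℝ) ≤ K := by exact_mod_cast h.one_le_K
  refine rounds_runs h hδ hδ1 hpart hL hfuel (schedule_mul_le_itemBound h hδ hδ1) fuel 0 hLf _ _ _ _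
    ⟨List.nodup_finRange N, ?_, rfl, rfl, fun _ _ => rfl, fun _ => le_rfl, ?_, ?_, ?_, ?_, ?_,
      active_zero h⟩
  · intro i _
    simp
  · intro i _
    simpa using itemBound_nonneg h hδ hδ1 i
  · simp [Ledger.pulls]
  · simp
  · simp only [step_cost, Ledger.pulls, List.length_nil]
    omega
  · intro i _ _
    refine (h.gap_le_one i).trans ?_
    have h1 : accuracy 0 = 1 / 8 := by rw [accuracy]; norm_num
    rw [h1]
    linarith

end Bounds

end MNL

open MNL MeasureTheory in
theorem theorem2 :
    ∃ c : ℝ, 0 < c ∧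
      ∀ (N K : ℕ) (_ : 2 ≤ N * K) (r v : Fin N → ℝ)
        (_ : ∀ i, 0 < r i ∧ r i ≤ 1) (_ : ∀ i, 0 < v i ∧ v i ≤ 1)
        (_ : ∀ i, gap r K v i ≠ 0) (δ : ℝ) (_ : 0 < δ)
        (part : List (Option (Fin N)) → List (Fin N) → List (List (Fin N)))
        (_ : IsPartitionRule K part)
        (Ω : Type*) [MeasurableSpace Ω] (μ : Measure Ω) [IsProbabilityMeasure μ]
        (X : ℕ → Finset (Fin N) → Ω → Option (Fin N)) (_ : IsFeedback μ K v X),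
        H₂ r K v ≤ 3 * H₁ r K v ∧
        (∀ (I : List (Fin N)) (a b : Fin N → ℝ), I.Nodup → (∀ i, 0 ≤ a i) → (∀ i, 0 ≤ b i) →
          (pruneT r K I a b).val.toFinset = prune r K I.toFinset a b) ∧
        ENNReal.ofReal (1 - δ) ≤ μ {ω | ∃ (C : List (Fin N)) (s : Ledger N),
          Returns (fun t S => X t S ω) part r K δ C s ∧
          C.toFinset = best r K v ∧
          (s.pulls : ℝ) ≤ c * pullBound r K v δ ∧
          (s.time : ℝ) ≤ c * timeBound r K v δ} := by
  refine ⟨1000000000, by norm_num, ?_⟩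
  intro N K hNK r v hr hv hgap δ hδ part hpart Ω _ μ _ X hX
  have h : Regular K r v := ⟨hNK, fun i => (hr i).1, fun i => (hr i).2, fun i => (hv i).1,
    fun i => (hv i).2, hgap⟩
  refine ⟨H₂_le_three_mul_H₁ h, fun I a b hI ha hb => pruneT_val h.r_le_one ha hb hI, ?_⟩
  -- For `δ ≥ 1` the probability bound is void. Otherwise `δ < 1` gives a schedule with positive
  -- logarithms.
  rcases le_or_gt 1 δ with hδ1 | hδ1
  · rw [ENNReal.ofReal_of_nonpos (by linarith)]
    exact zero_le
  obtain ⟨L, hL⟩ := exists_forall_active_lt h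
  -- One amount of fuel serves all good outcomes: `L` for the rounds, and the maximal total number
  -- of choices for each exploration loop.
  have hruns := algorithm_runs h hδ hδ1 hpart hL
    (fuel := L + N * (2 * schedule N δ L) + 1) (by omega) (by omega)
  have hprob := Wins.le_measure hX h.v_nonneg
    (potential_nonneg h.v_nonneg h.v_le_one h.one_le_N hδ L)
    (fun k S => (sum_choiceProb_mul_potential h.v_nonneg δ L k S).le)
    (one_le_potential h.v_nonneg h.v_le_one h.one_le_N hδ L) hruns
  refine (ENNReal.ofReal_le_ofReal ?_).trans (hprob.trans (measure_mono ?_))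
  · linarith [potential_zero_le (v := v) h.one_le_N hδ L]
  · rintro ω ⟨t, k, ⟨C, s⟩, hrun, -, τ, hret⟩
    have hpulls := hret.pulls_le_pullBound h hδ hδ1
    refine ⟨C, s, ⟨_, hrun⟩, hret.eq_best, ?_, hret.time_le_timeBound h hδ hδ1⟩
    have : (0 : ℝ) ≤ s.pulls := by positivity
    linarith
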